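/- **Game.** There are $K\ge 2$ fog nodes and $M$ tasks, with indices $\rho_{k,m}>\tfrac12$, $\epsilon_{k,m}>0$, $\kappa_{k,m}>0$; whenever $\kappa_{k,m}=\epsilon_{k,m}$, some other node $j\ne k$ has $\kappa_{j,m}-\epsilon_{j,m}\le 1$. Node $k$ chooses $x_k\in[0,1]^M$. Its utility is $u_k=\sum_m u_{k,m}$, where $$u_{k,m}=\rho_{k,m}\bigl(1-e^{-a_{k,m}/\rho_{k,m}}\bigr)+\epsilon_{k,m}\sum_i x_{i,m}-\kappa_{k,m}x_{k,m},\qquad a_{k,m}=\frac{x_{k,m}}{\sum_i x_{i,m}}$$ ($a_{k,m}=0$ if the sum is $0$). The game is repeated for $T$ rounds. For every task $m$, node $k$ runs BGAM or LBWI with horizon $T$, using as feedback $u^t$ only its own utility $u_{k,m}$ of round $t$ plus independent centred Gaussian noise (of arbitrary variance, depending on $k,m$ only). All learners randomize independently, except that the LBWI exploration orders may be dependent on each other (see below). **BGAM** (constants $\nu,L,U>0$, $0\le\beta<1$). Put $\xi=\tfrac12$, $\sigma=T^{-1/4}\sqrt{\xi U\xi/(3(L\xi+U))}$, $\alpha=\sigma/\xi$;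 start from $y^1=0$ and momentum $0$. In round $t$ draw $c^t\in\{-1,1\}$ uniformly, play $x^t=y^t+\sigma c^t+\xi$, observe $u^t$, and set $v^t=\beta v^{t-1}+u^tc^t$, $y^{t+1}=P\bigl(y^t+\tfrac{\nu}{\sqrt t}v^t\bigr)$, where $P$ is the projection to $(1-\alpha)[-\xi,\xi]$. **LBWI** (constants $N,A\ge1$; exploration constant $\gamma=\gamma_T\in(0,1]$, the same in all rounds, with $\gamma_T\to0$ and $\gamma_TT^{2/3}/(\log T)^{4/3}\to\infty$ as $T\to\infty$). For $n$ arms with weights $w$ put $p[j]=(1-\gamma)w[j]/\sum_i w[i]+\gamma/n$. In the first $T_1=AN$ rounds, arms $\lambda^t\in\{0,\dots,N-1\}$ are taken from a random exploration order (of any law, independent of all other randomness), $x^t$ is uniform on $[\lambda^t/N,(\lambda^t+1)/N]$, the average utility $\hat\mu[n]$ of each arm is recorded ($0$ for an arm that was never played), and the weights, $\Omega^1\equiv1$, are updated by $\Omega^{t+1}[\lambda^t]=\Omega^t[\lambda^t]\exp(\gamma u^t/(Np^t[\lambda^t]))$. Then $\hat L=N\max_n|\hat\mu[n]-\hat\mu[n+1]|$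 (maximum over neighbouring arms, $0$ if $N=1$), $\tilde L=\hat L+N\sqrt{\tfrac2A\ln(2NT)}$, $\tilde N=N\lceil\tilde L^{2/3}T^{1/3}/N\rceil$, and $\omega^{T_1+1}[n]=\tfrac{N}{\tilde N}\Omega^{T_1}[\lfloor nN/\tilde N\rfloor]$ for $0\le n<\tilde N$. In the rounds $t>T_1$ an arm $\lambda^t$ is drawn from $p^t$ (with $\tilde N$ arms and weights $\omega^t$), $x^t$ is uniform on $[\lambda^t/\tilde N,(\lambda^t+1)/\tilde N]$, and $\omega^{t+1}[\lambda^t]=\omega^t[\lambda^t]\exp(\gamma u^t/(\tilde Np^t[\lambda^t]))$, the other weights being unchanged. **Claim.** The game has a unique (pure) Nash equilibrium $X^*\in[0,1]^{K\times M}$, and the time-averaged joint action $\frac1T\sum_{t=1}^T X^t$ of the horizon-$T$ play converges to $X^*$ in probability as $T\to\infty$. -/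

import Mathlib

open MeasureTheory ProbabilityTheory Filter Topology
open scoped NNReal ENNReal

noncomputable section

/-! The task allocation game -/

/-- Parameters of a task allocation game with `K` fog nodes and `M` tasks: the efficiency
indices `ρ`, the power consumption indices `ε` and the cost indices `κ`. -/
structure TaskGame (K M : ℕ) where
  ρ : Fin K → Fin M → ℝ
  ε : Fin K → Fin M → ℝ
  κ : Fin K → Fin M → ℝ
  ρ_pos : ∀ k m, 0 < ρ k m
  ε_pos : ∀ k m, 0 < ε k m
  κ_pos : ∀ k m, 0 < κ k m

namespace TaskGame

variable {K M : ℕ}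

/-- Proportional allocation `x k / ∑ i, x i` of one task; it is `0` if the sum is `0`. -/
def share (x : Fin K → ℝ) (k : Fin K) : ℝ := x k / ∑ i, x i

/-- Utility of node `k` from task `m`, when the requested fractions of this task are `x`. -/
def taskUtility (G : TaskGame K M) (k : Fin K) (m : Fin M) (x : Fin K → ℝ) : ℝ :=
  G.ρ k m * (1 - Real.exp (-(share x k / G.ρ k m))) + G.ε k m * ∑ i, x i - G.κ k m * x k

/-- Total utility of node `k` under the joint action `X`. -/
def utility (G : TaskGame K M) (k : Fin K) (X : Fin K → Fin M → ℝ) : ℝ :=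
  ∑ m, G.taskUtility k m (fun i => X i m)

/-- `X` is a Nash equilibrium of the game with strategy spaces `[0,1]^M`. -/
def IsNash (G : TaskGame K M) (X : Fin K → Fin M → ℝ) : Prop :=
  (∀ k m, X k m ∈ Set.Icc (0 : ℝ) 1) ∧
    ∀ (k : Fin K) (x : Fin M → ℝ), (∀ m, x m ∈ Set.Icc (0 : ℝ) 1) →
      G.utility k (Function.update X k x) ≤ G.utility k X

end TaskGame

/-! Online learners with bandit feedback -/

/-- The random draws that one learner (one node, one task) can use in one round: a random sign,
two numbers from `[0,1]`, and the next arm of its exploration order. -/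
structure Draw where
  sgn : ℝ
  arm : ℝ
  pos : ℝ
  order : ℕ

/-- A learner: in round `t` it plays `act t d s`, where `d` is the draw and `s` its state;
after observing the utility `u` its state becomes `upd t d u s`. -/
structure Learner where
  State : Type
  init : State
  act : ℕ → Draw → State → ℝ
  upd : ℕ → Draw → ℝ → State → State

/-- Parameters of bandit gradient ascent with momentum. -/
structure BGAM where
  ν : ℝ
  β : ℝ
  L : ℝ
  U : ℝ
  ν_pos : 0 < ν
  β_nonneg : 0 ≤ β
  β_lt_one : β < 1
  L_pos : 0 < L
  U_pos : 0 < U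

namespace BGAM

/-- The shifted action space is `[-ξ, ξ]`. -/
def ξ : ℝ := 1 / 2

/-- The exploration radius for the horizon `T`, with `r = R = ξ`. -/
def σ (p : BGAM) (T : ℕ) : ℝ :=
  (T : ℝ) ^ (-(1 / 4) : ℝ) * √(ξ * p.U * ξ / (3 * (p.L * ξ + p.U)))

def α (p : BGAM) (T : ℕ) : ℝ := p.σ T / ξ

/-- Projection to `(1 - α) [-ξ, ξ]`. -/
def proj (p : BGAM) (T : ℕ) (y : ℝ) : ℝ :=
  max (-((1 - p.α T) * ξ)) (min ((1 - p.α T) * ξ) y)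

/-- Bandit gradient ascent with momentum for the horizon `T`; the state is `(y, v)`. -/
def learner (p : BGAM) (T : ℕ) : Learner where
  State := ℝ × ℝ
  init := (0, 0)
  act _ d s := s.1 + p.σ T * d.sgn + ξ
  upd t d u s :=
    let v := p.β * s.2 + u * d.sgn
    (p.proj T (s.1 + p.ν / √(t : ℝ) * v), v)

end BGAM

/-- Parameters of the Lipschitz bandit with initialization: `N` intervals and `A` pulls per
interval in the first phase, and the exploration constant `γ T` for the horizon `T`. -/
structure LBWI where
  N : ℕ
  A : ℕ
  γ : ℕ → ℝ
  N_pos : 0 < N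
  A_pos : 0 < A
  γ_pos : ∀ T, 0 < γ T
  γ_le_one : ∀ T, γ T ≤ 1
  γ_tendsto : Tendsto γ atTop (𝓝 0)
  γ_rate : Tendsto (fun T : ℕ => γ T * (T : ℝ) ^ (2 / 3 : ℝ) / Real.log T ^ (4 / 3 : ℝ))
    atTop atTop

namespace LBWI

/-- Arm probabilities of EXP3 with `n` arms, weights `w` and exploration constant `γ`. -/
def prob (γ : ℝ) (n : ℕ) (w : ℕ → ℝ) (j : ℕ) : ℝ :=
  (1 - γ) * (w j / ∑ i ∈ Finset.range n, w i) + γ / n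

/-- EXP3 update of the weights after the reward `u` of the arm `j`. -/
def reweight (γ : ℝ) (n : ℕ) (w : ℕ → ℝ) (j : ℕ) (u : ℝ) : ℕ → ℝ :=
  Function.update w j (w j * Real.exp (γ * u / (n * prob γ n w j)))

/-- The arm in `{0, …, n-1}` chosen by a number `a ∈ [0,1]` according to the probabilities
`q 0, …, q (n-1)`: it is `j` if `q 0 + ⋯ + q (j-1) ≤ a < q 0 + ⋯ + q j`. -/
def select (n : ℕ) (q : ℕ → ℝ) (a : ℝ) : ℕ :=
  ((Finset.range (n - 1)).filter fun j => ∑ i ∈ Finset.range (j + 1), q i ≤ a).card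

/-- State: number of pulls `count` and average utility `mean` of the arms of the first phase, the
current number `n` of arms and their current weights `w`. -/
structure State where
  count : ℕ → ℝ
  mean : ℕ → ℝ
  n : ℕ
  w : ℕ → ℝ

/-- Length of the first phase. -/
def T₁ (p : LBWI) : ℕ := p.A * p.N

/-- Crude estimate of the Lipschitz constant from the averages of neighbouring intervals. -/
def Lhat (p : LBWI) (mean : ℕ → ℝ) : ℝ :=
  p.N * ⨆ j : Fin (p.N - 1), |mean j - mean (j + 1)|

def Ltilde (p : LBWI) (T : ℕ) (mean : ℕ → ℝ) : ℝ :=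
  p.Lhat mean + p.N * √(2 / p.A * Real.log (2 * p.N * T))

/-- Number of intervals in the second phase. -/
def Ntilde (p : LBWI) (T : ℕ) (mean : ℕ → ℝ) : ℕ :=
  p.N * ⌈p.Ltilde T mean ^ (2 / 3 : ℝ) * (T : ℝ) ^ (1 / 3 : ℝ) / p.N⌉₊

/-- The arm played in round `t`. In the first phase it is the next arm of the exploration order
(reduction modulo `N` changes nothing for an order with values in `{0, …, N-1}`). -/
def arm (p : LBWI) (T t : ℕ) (d : Draw) (s : State) : ℕ :=
  if t ≤ p.T₁ then d.order % p.N else select s.n (prob (p.γ T) s.n s.w) d.arm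

/-- Lipschitz bandit with initialization for the horizon `T`. At the end of the first phase,
the weight of each old interval is divided equally among the new intervals inside it. -/
def learner (p : LBWI) (T : ℕ) : Learner where
  State := State
  init := { count := fun _ => 0, mean := fun _ => 0, n := p.N, w := fun _ => 1 }
  act t d s := ((p.arm T t d s : ℝ) + d.pos) / s.n
  upd t d u s :=
    let j := p.arm T t d s
    let count' := Function.update s.count j (1 + s.count j)
    let mean' := Function.update s.mean j ((s.mean j * s.count j + u) / (s.count j + 1))
    if t < p.T₁ then
      { count := count', mean := mean', n := s.n, w := reweight (p.γ T) s.n s.w j u }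
    else if t = p.T₁ then
      { count := count', mean := mean', n := p.Ntilde T mean'
        w := fun i => p.N / p.Ntilde T mean' * s.w (i * p.N / p.Ntilde T mean') }
    else
      { s with w := reweight (p.γ T) s.n s.w j u }

end LBWI

/-- The two decision-making policies. -/
inductive Policy where
  | bgam (p : BGAM)
  | lbwi (p : LBWI)

def Policy.learner (T : ℕ) : Policy → Learner
  | .bgam p => p.learner T
  | .lbwi p => p.learner T

/-! Randomness and play -/

/-- Indices of the real random numbers of node `k`, task `m`, round `t`: random sign, choice
of the arm, position inside the interval, and noise of the observed utility. -/
inductive Source (K M : ℕ) where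
  | sgn (k : Fin K) (m : Fin M) (t : ℕ)
  | arm (k : Fin K) (m : Fin M) (t : ℕ)
  | pos (k : Fin K) (m : Fin M) (t : ℕ)
  | noise (k : Fin K) (m : Fin M) (t : ℕ)

/-- Their laws: uniform on `{-1, 1}` (the unit vectors of `ℝ`), uniform on `[0,1]` (twice),
and centred Gaussian with variance `v k m`. -/
def Source.law {K M : ℕ} (v : Fin K → Fin M → ℝ≥0) : Source K M → Measure ℝ
  | .sgn _ _ _ => (1 / 2 : ℝ≥0∞) • Measure.dirac 1 + (1 / 2 : ℝ≥0∞) • Measure.dirac (-1)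
  | .arm _ _ _ => volume.restrict (Set.Icc 0 1)
  | .pos _ _ _ => volume.restrict (Set.Icc 0 1)
  | .noise k m _ => gaussianReal 0 (v k m)

/-- The randomness of the repeated game: independent random numbers `X`, and random exploration
orders, of any law, that are independent of these numbers. -/
structure Randomness (K M : ℕ) (v : Fin K → Fin M → ℝ≥0) {Ω : Type*} [MeasurableSpace Ω]
    (μ : Measure Ω) where
  X : Source K M → Ω → ℝ
  measurable_X : ∀ s, Measurable (X s)
  law_X : ∀ s, μ.map (X s) = s.law v
  indep_X : iIndepFun X μ
  order : Fin K → Fin M → ℕ → Ω → ℕ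
  measurable_order : ∀ k m t, Measurable (order k m t)
  indep_order : IndepFun (fun ω k m t => order k m t ω) (fun ω s => X s ω) μ

namespace Randomness

variable {K M : ℕ} {v : Fin K → Fin M → ℝ≥0} {Ω : Type*} [MeasurableSpace Ω] {μ : Measure Ω}

def draw (R : Randomness K M v μ) (k : Fin K) (m : Fin M) (t : ℕ) (ω : Ω) : Draw where
  sgn := R.X (.sgn k m t) ω
  arm := R.X (.arm k m t) ω
  pos := R.X (.pos k m t) ω
  order := R.order k m t ω

/-- Joint action in round `t`, when the states at the beginning of this round are `s`. -/
def joint (R : Randomness K M v μ) (ℓ : Fin K → Fin M → Learner) (t : ℕ) (ω : Ω)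
    (s : ∀ k m, (ℓ k m).State) (k : Fin K) (m : Fin M) : ℝ :=
  (ℓ k m).act t (R.draw k m t ω) (s k m)

/-- States of the learners after `t` rounds, when every learner observes only the noisy utility of
its own node from its own task. -/
def states (R : Randomness K M v μ) (G : TaskGame K M) (ℓ : Fin K → Fin M → Learner) (ω : Ω) :
    ℕ → ∀ k m, (ℓ k m).State
  | 0 => fun k m => (ℓ k m).init
  | t + 1 => fun k m =>
      (ℓ k m).upd (t + 1) (R.draw k m (t + 1) ω)
        (G.taskUtility k m (fun i => R.joint ℓ (t + 1) ω (R.states G ℓ ω t) i m)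
          + R.X (.noise k m (t + 1)) ω)
        (R.states G ℓ ω t k m)

/-- Joint action in round `t + 1`. -/
def play (R : Randomness K M v μ) (G : TaskGame K M) (ℓ : Fin K → Fin M → Learner) (t : ℕ)
    (ω : Ω) : Fin K → Fin M → ℝ :=
  R.joint ℓ (t + 1) ω (R.states G ℓ ω t)

/-- Average joint action over the rounds `1, …, T`, when node `k` runs `pol k m` for the
task `m` with the horizon `T`. -/
def averagePlay (R : Randomness K M v μ) (G : TaskGame K M) (pol : Fin K → Fin M → Policy)
    (T : ℕ) (ω : Ω) (k : Fin K) (m : Fin M) : ℝ :=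
  (∑ t ∈ Finset.range T, R.play G (fun k m => (pol k m).learner T) t ω k m) / T

end Randomness

end

/-! Analysis of the one-task game -/

namespace FogGame

/-! Utilities are sums over the tasks, so both claims reduce to a game about one task. There only
the net costs `c = κ - ε` matter, because the term `ε` times the demand of the others cannot be
influenced. The gain is concave in the own demand, and for `ρ > 1/2` it is strongly convex in the
total demand of the others.

Suppose that every learner has expected regret `o(T)` against each fixed demand `y > 0`. Then the
law of the joint demand in a uniformly chosen round is asymptotically a coarse correlated
equilibrium. Along an ultrafilter, let `x̄`, `A`, `F` be the limits of the mean demands, shares and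
gains. Jensen's inequality in the demand of the others shows that `F k - c k * x̄ k` is at least the
utility of any constant `y` against the mean demand of the others. Taking `y = x̄ k` and using
Jensen's inequality in the share gives `gain (x̄ k / ∑ x̄) ≤ F k ≤ gain (A k)`, hence `x̄ k / ∑ x̄ ≤
A k`. The left sides add up to one, the right sides to at most one, so all these inequalities are
equalities. Consequently `x̄` is an equilibrium, and the defects in Jensen's inequality, which
control variances, vanish: the demands themselves converge in `L¹`
(`exists_isEq_tendsto_of_regret`). Existence of an equilibrium is thus a by-product of learning,
with no fixed point theorem. Uniqueness (`IsEq.unique`) compares first-order conditions at two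
equilibria, and it makes the limit independent of the ultrafilter.

The regret bounds treat one learner in an environment (`Env`): in each round its state and the
demand of the others do not depend on its own fresh randomness. Conditional expectations are
expressed by resampling single random numbers (`IsLaw.integral_le_of_resample`). For gradient ascent
(`bgam_regret`), sign times utility is on average `σ` times a difference quotient, and the regret is
of order `√T / σ + σ T`, that is `T^(3/4)`. For the Lipschitz bandit (`lbwi_regret`), exponential
weights with `n` arms cost `n log n / γ + γ T + T / n`, where `n` is roughly between `(T log
T)^(1/3)` and a constant multiple of it, and the rate assumed for `γ` makes this `o(T)`. Gaussian
noise makes rewards unbounded, so second-order terms are controlled by exponential moments, and the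
unbounded influence of the first phase is cut off by an event of high probability (`moderate`). -/

/-- The efficiency of a share `a` with efficiency index `ρ`. -/
noncomputable def gain (ρ a : ℝ) : ℝ := ρ * (1 - Real.exp (-(a / ρ)))

/-! ### Monotonicity and strong concavity of the gain -/

section gain

variable {ρ : ℝ}

lemma gain_zero : gain ρ 0 = 0 := by simp [gain]

lemma hasDerivAt_gain (hρ : 0 < ρ) (a : ℝ) : HasDerivAt (gain ρ) (Real.exp (-(a / ρ))) a := by
  have h := ((((hasDerivAt_id a).div_const ρ).neg.exp).const_sub 1).const_mul ρ
  refine h.congr_deriv ?_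
  simp only [id, Pi.neg_apply]
  field_simp

lemma gain_strictMono (hρ : 0 < ρ) : StrictMono (gain ρ) :=
  strictMono_of_deriv_pos fun a => by
    rw [(hasDerivAt_gain hρ a).deriv]; exact Real.exp_pos _

lemma measurable_gain : Measurable (gain ρ) := by unfold gain; fun_prop

lemma gain_nonneg (hρ : 0 < ρ) {a : ℝ} (ha : 0 ≤ a) : 0 ≤ gain ρ a := by
  rw [← gain_zero (ρ := ρ)]; exact (gain_strictMono hρ).monotone ha

/-- A twice differentiable function with second derivative at least `m` on an interval lies
above its tangents by at least `m / 2` times the squared distance. -/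
lemma tangent_add_sq_le {f f' f'' : ℝ → ℝ} {l r m : ℝ}
    (h1 : ∀ x ∈ Set.Icc l r, HasDerivAt f (f' x) x)
    (h2 : ∀ x ∈ Set.Icc l r, HasDerivAt f' (f'' x) x)
    (hm : ∀ x ∈ Set.Icc l r, m ≤ f'' x) {X x : ℝ} (hX : X ∈ Set.Icc l r)
    (hx : x ∈ Set.Icc l r) :
    f X + f' X * (x - X) + m / 2 * (x - X) ^ 2 ≤ f x := by
  have key : ∀ a ∈ Set.Icc l r, ∀ b ∈ Set.Icc l r, a < b → m * (b - a) ≤ f' b - f' a := by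
    intro a ha b hb hab
    have hsub : Set.Icc a b ⊆ Set.Icc l r := Set.Icc_subset_Icc ha.1 hb.2
    obtain ⟨c, hc, hce⟩ := exists_hasDerivAt_eq_slope f' f'' hab
      (fun y hy => (h2 y (hsub hy)).continuousAt.continuousWithinAt)
      (fun y hy => h2 y (hsub (Set.Ioo_subset_Icc_self hy)))
    have h := hm c (hsub (Set.Ioo_subset_Icc_self hc))
    rw [hce, le_div_iff₀ (sub_pos.2 hab)] at h
    exact h
  have hd : ∀ y ∈ Set.Icc l r,
      HasDerivAt (fun y => f y - f' X * (y - X) - m / 2 * (y - X) ^ 2)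
        (f' y - f' X - m * (y - X)) y := by
    intro y hy
    have h := ((h1 y hy).sub (((hasDerivAt_id y).sub_const X).const_mul (f' X))).sub
      ((((hasDerivAt_id y).sub_const X).pow 2).const_mul (m / 2))
    refine h.congr_deriv ?_
    simp only [id]; push_cast; ring
  rcases lt_trichotomy X x with h | h | h
  · have hsub : Set.Icc X x ⊆ Set.Icc l r := Set.Icc_subset_Icc hX.1 hx.2
    obtain ⟨c, hc, hce⟩ := exists_hasDerivAt_eq_slope _ _ h
      (fun y hy => (hd y (hsub hy)).continuousAt.continuousWithinAt)
      (fun y hy => hd y (hsub (Set.Ioo_subset_Icc_self hy)))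
    have h3 := key X hX c (hsub (Set.Ioo_subset_Icc_self hc)) hc.1
    rw [eq_div_iff (sub_pos.2 h).ne'] at hce
    have h4 : 0 ≤ (f' c - f' X - m * (c - X)) * (x - X) :=
      mul_nonneg (by linarith) (by linarith)
    have h5 : (X - X) ^ 2 = 0 := by simp
    rw [hce, h5] at h4
    linarith
  · subst h; simp
  · have hsub : Set.Icc x X ⊆ Set.Icc l r := Set.Icc_subset_Icc hx.1 hX.2
    obtain ⟨c, hc, hce⟩ := exists_hasDerivAt_eq_slope _ _ h
      (fun y hy => (hd y (hsub hy)).continuousAt.continuousWithinAt)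
      (fun y hy => hd y (hsub (Set.Ioo_subset_Icc_self hy)))
    have h3 := key c (hsub (Set.Ioo_subset_Icc_self hc)) X hX hc.2
    rw [eq_div_iff (sub_pos.2 h).ne'] at hce
    have h4 : (f' c - f' X - m * (c - X)) * (X - x) ≤ 0 :=
      mul_nonpos_of_nonpos_of_nonneg (by linarith) (by linarith)
    have h5 : (X - X) ^ 2 = 0 := by simp
    rw [hce, h5] at h4
    linarith

/-- The second derivative is `-exp (-a/ρ) / ρ`, smallest in absolute value at `a = 1`. The quadratic
term later converts near-equality in Jensen's inequality into a small variance of the share. -/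
lemma gain_le_tangent (hρ : 0 < ρ) {a A : ℝ} (ha : a ∈ Set.Icc (0 : ℝ) 1)
    (hA : A ∈ Set.Icc (0 : ℝ) 1) :
    gain ρ a ≤ gain ρ A + Real.exp (-(A / ρ)) * (a - A)
      - Real.exp (-(1 / ρ)) / ρ / 2 * (a - A) ^ 2 := by
  have h := tangent_add_sq_le (f := fun a => -gain ρ a) (f' := fun a => -Real.exp (-(a / ρ)))
    (f'' := fun a => Real.exp (-(a / ρ)) / ρ) (l := 0) (r := 1)
    (m := Real.exp (-(1 / ρ)) / ρ) (fun x _ => (hasDerivAt_gain hρ x).neg)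
    (fun x _ => by
      refine (((hasDerivAt_id x).div_const ρ).neg.exp.neg).congr_deriv ?_
      simp only [id, Pi.neg_apply]; field_simp)
    (fun x hx => by
      have := hx.2
      gcongr) hA ha
  linarith

lemma gain_concave (hρ : 0 < ρ) : ConcaveOn ℝ Set.univ (gain ρ) := by
  have h : ConvexOn ℝ Set.univ (fun a : ℝ => Real.exp (-(a / ρ))) := by
    have := convexOn_exp.comp_linearMap ((-(1 / ρ)) • LinearMap.id : ℝ →ₗ[ℝ] ℝ)
    have e : (fun a : ℝ => Real.exp (-(a / ρ))) =
        Real.exp ∘ ((-(1 / ρ)) • LinearMap.id : ℝ →ₗ[ℝ] ℝ) := by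
      ext a
      simp only [Function.comp, LinearMap.smul_apply, LinearMap.id_apply, smul_eq_mul]
      congr 1
      ring
    rw [e]
    exact this
  refine ⟨convex_univ, fun x _ y _ a b ha hb hab => ?_⟩
  have h1 := h.2 (Set.mem_univ x) (Set.mem_univ y) ha hb hab
  simp only [smul_eq_mul, gain] at *
  have h2 := mul_le_mul_of_nonneg_left h1 hρ.le
  have h3 : a * ρ + b * ρ = ρ := by rw [← add_mul, hab, one_mul]
  nlinarith

lemma abs_gain_sub_le (hρ : 0 < ρ) {a b : ℝ} (ha : 0 ≤ a) (hb : 0 ≤ b) :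
    |gain ρ a - gain ρ b| ≤ |a - b| := by
  have h := (convex_Ici (0 : ℝ)).norm_image_sub_le_of_norm_hasDerivWithin_le
    (f := gain ρ) (f' := fun a => Real.exp (-(a / ρ))) (C := 1)
    (fun x _ => (hasDerivAt_gain hρ x).hasDerivWithinAt)
    (fun x hx => by
      rw [Real.norm_eq_abs, abs_of_pos (Real.exp_pos _), Real.exp_le_one_iff]
      have : 0 ≤ x / ρ := div_nonneg hx hρ.le
      linarith) (x := b) (y := a) hb ha
  simpa using h

lemma gain_le (hρ : 0 < ρ) {a : ℝ} (ha : 0 ≤ a) : gain ρ a ≤ a := by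
  have h := abs_gain_sub_le hρ ha le_rfl
  rw [gain_zero, sub_zero, sub_zero, abs_of_nonneg ha] at h
  exact (le_abs_self _).trans h

end gain

/-! ### The share as a function of the own demand and of the demand of the others -/

section ratio

lemma div_add_nonneg {x S : ℝ} (hx : 0 ≤ x) (hS : 0 ≤ S) : 0 ≤ x / (x + S) := by positivity

lemma div_add_le_one {x S : ℝ} (hx : 0 ≤ x) (hS : 0 ≤ S) : x / (x + S) ≤ 1 :=
  div_le_one_of_le₀ (by linarith) (by linarith)

/-- For `S > 0` the function is `1 - S / (x + S)`. For `S = 0` it jumps from `0` to `1` at the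
endpoint `0`; a downward value at an endpoint does not destroy concavity. -/
lemma concaveOn_div_add {S : ℝ} (hS : 0 ≤ S) :
    ConcaveOn ℝ (Set.Ici 0) (fun x : ℝ => x / (x + S)) := by
  refine ⟨convex_Ici 0, fun x hx y hy a b ha hb hab => ?_⟩
  simp only [Set.mem_Ici, smul_eq_mul] at *
  rcases hS.eq_or_lt with rfl | hS
  · rcases hx.eq_or_lt with rfl | hx
    · rcases hy.eq_or_lt with rfl | hy
      · simp
      · rcases hb.eq_or_lt with rfl | hb
        · simp
        · have : 0 < b * y := by positivity
          simp only [mul_zero, zero_add, add_zero, div_zero, div_self hy.ne', div_self this.ne']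
          linarith
    · rcases ha.eq_or_lt with rfl | ha
      · simp only [zero_mul, zero_add, add_zero] at *
        subst hab; simp
      · have h1 : 0 < a * x := by positivity
        have h2 : 0 ≤ b * y := by positivity
        have h4 : a * x + b * y ≠ 0 := by linarith
        rw [add_zero, add_zero, add_zero, div_self hx.ne', div_self h4]
        have h3 := mul_le_mul_of_nonneg_left (div_self_le_one y) hb
        linarith
  · have e : ∀ z : ℝ, 0 ≤ z → z / (z + S) = 1 - S * (z + S)⁻¹ := by
      intro z hz
      have : z + S ≠ 0 := by positivity
      field_simp; ring
    have hc := (convexOn_zpow (𝕜 := ℝ) (-1)).2 (show x + S ∈ Set.Ioi 0 by simp; positivity)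
      (show y + S ∈ Set.Ioi 0 by simp; positivity) ha hb hab
    simp only [smul_eq_mul, zpow_neg_one] at hc
    rw [e x hx, e y hy, e _ (by positivity)]
    have e2 : a * x + b * y + S = a * (x + S) + b * (y + S) := by
      linear_combination (-S) * hab
    rw [e2]
    have := mul_le_mul_of_nonneg_left hc hS.le
    nlinarith

/-- The constant `1 / z` is uniform in `S`. It must blow up as `z → 0` because of the jump at `0`
for `S = 0`; this is why regret is only measured against positive demands. -/
lemma abs_div_add_sub_le {x y z S : ℝ} (hz : 0 < z) (hx : z ≤ x) (hy : z ≤ y) (hS : 0 ≤ S) :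
    |x / (x + S) - y / (y + S)| ≤ |x - y| / z := by
  have h1 : 0 < x + S := by linarith
  have h2 : 0 < y + S := by linarith
  have e : x / (x + S) - y / (y + S) = (x - y) * (S / ((x + S) * (y + S))) := by
    field_simp; ring
  have h3 : S / ((x + S) * (y + S)) ≤ 1 / z := by
    rw [div_le_div_iff₀ (by positivity) hz]
    have := mul_nonneg (by linarith : 0 ≤ x) h2.le
    nlinarith [mul_nonneg hS (by linarith : 0 ≤ y - z + S)]
  rw [e, abs_mul, abs_of_nonneg (a := S / _) (by positivity), div_eq_mul_one_div |x - y|]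
  gcongr

lemma hasDerivAt_gain_div {ρ : ℝ} (hρ : 0 < ρ) {x S : ℝ} (h : 0 < x + S) :
    HasDerivAt (fun x => gain ρ (x / (x + S)))
      (Real.exp (-(x / (x + S) / ρ)) * (1 - x / (x + S)) / (x + S)) x := by
  have h1 := (hasDerivAt_gain hρ (x / (x + S))).comp x
    ((hasDerivAt_id x).div ((hasDerivAt_id x).add_const S) h.ne')
  refine h1.congr_deriv ?_
  simp only [id]
  field_simp

/-- Strong convexity of the efficiency in the demand of the opponents. -/
lemma gain_div_ge_tangent {ρ y B : ℝ} (hρ : 1 / 2 < ρ) (hy : 0 < y) :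
    ∃ m > 0, ∀ R ∈ Set.Icc 0 B, ∃ q : ℝ, ∀ S ∈ Set.Icc 0 B,
      gain ρ (y / (y + R)) + q * (S - R) + m * (S - R) ^ 2 ≤ gain ρ (y / (y + S)) := by
  have hρ0 : 0 < ρ := by linarith
  rcases lt_or_ge B 0 with hB | hB
  · exact ⟨1, one_pos, fun R hR => absurd (hR.1.trans hR.2) (not_le.2 hB)⟩
  -- The second derivative in `S` is `exp (-a/ρ) * y / (y+S)^3 * (2 - a/ρ)` with `a = y / (y+S) ≤
  -- 1`. The assumption `ρ > 1/2` is exactly what keeps the last factor away from zero; `m` is half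
  -- the product of lower bounds of the three factors.
  have h2 : 0 < 2 - 1 / ρ := by
    rw [sub_pos, div_lt_iff₀ hρ0]; linarith
  refine ⟨Real.exp (-(1 / ρ)) * (y / (y + B) ^ 3) * (2 - 1 / ρ) / 2, by positivity,
    fun R hR => ⟨Real.exp (-(y / (y + R) / ρ)) * (-(y / (y + R) ^ 2)), fun S hS => ?_⟩⟩
  refine tangent_add_sq_le (f := fun S => gain ρ (y / (y + S)))
    (f' := fun S => Real.exp (-(y / (y + S) / ρ)) * (-(y / (y + S) ^ 2)))
    (f'' := fun S => Real.exp (-(y / (y + S) / ρ)) * (y / (y + S) ^ 3) * (2 - y / (y + S) / ρ))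
    (l := 0) (r := B) ?_ ?_ ?_ hR hS
  · intro x hx
    have hx0 : 0 < y + x := by linarith [hx.1]
    have h1 := (hasDerivAt_gain hρ0 (y / (y + x))).comp x
      ((hasDerivAt_const x y).div ((hasDerivAt_id x).const_add y) hx0.ne')
    refine h1.congr_deriv ?_
    simp only [id]
    field_simp
    ring
  · intro x hx
    have hx0 : 0 < y + x := by linarith [hx.1]
    have d1 := (((hasDerivAt_const x y).div ((hasDerivAt_id x).const_add y) hx0.ne').div_const ρ).neg.exp
    have d2 := ((hasDerivAt_const x y).div (((hasDerivAt_id x).const_add y).pow 2)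
      (pow_pos hx0 2).ne').neg
    refine (d1.mul d2).congr_deriv ?_
    simp only [id, Pi.div_apply, Pi.pow_apply, Pi.neg_apply]
    field_simp
    ring
  · intro x hx
    have hx0 : 0 < y + x := by linarith [hx.1]
    have h3 : y / (y + x) ≤ 1 := div_add_le_one hy.le hx.1
    have h4 : x ≤ B := hx.2
    gcongr

end ratio

/-- Utility of a node that requests `x` while the other nodes request `S` in total. -/
noncomputable def payoff (ρ ε κ x S : ℝ) : ℝ := gain ρ (x / (x + S)) + ε * (x + S) - κ * x

/-! ### Concavity and Lipschitz bounds of the payoff in the own demand -/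

section payoff

variable {ρ ε κ : ℝ}

/-- The gain is increasing and concave, so its composition with the concave share is concave; the
remaining terms are affine. -/
lemma concaveOn_payoff (hρ : 0 < ρ) {S : ℝ} (hS : 0 ≤ S) :
    ConcaveOn ℝ (Set.Ici 0) (fun x => payoff ρ ε κ x S) := by
  refine ⟨convex_Ici 0, fun x hx y hy a b ha hb hab => ?_⟩
  have h1 := (concaveOn_div_add hS).2 hx hy ha hb hab
  have h2 := (gain_concave hρ).2 (Set.mem_univ (x / (x + S))) (Set.mem_univ (y / (y + S))) ha hb hab
  have h3 := (gain_strictMono hρ).monotone h1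
  simp only [smul_eq_mul, payoff] at *
  have e : ε * (a * x + b * y + S) = a * (ε * (x + S)) + b * (ε * (y + S)) := by
    linear_combination (-ε * S) * hab
  rw [e]
  nlinarith

lemma abs_payoff_sub_le (hρ : 0 < ρ) {x y z S : ℝ} (hz : 0 < z) (hx : z ≤ x) (hy : z ≤ y)
    (hS : 0 ≤ S) :
    |payoff ρ ε κ x S - payoff ρ ε κ y S| ≤ (1 / z + |ε - κ|) * |x - y| := by
  have h1 := abs_gain_sub_le hρ (div_add_nonneg (hz.le.trans hx) hS)
    (div_add_nonneg (hz.le.trans hy) hS)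
  have h2 := h1.trans (abs_div_add_sub_le hz hx hy hS)
  have e : payoff ρ ε κ x S - payoff ρ ε κ y S =
      (gain ρ (x / (x + S)) - gain ρ (y / (y + S))) + (ε - κ) * (x - y) := by
    unfold payoff; ring
  rw [e]
  refine (abs_add_le _ _).trans ?_
  rw [abs_mul, add_mul]
  refine add_le_add (h2.trans_eq (by ring)) le_rfl

lemma abs_payoff_le (hρ : 0 < ρ) {x S B : ℝ} (hx : x ∈ Set.Icc (0 : ℝ) 1) (hS : S ∈ Set.Icc 0 B) :
    |payoff ρ ε κ x S| ≤ 1 + |ε| * (1 + B) + |κ| := by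
  have h0 := div_add_nonneg hx.1 hS.1
  have h1 := gain_nonneg hρ h0
  have h2 := (gain_le hρ h0).trans (div_add_le_one hx.1 hS.1)
  have h3 : |ε * (x + S)| ≤ |ε| * (1 + B) := by
    rw [abs_mul, abs_of_nonneg (a := x + S) (by linarith [hx.1, hS.1])]
    gcongr; exacts [hx.2, hS.2]
  have h4 : |κ * x| ≤ |κ| := by
    rw [abs_mul, abs_of_nonneg hx.1]
    exact mul_le_of_le_one_right (abs_nonneg _) hx.2
  rw [abs_le] at *
  unfold payoff
  constructor <;> linarith [h3.1, h3.2, h4.1, h4.2]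

/-- Two symmetric evaluations give a supergradient up to a Lipschitz error. -/
lemma payoff_sub_average_le (hρ : 0 < ρ) {x y r S : ℝ} (hS : 0 ≤ S) (hr : 0 < r) (hx : r ≤ x)
    (hy : 4 * r ≤ y) :
    payoff ρ ε κ y S - (payoff ρ ε κ (x + r) S + payoff ρ ε κ (x - r) S) / 2 ≤
      (payoff ρ ε κ (x + r) S - payoff ρ ε κ (x - r) S) / 2 * (y - x) / r
        + (2 / y + |ε - κ|) * (2 * r) := by
  set h := fun x => payoff ρ ε κ x S with hh
  have hc : ConcaveOn ℝ (Set.Ici 0) h := concaveOn_payoff hρ hS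
  have hy0 : 0 < y := by linarith
  have herr : 0 ≤ (2 / y + |ε - κ|) * (2 * r) := by positivity
  have e1 : payoff ρ ε κ (x + r) S = h (x + r) := rfl
  have e2 : payoff ρ ε κ (x - r) S = h (x - r) := rfl
  have e3 : payoff ρ ε κ y S = h y := rfl
  rw [e1, e2, e3]
  have m1 : x - r ∈ Set.Ici (0 : ℝ) := by simp only [Set.mem_Ici]; linarith
  have m2 : x + r ∈ Set.Ici (0 : ℝ) := by simp only [Set.mem_Ici]; linarith
  have m3 : y ∈ Set.Ici (0 : ℝ) := hy0.le
  -- If `y` is outside `[x - r, x + r]`, the chord through the two evaluation points lies above the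
  -- payoff at `y`, and no error term is needed.
  rcases lt_or_ge (x + r) y with c1 | c1
  · have h1 := hc.slope_anti_adjacent m1 m3 (by linarith : x - r < x + r) c1
    rw [div_le_div_iff₀ (by linarith) (by linarith)] at h1
    suffices h y - (h (x + r) + h (x - r)) / 2 ≤ (h (x + r) - h (x - r)) / 2 * (y - x) / r by linarith
    rw [le_div_iff₀ hr]
    nlinarith
  rcases lt_or_ge y (x - r) with c2 | c2
  · have h1 := hc.slope_anti_adjacent m3 m2 c2 (by linarith : x - r < x + r)
    rw [div_le_div_iff₀ (by linarith) (by linarith)] at h1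
    suffices h y - (h (x + r) + h (x - r)) / 2 ≤ (h (x + r) - h (x - r)) / 2 * (y - x) / r by linarith
    rw [le_div_iff₀ hr]
    nlinarith
  -- Now `|y - x| ≤ r`, and `4 * r ≤ y` keeps both evaluation points above `y / 2`, where the
  -- Lipschitz constant is `2 / y + |ε - κ|`.
  have b1 := abs_payoff_sub_le (ε := ε) (κ := κ) hρ (half_pos hy0) (by linarith : y / 2 ≤ y)
    (by linarith : y / 2 ≤ x + r) hS
  have b2 := abs_payoff_sub_le (ε := ε) (κ := κ) hρ (half_pos hy0) (by linarith : y / 2 ≤ y)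
    (by linarith : y / 2 ≤ x - r) hS
  have a1 : |y - (x + r)| ≤ 2 * r := by rw [abs_le]; constructor <;> linarith
  have a2 : |y - (x - r)| ≤ 2 * r := by rw [abs_le]; constructor <;> linarith
  have hL : 0 ≤ 2 / y + |ε - κ| := by positivity
  have e4 : 1 / (y / 2) = 2 / y := by field_simp
  rw [e4] at b1 b2
  have b1' := (le_abs_self _).trans (b1.trans (mul_le_mul_of_nonneg_left a1 hL))
  have b2' := (le_abs_self _).trans (b2.trans (mul_le_mul_of_nonneg_left a2 hL))
  rw [e1, e3] at b1'
  rw [e2, e3] at b2'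
  set E := (2 / y + |ε - κ|) * (2 * r)
  -- The claim is the combination of the two Lipschitz bounds with weights `(1 + th) / 2` and `(1 -
  -- th) / 2`.
  set th := (y - x) / r with hth
  have t1 : th ≤ 1 := by rw [hth, div_le_one hr]; linarith
  have t2 : -1 ≤ th := by rw [hth, le_div_iff₀ hr]; linarith
  have e5 : (h (x + r) - h (x - r)) / 2 * (y - x) / r = (h (x + r) - h (x - r)) / 2 * th := by
    rw [hth]; ring
  rw [e5]
  nlinarith [mul_nonneg (by linarith : 0 ≤ 1 + th) (by linarith : 0 ≤ E - (h y - h (x + r))),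
    mul_nonneg (by linarith : 0 ≤ 1 - th) (by linarith : 0 ≤ E - (h y - h (x - r)))]

end payoff

/-! Equilibria of the one-task game -/

section Equilibrium

variable {K : ℕ} {ρ c x x' : Fin K → ℝ}

/-- Nash equilibria of the game about one task, with efficiency indices `ρ` and net costs `c`. -/
def IsEq (ρ c x : Fin K → ℝ) : Prop :=
  (∀ k, x k ∈ Set.Icc (0 : ℝ) 1) ∧ ∀ k, ∀ y ∈ Set.Icc (0 : ℝ) 1,
    gain (ρ k) (y / (y + (∑ i, x i - x k))) - c k * y ≤
      gain (ρ k) (x k / ∑ i, x i) - c k * x k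

lemma deriv_nonpos_of_right {f : ℝ → ℝ} {f' a b : ℝ} (hf : HasDerivAt f f' a) (hab : a < b)
    (h : ∀ y ∈ Set.Icc a b, f y ≤ f a) : f' ≤ 0 := by
  have h1 := (hasDerivAt_iff_tendsto_slope.1 hf).mono_left
    (nhdsWithin_mono a (show Set.Ioi a ⊆ {a}ᶜ from fun y hy => ne_of_gt hy))
  refine le_of_tendsto h1 ?_
  filter_upwards [Ioo_mem_nhdsGT hab] with y hy
  rw [slope_def_field]
  exact div_nonpos_of_nonpos_of_nonneg (by linarith [h y ⟨hy.1.le, hy.2.le⟩]) (by linarith [hy.1])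

lemma deriv_nonneg_of_left {f : ℝ → ℝ} {f' a b : ℝ} (hf : HasDerivAt f f' a) (hab : b < a)
    (h : ∀ y ∈ Set.Icc b a, f y ≤ f a) : 0 ≤ f' := by
  have h1 := (hasDerivAt_iff_tendsto_slope.1 hf).mono_left
    (nhdsWithin_mono a (show Set.Iio a ⊆ {a}ᶜ from fun y hy => ne_of_lt hy))
  refine ge_of_tendsto h1 ?_
  filter_upwards [Ioo_mem_nhdsLT hab] with y hy
  rw [slope_def_field]
  exact div_nonneg_of_nonpos (by linarith [h y ⟨hy.1.le, hy.2.le⟩]) (by linarith [hy.2])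

/-- If nobody requests anything, an arbitrarily small demand wins the whole task: the gain jumps to
`gain 1 > 0` while the cost tends to zero. -/
lemma IsEq.sum_pos (hK : 2 ≤ K) (hρ : ∀ k, 0 < ρ k) (h : IsEq ρ c x) : 0 < ∑ i, x i := by
  have h0 : 0 ≤ ∑ i, x i := Finset.sum_nonneg fun i _ => (h.1 i).1
  rcases h0.eq_or_lt with h0 | h0
  swap
  · exact h0
  exfalso
  have hx : ∀ i, x i = 0 := fun i =>
    (Finset.sum_eq_zero_iff_of_nonneg fun i _ => (h.1 i).1).1 h0.symm i (Finset.mem_univ i)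
  let k : Fin K := ⟨0, by omega⟩
  have h1 : ∀ y ∈ Set.Ioc (0 : ℝ) 1, gain (ρ k) 1 ≤ c k * y := by
    intro y hy
    have := h.2 k y ⟨hy.1.le, hy.2⟩
    rw [← h0, hx k, sub_zero, add_zero, div_self hy.1.ne', div_zero, gain_zero] at this
    linarith
  have h2 : 0 < gain (ρ k) 1 := by
    rw [← gain_zero (ρ := ρ k)]; exact gain_strictMono (hρ k) one_pos
  have h3 : Tendsto (fun y => c k * y) (𝓝[>] 0) (𝓝 (c k * 0)) :=
    ((continuous_const.mul continuous_id).tendsto 0).mono_left nhdsWithin_le_nhds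
  have h4 := ge_of_tendsto h3 (b := gain (ρ k) 1) (by
    filter_upwards [Ioc_mem_nhdsGT (zero_lt_one' ℝ)] with y hy using h1 y hy)
  linarith

/-- First-order condition for a node that can still increase its demand; `IsEq.le_of_pos` is the one
for a node that can decrease it. Expressed by the share `a` and the total `s`, the marginal gain is
`exp (-a/ρ) * (1 - a) / s`, so two equilibria can be compared through their totals. -/
lemma IsEq.le_of_lt_one (hρ : ∀ k, 0 < ρ k) (h : IsEq ρ c x) (hs : 0 < ∑ i, x i) {k : Fin K}
    (hk : x k < 1) :
    Real.exp (-(x k / (∑ i, x i) / ρ k)) * (1 - x k / ∑ i, x i) / (∑ i, x i) ≤ c k := by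
  have e : x k + (∑ i, x i - x k) = ∑ i, x i := by ring
  have h1 := (hasDerivAt_gain_div (hρ k) (x := x k) (S := ∑ i, x i - x k) (by rwa [e])).sub
    ((hasDerivAt_id (x k)).const_mul (c k))
  have h2 := deriv_nonpos_of_right h1 hk fun y hy => by
    have := h.2 k y ⟨(h.1 k).1.trans hy.1, hy.2⟩
    simpa [e] using this
  rw [e] at h2
  linarith

lemma IsEq.le_of_pos (hρ : ∀ k, 0 < ρ k) (h : IsEq ρ c x) (hs : 0 < ∑ i, x i) {k : Fin K}
    (hk : 0 < x k) :
    c k ≤ Real.exp (-(x k / (∑ i, x i) / ρ k)) * (1 - x k / ∑ i, x i) / (∑ i, x i) := by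
  have e : x k + (∑ i, x i - x k) = ∑ i, x i := by ring
  have h1 := (hasDerivAt_gain_div (hρ k) (x := x k) (S := ∑ i, x i - x k) (by rwa [e])).sub
    ((hasDerivAt_id (x k)).const_mul (c k))
  have h2 := deriv_nonneg_of_left h1 hk fun y hy => by
    have := h.2 k y ⟨hy.1, hy.2.trans (h.1 k).2⟩
    simpa [e] using this
  rw [e] at h2
  linarith

lemma IsEq.eq_zero_of_sum_eq (h : IsEq ρ c x) {k j : Fin K} (hk : ∑ i, x i = x k) (hj : j ≠ k) :
    x j = 0 := by
  have h1 : ∑ i ∈ Finset.univ.erase k, x i = 0 := by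
    have := Finset.add_sum_erase Finset.univ x (Finset.mem_univ k)
    linarith
  exact (Finset.sum_eq_zero_iff_of_nonneg fun i _ => (h.1 i).1).1 h1 j (by simp [hj])

/-- A node that is alone in an equilibrium requests the whole task. -/
lemma IsEq.eq_one_of_sum_eq (hK : 2 ≤ K) (hρ : ∀ k, 0 < ρ k)
    (hne : ∀ k, c k = 0 → ∃ j, j ≠ k ∧ c j ≤ 1) (h : IsEq ρ c x) {k : Fin K}
    (hk : ∑ i, x i = x k) : x k = 1 := by
  have hs := h.sum_pos hK hρ
  have hxk : 0 < x k := hk ▸ hs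
  refine le_antisymm (h.1 k).2 ?_
  -- A sole node has share one at every positive demand, so only the cost distinguishes its options.
  have h1 : ∀ y ∈ Set.Ioc (0 : ℝ) 1, c k * x k ≤ c k * y := by
    intro y hy
    have := h.2 k y ⟨hy.1.le, hy.2⟩
    rw [hk, sub_self, add_zero, div_self hy.1.ne', div_self hxk.ne'] at this
    linarith
  rcases lt_trichotomy (c k) 0 with hc | hc | hc
  · have := h1 1 ⟨one_pos, le_rfl⟩
    nlinarith
  -- At zero cost node `k` is indifferent. The other node `j` requests nothing and has marginal gain
  -- `1 / x k`, so its first-order condition and `c j ≤ 1` force `x k ≥ 1`.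
  · obtain ⟨j, hj, hcj⟩ := hne k hc
    have hx := h.eq_zero_of_sum_eq hk hj
    have := h.le_of_lt_one hρ hs (k := j) (by rw [hx]; exact one_pos)
    rw [hx, hk] at this
    simp only [zero_div, neg_zero, Real.exp_zero, sub_zero, mul_one] at this
    rw [div_le_iff₀ hxk] at this
    nlinarith
  · have := h1 (x k / 2) ⟨by linarith, by linarith [(h.1 k).2]⟩
    nlinarith

lemma marginal_strictAnti {ρ a b : ℝ} (hρ : 0 < ρ) (hab : a < b) (hb : b ≤ 1) :
    Real.exp (-(b / ρ)) * (1 - b) < Real.exp (-(a / ρ)) * (1 - a) := by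
  have h1 : Real.exp (-(b / ρ)) ≤ Real.exp (-(a / ρ)) := by gcongr
  have h2 := Real.exp_pos (-(a / ρ))
  nlinarith

/-- When the total grows, no share can grow: such a node would have a larger demand, hence could
move up in `x` and down in `x'`, and the two first-order conditions contradict the strict decrease
of the marginal gain. Since shares add up to one, they all agree. If the totals differed, a node
with positive demand would have the same share at two totals, so its marginal gain would vanish and
its share would be one; but a sole node requests the whole task in both equilibria. -/
lemma IsEq.eq_of_sum_le (hK : 2 ≤ K) (hρ : ∀ k, 0 < ρ k)
    (hne : ∀ k, c k = 0 → ∃ j, j ≠ k ∧ c j ≤ 1) (h : IsEq ρ c x) (h' : IsEq ρ c x')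
    (hss : ∑ i, x i ≤ ∑ i, x' i) : x = x' := by
  have hs := h.sum_pos hK hρ
  have hs' := h'.sum_pos hK hρ
  set s := ∑ i, x i with hsd
  set s' := ∑ i, x' i with hsd'
  have hle1 : ∀ k, x k / s ≤ 1 := fun k => by
    rw [div_le_one hs]
    exact Finset.single_le_sum (f := x) (fun i _ => (h.1 i).1) (Finset.mem_univ k)
  have hle1' : ∀ k, x' k / s' ≤ 1 := fun k => by
    rw [div_le_one hs']
    exact Finset.single_le_sum (f := x') (fun i _ => (h'.1 i).1) (Finset.mem_univ k)
  have key : ∀ k, x' k / s' ≤ x k / s := by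
    intro k
    by_contra! hlt
    have h1 : x k < x' k := by
      rw [div_lt_div_iff₀ hs hs'] at hlt
      have := mul_le_mul_of_nonneg_left hss (h'.1 k).1
      have := (h.1 k).1
      nlinarith
    have h2 := h.le_of_lt_one hρ hs (k := k) (h1.trans_le (h'.1 k).2)
    have h3 := h'.le_of_pos hρ hs' (k := k) ((h.1 k).1.trans_lt h1)
    have h4 := marginal_strictAnti (hρ k) hlt (hle1' k)
    have h5 := h2.trans h3
    rw [← hsd, ← hsd', div_le_div_iff₀ hs hs'] at h5
    have h6 : 0 ≤ Real.exp (-(x' k / s' / ρ k)) * (1 - x' k / s') :=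
      mul_nonneg (Real.exp_pos _).le (sub_nonneg.2 (hle1' k))
    nlinarith
  have hsum : ∑ k, x k / s = ∑ k, x' k / s' := by
    rw [← Finset.sum_div, ← Finset.sum_div, div_self hs.ne', div_self hs'.ne']
  have heq : ∀ k, x' k / s' = x k / s := fun k =>
    (Finset.sum_eq_sum_iff_of_le fun k _ => key k).1 hsum.symm k (Finset.mem_univ k)
  rcases hss.eq_or_lt with he | hlt
  · funext k
    have := heq k
    rw [he, div_left_inj' hs'.ne'] at this
    exact this.symm
  obtain ⟨k, hk⟩ : ∃ k, 0 < x k := by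
    by_contra! hall
    exact absurd hs (not_lt.2 (Finset.sum_nonpos fun i _ => hall i))
  have hk' : x k < x' k := by
    have e : x' k = x k / s * s' := by rw [← heq k]; field_simp
    rw [e, div_mul_eq_mul_div, lt_div_iff₀ hs]
    exact mul_lt_mul_of_pos_left hlt hk
  have h2 := h.le_of_lt_one hρ hs (k := k) (hk'.trans_le (h'.1 k).2)
  have h3 := h'.le_of_pos hρ hs' (k := k) (hk.trans hk')
  have h5 := h2.trans h3
  rw [← hsd, ← hsd', heq k, div_le_div_iff₀ hs hs'] at h5
  have h7 := Real.exp_pos (-(x k / s / ρ k))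
  have h6 : x k / s = 1 := by
    refine le_antisymm (hle1 k) ?_
    by_contra! hc
    have : 0 < Real.exp (-(x k / s / ρ k)) * (1 - x k / s) := mul_pos h7 (by linarith)
    nlinarith
  have hk1 : s = x k := by rw [div_eq_one_iff_eq hs.ne'] at h6; exact h6.symm
  have hk2 : s' = x' k := by
    have := (heq k).trans h6
    rw [div_eq_one_iff_eq hs'.ne'] at this; exact this.symm
  have := h.eq_one_of_sum_eq hK hρ hne hk1
  have := h'.eq_one_of_sum_eq hK hρ hne hk2
  linarith

/-- The equilibrium of the one-task game is unique. -/
theorem IsEq.unique (hK : 2 ≤ K) (hρ : ∀ k, 0 < ρ k)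
    (hne : ∀ k, c k = 0 → ∃ j, j ≠ k ∧ c j ≤ 1) (h : IsEq ρ c x) (h' : IsEq ρ c x') : x = x' := by
  rcases le_total (∑ i, x i) (∑ i, x' i) with hs | hs
  · exact h.eq_of_sum_le hK hρ hne h' hs
  · exact (h'.eq_of_sum_le hK hρ hne h hs).symm

end Equilibrium

end FogGame

/-! Vanishing regret against all constant demands forces convergence to the equilibrium -/

namespace FogGame

/-! ### Limits along ultrafilters -/

section Ultra

variable {ι : Type*} {U : Ultrafilter ι}

/-- Along an ultrafilter all bounded means converge simultaneously, which replaces the choice of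
subsequences. -/
lemma exists_tendsto_Icc {φ : ι → ℝ} {a b : ℝ} (h : ∀ᶠ i in (U : Filter ι), φ i ∈ Set.Icc a b) :
    ∃ l ∈ Set.Icc a b, Tendsto φ U (𝓝 l) := by
  obtain ⟨l, hl, hle⟩ := (isCompact_Icc (a := a) (b := b)).ultrafilter_le_nhds (U.map φ)
    (le_principal_iff.2 h)
  exact ⟨l, hl, hle⟩

lemma tendsto_zero_of_eventually_le {ι : Type*} {l : Filter ι} {φ : ι → ℝ}
    (h0 : ∀ᶠ i in l, 0 ≤ φ i) (h : ∀ δ > 0, ∀ᶠ i in l, φ i ≤ δ) : Tendsto φ l (𝓝 0) := by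
  rw [tendsto_order]
  refine ⟨fun a ha => h0.mono fun i hi => ha.trans_le hi, fun a ha => ?_⟩
  filter_upwards [h (a / 2) (half_pos ha)] with i hi
  linarith

end Ultra

/-! ### Integrals of bounded functions of the joint demand -/

section Cube

variable {K : ℕ}

lemma integrable_of_cube {ν : Measure (Fin K → ℝ)} [IsProbabilityMeasure ν]
    (hν : ∀ᵐ x ∂ν, ∀ k, x k ∈ Set.Icc (0 : ℝ) 1) {φ : (Fin K → ℝ) → ℝ} (hφ : Measurable φ) {C : ℝ}
    (hC : ∀ x : Fin K → ℝ, (∀ k, x k ∈ Set.Icc (0 : ℝ) 1) → |φ x| ≤ C) : Integrable φ ν :=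
  Integrable.of_bound hφ.aestronglyMeasurable C (hν.mono fun x hx => hC x hx)

lemma sum_le_of_cube {x : Fin K → ℝ} (hx : ∀ k, x k ∈ Set.Icc (0 : ℝ) 1) : ∑ i, x i ≤ K := by
  refine (Finset.sum_le_sum fun i _ => (hx i).2).trans ?_
  simp

lemma sum_nonneg_of_cube {x : Fin K → ℝ} (hx : ∀ k, x k ∈ Set.Icc (0 : ℝ) 1) : 0 ≤ ∑ i, x i :=
  Finset.sum_nonneg fun i _ => (hx i).1

lemma others_mem_of_cube {x : Fin K → ℝ} (hx : ∀ k, x k ∈ Set.Icc (0 : ℝ) 1) (k : Fin K) :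
    ∑ i, x i - x k ∈ Set.Icc (0 : ℝ) K := by
  constructor
  · rw [sub_nonneg]
    exact Finset.single_le_sum (f := x) (fun i _ => (hx i).1) (Finset.mem_univ k)
  · linarith [sum_le_of_cube hx, (hx k).1]

lemma share_mem_of_cube {x : Fin K → ℝ} (hx : ∀ k, x k ∈ Set.Icc (0 : ℝ) 1) (k : Fin K) :
    x k / ∑ i, x i ∈ Set.Icc (0 : ℝ) 1 := by
  have h := others_mem_of_cube hx k
  have e : x k / ∑ i, x i = x k / (x k + (∑ i, x i - x k)) := by congr 1; ring
  rw [e]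
  exact ⟨div_add_nonneg (hx k).1 h.1, div_add_le_one (hx k).1 h.1⟩

lemma gain_mem_of_cube {ρ a : ℝ} (hρ : 0 < ρ) (ha : a ∈ Set.Icc (0 : ℝ) 1) :
    gain ρ a ∈ Set.Icc (0 : ℝ) 1 :=
  ⟨gain_nonneg hρ ha.1, (gain_le hρ ha.1).trans ha.2⟩

lemma abs_le_one_of_mem {a : ℝ} (ha : a ∈ Set.Icc (0 : ℝ) 1) : |a| ≤ 1 := by
  rw [abs_of_nonneg ha.1]; exact ha.2

lemma integral_affine₄ {α : Type*} [MeasurableSpace α] {ν : Measure α} [IsProbabilityMeasure ν]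
    {f₁ f₂ f₃ f₄ : α → ℝ} (h₁ : Integrable f₁ ν) (h₂ : Integrable f₂ ν) (h₃ : Integrable f₃ ν)
    (h₄ : Integrable f₄ ν) (a a₁ a₂ a₃ a₄ : ℝ) :
    ∫ x, (a + a₁ * f₁ x + a₂ * f₂ x + a₃ * f₃ x + a₄ * f₄ x) ∂ν =
      a + a₁ * ∫ x, f₁ x ∂ν + a₂ * ∫ x, f₂ x ∂ν + a₃ * ∫ x, f₃ x ∂ν + a₄ * ∫ x, f₄ x ∂ν := by
  have c0 : Integrable (fun _ : α => a) ν := integrable_const a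
  have c1 : Integrable (fun x => a + a₁ * f₁ x) ν := c0.add (h₁.const_mul a₁)
  have c2 : Integrable (fun x => a + a₁ * f₁ x + a₂ * f₂ x) ν := c1.add (h₂.const_mul a₂)
  have c3 : Integrable (fun x => a + a₁ * f₁ x + a₂ * f₂ x + a₃ * f₃ x) ν :=
    c2.add (h₃.const_mul a₃)
  rw [integral_add c3 (h₄.const_mul a₄), integral_add c2 (h₃.const_mul a₃),
    integral_add c1 (h₂.const_mul a₂), integral_add c0 (h₁.const_mul a₁)]
  simp [integral_const_mul]

lemma integral_affine₂ {α : Type*} [MeasurableSpace α] {ν : Measure α} [IsProbabilityMeasure ν]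
    {f₁ f₂ : α → ℝ} (h₁ : Integrable f₁ ν) (h₂ : Integrable f₂ ν) (a a₁ a₂ : ℝ) :
    ∫ x, (a + a₁ * f₁ x + a₂ * f₂ x) ∂ν = a + a₁ * ∫ x, f₁ x ∂ν + a₂ * ∫ x, f₂ x ∂ν := by
  simpa using integral_affine₄ h₁ h₂ h₁ h₁ a a₁ a₂ 0 0

variable {ι : Type*} {l : Filter ι} {ν : ι → Measure (Fin K → ℝ)} [∀ i, IsProbabilityMeasure (ν i)]

/-- Integrate `|φ| ≤ δ/2 + φ² / (δ/2)` for every accuracy `δ`. -/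
lemma tendsto_integral_abs_of_sq
    (hν : ∀ᶠ i in l, ∀ᵐ x ∂ν i, ∀ k, x k ∈ Set.Icc (0 : ℝ) 1) {φ : (Fin K → ℝ) → ℝ}
    (hφ : Measurable φ) {C : ℝ}
    (hC : ∀ x : Fin K → ℝ, (∀ k, x k ∈ Set.Icc (0 : ℝ) 1) → |φ x| ≤ C)
    (h : Tendsto (fun i => ∫ x, φ x ^ 2 ∂ν i) l (𝓝 0)) :
    Tendsto (fun i => ∫ x, |φ x| ∂ν i) l (𝓝 0) := by
  refine tendsto_zero_of_eventually_le (Eventually.of_forall fun i =>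
    integral_nonneg fun x => abs_nonneg _) fun δ hδ => ?_
  have hδ2 : 0 < δ / 2 := half_pos hδ
  filter_upwards [hν, h.eventually (gt_mem_nhds (pow_pos hδ2 2))] with i hi hi2
  have hI : Integrable (fun x => |φ x|) (ν i) :=
    integrable_of_cube hi hφ.abs (C := C) fun x hx => by rw [abs_abs]; exact hC x hx
  have hI2 : Integrable (fun x => φ x ^ 2) (ν i) :=
    integrable_of_cube hi (hφ.pow_const 2) (C := C ^ 2) fun x hx => by
      rw [abs_pow]; exact pow_le_pow_left₀ (abs_nonneg _) (hC x hx) 2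
  calc ∫ x, |φ x| ∂ν i ≤ ∫ x, (δ / 2 + φ x ^ 2 / (δ / 2)) ∂ν i := by
        refine integral_mono hI ((integrable_const _).add (hI2.div_const _)) fun x => ?_
        simp only
        rw [← sub_nonneg]
        have e : δ / 2 + φ x ^ 2 / (δ / 2) - |φ x| =
            (|φ x| - δ / 2) ^ 2 / (δ / 2) + |φ x| := by
          rw [← sq_abs (φ x)]; field_simp; ring
        rw [e]; positivity
    _ = δ / 2 + (∫ x, φ x ^ 2 ∂ν i) / (δ / 2) := by
        have h1 := integral_affine₂ hI2 hI2 (δ / 2) (1 / (δ / 2)) 0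
        simp only [zero_mul, add_zero, one_div_mul_eq_div] at h1
        exact h1
    _ ≤ δ / 2 + (δ / 2) ^ 2 / (δ / 2) := by gcongr
    _ = δ := by field_simp; ring

lemma tendsto_integral_abs_mono
    (hν : ∀ᶠ i in l, ∀ᵐ x ∂ν i, ∀ k, x k ∈ Set.Icc (0 : ℝ) 1) {φ ψ χ : (Fin K → ℝ) → ℝ}
    (hψ : Measurable ψ) (hχ : Measurable χ) {B C D : ℝ}
    (hCψ : ∀ x : Fin K → ℝ, (∀ k, x k ∈ Set.Icc (0 : ℝ) 1) → |ψ x| ≤ C)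
    (hCχ : ∀ x : Fin K → ℝ, (∀ k, x k ∈ Set.Icc (0 : ℝ) 1) → |χ x| ≤ C)
    (h1 : Tendsto (fun i => ∫ x, |ψ x| ∂ν i) l (𝓝 0))
    (h2 : Tendsto (fun i => ∫ x, |χ x| ∂ν i) l (𝓝 0))
    (h : ∀ x : Fin K → ℝ, (∀ k, x k ∈ Set.Icc (0 : ℝ) 1) → |φ x| ≤ B * |ψ x| + D * |χ x|) :
    Tendsto (fun i => ∫ x, |φ x| ∂ν i) l (𝓝 0) := by
  have h3 := (h1.const_mul B).add (h2.const_mul D)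
  rw [mul_zero, mul_zero, add_zero] at h3
  refine tendsto_of_tendsto_of_tendsto_of_le_of_le' tendsto_const_nhds h3
    (Eventually.of_forall fun i => integral_nonneg fun x => abs_nonneg _) ?_
  filter_upwards [hν] with i hi
  have hI1 : Integrable (fun x => |ψ x|) (ν i) :=
    integrable_of_cube hi hψ.abs (C := C) fun x hx => by rw [abs_abs]; exact hCψ x hx
  have hI2 : Integrable (fun x => |χ x|) (ν i) :=
    integrable_of_cube hi hχ.abs (C := C) fun x hx => by rw [abs_abs]; exact hCχ x hx
  rw [← integral_const_mul, ← integral_const_mul,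
    ← integral_add (hI1.const_mul B) (hI2.const_mul D)]
  exact integral_mono_of_nonneg (Eventually.of_forall fun x => abs_nonneg _)
    ((hI1.const_mul B).add (hI2.const_mul D)) (hi.mono fun x hx => h x hx)

end Cube

variable {K : ℕ} {ρ c : Fin K → ℝ}

/-- Excess utility of the constant demand `y` of node `k`, against the joint demand `x`. -/
noncomputable def excess (ρ c : Fin K → ℝ) (k : Fin K) (y : ℝ) (x : Fin K → ℝ) : ℝ :=
  gain (ρ k) (y / (y + (∑ i, x i - x k))) - c k * y - (gain (ρ k) (x k / ∑ i, x i) - c k * x k)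

lemma measurable_excess (k : Fin K) (y : ℝ) : Measurable (excess ρ c k y) := by
  unfold excess gain; fun_prop

/-- The hypothesis `hreg` says that `ν i` is asymptotically a coarse correlated equilibrium, tested
with positive demands only. In the proof `xb`, `A`, `F` are the limits of the mean demands, shares
and gains. Jensen's inequality is used with quadratic remainder in both directions, and the fact
that shares add up to at most one forces both to be tight. -/
theorem exists_isEq_tendsto_of_regret {ι : Type*} {U : Ultrafilter ι}
    {ν : ι → Measure (Fin K → ℝ)} [∀ i, IsProbabilityMeasure (ν i)]
    (hK : 2 ≤ K) (hρ : ∀ k, 1 / 2 < ρ k) (hne : ∀ k, c k = 0 → ∃ j, j ≠ k ∧ c j ≤ 1)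
    (hν : ∀ᶠ i in (U : Filter ι), ∀ᵐ x ∂ν i, ∀ k, x k ∈ Set.Icc (0 : ℝ) 1)
    (hreg : ∀ k, ∀ y ∈ Set.Ioc (0 : ℝ) 1, ∀ δ > 0, ∀ᶠ i in (U : Filter ι),
      ∫ x, excess ρ c k y x ∂ν i ≤ δ) :
    ∃ xb, IsEq ρ c xb ∧ ∀ k, Tendsto (fun i => ∫ x, |x k - xb k| ∂ν i) U (𝓝 0) := by
  have hρ0 : ∀ k, 0 < ρ k := fun k => by linarith [hρ k]
  have mx : ∀ k, Measurable (fun x : Fin K → ℝ => x k) := fun k => by fun_prop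
  have ms : Measurable (fun x : Fin K → ℝ => ∑ i, x i) := by fun_prop
  have ma : ∀ k, Measurable (fun x : Fin K → ℝ => x k / ∑ i, x i) := fun k => (mx k).div ms
  have mf : ∀ k, Measurable (fun x : Fin K → ℝ => gain (ρ k) (x k / ∑ i, x i)) :=
    fun k => measurable_gain.comp (ma k)
  have mS : ∀ k, Measurable (fun x : Fin K → ℝ => ∑ i, x i - x k) := fun k => ms.sub (mx k)
  have mean_mem : ∀ φ : (Fin K → ℝ) → ℝ, Measurable φ →
      (∀ x : Fin K → ℝ, (∀ k, x k ∈ Set.Icc (0 : ℝ) 1) → φ x ∈ Set.Icc (0 : ℝ) 1) →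
      ∀ᶠ i in (U : Filter ι), ∫ x, φ x ∂ν i ∈ Set.Icc (0 : ℝ) 1 := by
    intro φ hφ h
    filter_upwards [hν] with i hi
    have hI := integrable_of_cube hi hφ (C := 1) fun x hx => abs_le_one_of_mem (h x hx)
    constructor
    · exact integral_nonneg_of_ae (hi.mono fun x hx => (h x hx).1)
    · calc ∫ x, φ x ∂ν i ≤ ∫ _, (1 : ℝ) ∂ν i :=
            integral_mono_ae hI (integrable_const _) (hi.mono fun x hx => (h x hx).2)
        _ = 1 := by simp
  have ix : ∀ k, ∀ᶠ i in (U : Filter ι), Integrable (fun x : Fin K → ℝ => x k) (ν i) := fun k =>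
    hν.mono fun i hi => integrable_of_cube hi (mx k) fun x hx => abs_le_one_of_mem (hx k)
  have ia : ∀ k, ∀ᶠ i in (U : Filter ι),
      Integrable (fun x : Fin K → ℝ => x k / ∑ i, x i) (ν i) := fun k =>
    hν.mono fun i hi => integrable_of_cube hi (ma k) fun x hx =>
      abs_le_one_of_mem (share_mem_of_cube hx k)
  have if_ : ∀ k, ∀ᶠ i in (U : Filter ι),
      Integrable (fun x : Fin K → ℝ => gain (ρ k) (x k / ∑ i, x i)) (ν i) := fun k =>
    hν.mono fun i hi => integrable_of_cube hi (mf k) fun x hx =>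
      abs_le_one_of_mem (gain_mem_of_cube (hρ0 k) (share_mem_of_cube hx k))
  have hx_ex : ∀ k, ∃ l ∈ Set.Icc (0 : ℝ) 1, Tendsto (fun i => ∫ x, x k ∂ν i) U (𝓝 l) := fun k =>
    exists_tendsto_Icc (mean_mem _ (mx k) fun x hx => hx k)
  have ha_ex : ∀ k, ∃ l ∈ Set.Icc (0 : ℝ) 1,
      Tendsto (fun i => ∫ x, x k / ∑ j, x j ∂ν i) U (𝓝 l) := fun k =>
    exists_tendsto_Icc (mean_mem _ (ma k) fun x hx => share_mem_of_cube hx k)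
  have hf_ex : ∀ k, ∃ l ∈ Set.Icc (0 : ℝ) 1,
      Tendsto (fun i => ∫ x, gain (ρ k) (x k / ∑ j, x j) ∂ν i) U (𝓝 l) := fun k =>
    exists_tendsto_Icc (mean_mem _ (mf k) fun x hx =>
      gain_mem_of_cube (hρ0 k) (share_mem_of_cube hx k))
  choose xb hxb hxt using hx_ex
  choose A hA hAt using ha_ex
  choose F hF hFt using hf_ex
  have hSt : ∀ k, Tendsto (fun i => ∫ x, (∑ j, x j - x k) ∂ν i) U (𝓝 (∑ j, xb j - xb k)) := by
    intro k
    refine ((tendsto_finsetSum Finset.univ fun j _ => hxt j).sub (hxt k)).congr' ?_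
    filter_upwards [eventually_all.2 ix] with i hi
    rw [integral_sub (integrable_finsetSum _ fun j _ => hi j) (hi k),
      integral_finsetSum _ fun j _ => hi j]
  have hSm := others_mem_of_cube hxb
  -- the shares add up to at most one
  have hAsum : ∑ k, A k ≤ 1 := by
    refine le_of_tendsto (tendsto_finsetSum Finset.univ fun j _ => hAt j) ?_
    filter_upwards [eventually_all.2 ia] with i hi
    rw [← integral_finsetSum _ fun j _ => hi j]
    calc ∫ x, ∑ k, x k / ∑ j, x j ∂ν i ≤ ∫ _, (1 : ℝ) ∂ν i := by
          refine integral_mono (integrable_finsetSum _ fun j _ => hi j) (integrable_const _)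
            fun x => ?_
          simp only [← Finset.sum_div]
          -- The shares add up to `0` instead of `1` where all demands vanish, hence only an
          -- inequality.
          exact div_self_le_one _
      _ = 1 := by simp
  -- Jensen for the own share
  set κ : Fin K → ℝ := fun k => Real.exp (-(1 / ρ k)) / ρ k / 2 with hκ
  have hκ0 : ∀ k, 0 < κ k := fun k => by
    have := hρ0 k
    simp only [hκ]; positivity
  have sq_int : ∀ φ : (Fin K → ℝ) → ℝ, Measurable φ → ∀ C : ℝ,
      (∀ x : Fin K → ℝ, (∀ k, x k ∈ Set.Icc (0 : ℝ) 1) → |φ x| ≤ C) →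
      ∀ᶠ i in (U : Filter ι), Integrable (fun x => φ x ^ 2) (ν i) := fun φ hφ C hC =>
    hν.mono fun i hi => integrable_of_cube hi (hφ.pow_const 2) (C := C ^ 2) fun x hx => by
      rw [abs_pow]; exact pow_le_pow_left₀ (abs_nonneg _) (hC x hx) 2
  -- The generous bound `K` is shared with `bS`, since `tendsto_integral_abs_mono` takes one bound
  -- for both of its functions.
  have ba : ∀ k, ∀ x : Fin K → ℝ, (∀ k, x k ∈ Set.Icc (0 : ℝ) 1) →
      |x k / (∑ j, x j) - A k| ≤ K := by
    intro k x hx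
    have h1 := share_mem_of_cube hx k
    have h2 := hA k
    have h3 : (2 : ℝ) ≤ K := by exact_mod_cast hK
    rw [abs_le]; constructor <;> linarith [h1.1, h1.2, h2.1, h2.2]
  have bS : ∀ k, ∀ x : Fin K → ℝ, (∀ k, x k ∈ Set.Icc (0 : ℝ) 1) →
      |(∑ j, x j - x k) - (∑ j, xb j - xb k)| ≤ K := by
    intro k x hx
    have h1 := others_mem_of_cube hx k
    have h2 := hSm k
    rw [abs_le]; constructor <;> linarith [h1.1, h1.2, h2.1, h2.2]
  have jensen_a : ∀ k, ∀ᶠ i in (U : Filter ι),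
      ∫ x, gain (ρ k) (x k / ∑ j, x j) ∂ν i ≤ gain (ρ k) (A k)
        + Real.exp (-(A k / ρ k)) * (∫ x, x k / ∑ j, x j ∂ν i - A k)
        - κ k * ∫ x, (x k / ∑ j, x j - A k) ^ 2 ∂ν i := by
    intro k
    filter_upwards [hν, ia k, if_ k, sq_int _ ((ma k).sub_const (A k)) K (ba k)] with i hi h1 h2 h3
    have e : gain (ρ k) (A k) + Real.exp (-(A k / ρ k)) * (∫ x, x k / ∑ j, x j ∂ν i - A k)
        - κ k * ∫ x, (x k / ∑ j, x j - A k) ^ 2 ∂ν i =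
        ∫ x, (gain (ρ k) (A k) + Real.exp (-(A k / ρ k)) * (x k / ∑ j, x j - A k)
          - κ k * (x k / ∑ j, x j - A k) ^ 2) ∂ν i := by
      have h4 := integral_affine₂ h1 h3 (gain (ρ k) (A k) - Real.exp (-(A k / ρ k)) * A k)
        (Real.exp (-(A k / ρ k))) (-κ k)
      rw [mul_sub]
      calc _ = _ := by ring
        _ = _ := h4.symm
        _ = _ := by congr 1; ext x; ring
    rw [e]
    refine integral_mono_ae h2 (((integrable_const _).add
      ((h1.sub (integrable_const _)).const_mul _)).sub (h3.const_mul _)) ?_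
    filter_upwards [hi] with x hx
    exact gain_le_tangent (hρ0 k) (share_mem_of_cube hx k) (hA k)
  have hA0 : ∀ k, Tendsto (fun i => gain (ρ k) (A k)
      + Real.exp (-(A k / ρ k)) * (∫ x, x k / ∑ j, x j ∂ν i - A k)) U (𝓝 (gain (ρ k) (A k))) := by
    intro k
    have := (((hAt k).sub_const (A k)).const_mul (Real.exp (-(A k / ρ k)))).const_add
      (gain (ρ k) (A k))
    simpa using this
  have hFA : ∀ k, F k ≤ gain (ρ k) (A k) := by
    intro k
    refine le_of_tendsto_of_tendsto (hFt k) (hA0 k) ?_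
    filter_upwards [jensen_a k] with i hi
    have : 0 ≤ κ k * ∫ x, (x k / ∑ j, x j - A k) ^ 2 ∂ν i :=
      mul_nonneg (hκ0 k).le (integral_nonneg fun x => sq_nonneg _)
    linarith
  -- Jensen for the demand of the opponents
  have jensen_S : ∀ k, ∀ y ∈ Set.Ioc (0 : ℝ) 1, ∃ m > 0, ∃ q : ℝ, ∀ᶠ i in (U : Filter ι),
      gain (ρ k) (y / (y + (∑ j, xb j - xb k)))
        + q * (∫ x, (∑ j, x j - x k) ∂ν i - (∑ j, xb j - xb k))
        + m * ∫ x, ((∑ j, x j - x k) - (∑ j, xb j - xb k)) ^ 2 ∂ν i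
        - c k * y - (∫ x, gain (ρ k) (x k / ∑ j, x j) ∂ν i - c k * ∫ x, x k ∂ν i) ≤
        ∫ x, excess ρ c k y x ∂ν i := by
    intro k y hy
    obtain ⟨m, hm, h⟩ := gain_div_ge_tangent (B := K) (hρ k) hy.1
    obtain ⟨q, hq⟩ := h _ (hSm k)
    refine ⟨m, hm, q, ?_⟩
    filter_upwards [hν, eventually_all.2 ix, if_ k, sq_int _ ((mS k).sub_const _) K (bS k)]
      with i hi h1 h2 h3
    have hS : Integrable (fun x : Fin K → ℝ => ∑ j, x j - x k) (ν i) :=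
      (integrable_finsetSum _ fun j _ => h1 j).sub (h1 k)
    have i1 : Integrable (fun x : Fin K → ℝ =>
        q * ((∑ j, x j - x k) - (∑ j, xb j - xb k))) (ν i) :=
      (hS.sub (integrable_const _)).const_mul q
    have i2 : Integrable (fun x : Fin K → ℝ =>
        m * ((∑ j, x j - x k) - (∑ j, xb j - xb k)) ^ 2) (ν i) := h3.const_mul m
    have i3 : Integrable (fun x : Fin K → ℝ =>
        gain (ρ k) (x k / ∑ j, x j) - c k * x k) (ν i) := h2.sub ((h1 k).const_mul _)
    have e : gain (ρ k) (y / (y + (∑ j, xb j - xb k)))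
        + q * (∫ x, (∑ j, x j - x k) ∂ν i - (∑ j, xb j - xb k))
        + m * ∫ x, ((∑ j, x j - x k) - (∑ j, xb j - xb k)) ^ 2 ∂ν i
        - c k * y - (∫ x, gain (ρ k) (x k / ∑ j, x j) ∂ν i - c k * ∫ x, x k ∂ν i) =
        ∫ x, (gain (ρ k) (y / (y + (∑ j, xb j - xb k)))
          + q * ((∑ j, x j - x k) - (∑ j, xb j - xb k))
          + m * ((∑ j, x j - x k) - (∑ j, xb j - xb k)) ^ 2
          - c k * y - (gain (ρ k) (x k / ∑ j, x j) - c k * x k)) ∂ν i := by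
      have h4 := integral_affine₄ hS h3 h2 (h1 k) (gain (ρ k) (y / (y + (∑ j, xb j - xb k)))
        - q * (∑ j, xb j - xb k) - c k * y) q m (-1) (c k)
      calc _ = _ := by ring
        _ = _ := h4.symm
        _ = _ := by congr 1; ext x; ring
    rw [e]
    refine integral_mono_ae (((((integrable_const _).add i1).add i2).sub
      (integrable_const _)).sub i3) (integrable_of_cube hi (measurable_excess k y)
      (C := 1 + |c k| + 1 + |c k|) ?_) ?_
    · intro x hx
      have b1 := gain_mem_of_cube (hρ0 k) (share_mem_of_cube hx k)
      have hS := others_mem_of_cube hx k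
      have b2 := gain_mem_of_cube (hρ0 k)
        ⟨div_add_nonneg hy.1.le hS.1, div_add_le_one hy.1.le hS.1⟩
      have b3 : |c k * y| ≤ |c k| := by
        rw [abs_mul, abs_of_pos hy.1]; exact mul_le_of_le_one_right (abs_nonneg _) hy.2
      have b4 : |c k * x k| ≤ |c k| := by
        rw [abs_mul, abs_of_nonneg (hx k).1]; exact mul_le_of_le_one_right (abs_nonneg _) (hx k).2
      rw [abs_le] at *
      unfold excess
      constructor <;> linarith [b1.1, b1.2, b2.1, b2.2, b3.1, b3.2, b4.1, b4.2]
    · filter_upwards [hi] with x hx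
      have := hq _ (others_mem_of_cube hx k)
      unfold excess
      linarith
  -- The linear term disappears because the tangent is taken at the limit of the mean demand of the
  -- opponents.
  have hlim : ∀ k (q y : ℝ), Tendsto (fun i => gain (ρ k) (y / (y + (∑ j, xb j - xb k)))
        + q * (∫ x, (∑ j, x j - x k) ∂ν i - (∑ j, xb j - xb k))
        - c k * y - (∫ x, gain (ρ k) (x k / ∑ j, x j) ∂ν i - c k * ∫ x, x k ∂ν i)) U
      (𝓝 (gain (ρ k) (y / (y + (∑ j, xb j - xb k))) - c k * y - (F k - c k * xb k))) := by
    intro k q y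
    have := (((((hSt k).sub_const (∑ j, xb j - xb k)).const_mul q).const_add
      (gain (ρ k) (y / (y + (∑ j, xb j - xb k))))).sub_const (c k * y)).sub
      ((hFt k).sub ((hxt k).const_mul (c k)))
    simpa using this
  have hstar : ∀ k, ∀ y ∈ Set.Ioc (0 : ℝ) 1,
      gain (ρ k) (y / (y + (∑ j, xb j - xb k))) - c k * y ≤ F k - c k * xb k := by
    intro k y hy
    obtain ⟨m, hm, q, h⟩ := jensen_S k y hy
    rw [← sub_nonpos]
    refine le_of_forall_pos_le_add fun δ hδ => ?_
    rw [zero_add]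
    refine le_of_tendsto (hlim k q y) ?_
    filter_upwards [h, hreg k y hy δ hδ] with i h1 h2
    have : 0 ≤ m * ∫ x, ((∑ j, x j - x k) - (∑ j, xb j - xb k)) ^ 2 ∂ν i :=
      mul_nonneg hm.le (integral_nonneg fun x => sq_nonneg _)
    linarith
  -- the total demand does not vanish
  have hs : 0 < ∑ j, xb j := by
    refine (sum_nonneg_of_cube hxb).lt_of_ne fun h0 => ?_
    have hx0 : ∀ i, xb i = 0 := fun i =>
      (Finset.sum_eq_zero_iff_of_nonneg fun i _ => (hxb i).1).1 h0.symm i (Finset.mem_univ i)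
    -- Against opponents with mean demand zero, every small `y` would earn nearly `gain 1`.
    -- Vanishing regret would then give each of at least two nodes a mean share of one.
    have h1 : ∀ k, 1 ≤ A k := by
      intro k
      rw [← (gain_strictMono (hρ0 k)).le_iff_le]
      refine le_trans ?_ (hFA k)
      have h3 : Tendsto (fun y => F k + c k * y) (𝓝[>] 0) (𝓝 (F k + c k * 0)) :=
        ((continuous_const.add (continuous_const.mul continuous_id)).tendsto 0).mono_left
          nhdsWithin_le_nhds
      rw [mul_zero, add_zero] at h3
      refine ge_of_tendsto h3 ?_
      filter_upwards [Ioc_mem_nhdsGT (zero_lt_one' ℝ)] with y hy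
      have := hstar k y hy
      rw [← h0, hx0 k, sub_zero, add_zero, div_self hy.1.ne'] at this
      linarith
    have h2 : (K : ℝ) ≤ ∑ k, A k := by
      calc (K : ℝ) = ∑ _k : Fin K, (1 : ℝ) := by simp
        _ ≤ _ := Finset.sum_le_sum fun k _ => h1 k
    have h3 : (2 : ℝ) ≤ K := by exact_mod_cast hK
    linarith
  have hback : ∀ k, xb k + (∑ j, xb j - xb k) = ∑ j, xb j := fun k => by ring
  -- The decisive test demand is `xb k` itself: `gain (xb k / s) ≤ F k ≤ gain (A k)`. A vanishing
  -- `xb k` is not an admissible test demand, but then the claim is trivial.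
  have hAge : ∀ k, xb k / ∑ j, xb j ≤ A k := by
    intro k
    rcases (hxb k).1.eq_or_lt with h0 | h0
    · rw [← h0, zero_div]; exact (hA k).1
    · rw [← (gain_strictMono (hρ0 k)).le_iff_le]
      have := hstar k (xb k) ⟨h0, (hxb k).2⟩
      rw [hback] at this
      linarith [hFA k]
  -- A termwise inequality between families with sums `1` and at most `1` is an equality.
  have hAeq : ∀ k, A k = xb k / ∑ j, xb j := by
    have h1 : ∑ k, xb k / ∑ j, xb j = 1 := by rw [← Finset.sum_div, div_self hs.ne']
    have h2 : ∑ k, xb k / ∑ j, xb j = ∑ k, A k :=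
      le_antisymm (Finset.sum_le_sum fun k _ => hAge k) (h1 ▸ hAsum)
    exact fun k => ((Finset.sum_eq_sum_iff_of_le fun k _ => hAge k).1 h2 k (Finset.mem_univ k)).symm
  have hFeq : ∀ k, F k = gain (ρ k) (A k) := by
    intro k
    refine le_antisymm (hFA k) ?_
    rcases (hxb k).1.eq_or_lt with h0 | h0
    · rw [hAeq k, ← h0, zero_div, gain_zero]; exact (hF k).1
    · have := hstar k (xb k) ⟨h0, (hxb k).2⟩
      rw [hback, ← hAeq k] at this
      linarith
  have hEq : IsEq ρ c xb := by
    refine ⟨hxb, fun k y hy => ?_⟩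
    rw [← hAeq k, ← hFeq k]
    rcases hy.1.eq_or_lt with h0 | h0
    -- The deviation to `0` is covered by letting `y` tend to `0` from the right and discarding the
    -- nonnegative gain.
    · subst h0
      rw [zero_div, gain_zero, mul_zero, sub_zero]
      have h3 : Tendsto (fun y => F k - c k * xb k + c k * y) (𝓝[>] 0)
          (𝓝 (F k - c k * xb k + c k * 0)) :=
        ((continuous_const.add (continuous_const.mul continuous_id)).tendsto 0).mono_left
          nhdsWithin_le_nhds
      rw [mul_zero, add_zero] at h3
      refine ge_of_tendsto h3 ?_
      filter_upwards [Ioc_mem_nhdsGT (zero_lt_one' ℝ)] with y hy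
      have := hstar k y hy
      have := gain_nonneg (hρ0 k) (div_add_nonneg hy.1.le (hSm k).1)
      linarith
    · exact hstar k y ⟨h0, hy.2⟩
  refine ⟨xb, hEq, ?_⟩
  -- convergence of the shares
  have hA2 : ∀ k, Tendsto (fun i => ∫ x, (x k / ∑ j, x j - A k) ^ 2 ∂ν i) U (𝓝 0) := by
    intro k
    -- The defect in Jensen's inequality tends to `gain (A k) - F k = 0` and dominates `κ k` times
    -- the mean squared deviation of the share.
    have h1 := ((hA0 k).sub (hFt k)).div_const (κ k)
    rw [hFeq k, sub_self, zero_div] at h1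
    refine tendsto_of_tendsto_of_tendsto_of_le_of_le' tendsto_const_nhds h1
      (Eventually.of_forall fun i => integral_nonneg fun x => sq_nonneg _) ?_
    filter_upwards [jensen_a k] with i hi
    rw [le_div_iff₀ (hκ0 k)]
    linarith
  have hA1 : ∀ k, Tendsto (fun i => ∫ x, |x k / ∑ j, x j - A k| ∂ν i) U (𝓝 0) := fun k =>
    tendsto_integral_abs_of_sq hν ((ma k).sub_const _) (ba k) (hA2 k)
  obtain ⟨k, hk⟩ : ∃ k, 0 < xb k := by
    by_contra! hall
    exact absurd hs (not_lt.2 (Finset.sum_nonpos fun i _ => hall i))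
  rcases (hSm k).1.eq_or_lt with h0 | h0
  · -- node `k` is alone
    have hsk : ∑ j, xb j = xb k := by linarith
    have hone := hEq.eq_one_of_sum_eq hK hρ0 hne hsk
    -- The means converge to extreme values: a demand bounded by `1` with mean tending to `1`, or a
    -- nonnegative one with mean tending to `0`, converges in `L¹`.
    intro j
    by_cases hj : j = k
    · subst hj
      have h1 := (hxt j).const_sub 1
      rw [hone, sub_self] at h1
      refine h1.congr' ?_
      filter_upwards [hν, ix j] with i hi hii
      have : (1 : ℝ) = ∫ _, (1 : ℝ) ∂ν i := by simp
      rw [this, ← integral_sub (integrable_const _) hii]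
      refine integral_congr_ae ?_
      filter_upwards [hi] with x hx
      rw [hone, abs_sub_comm, abs_of_nonneg (by linarith [(hx j).2])]
    · have hz := hEq.eq_zero_of_sum_eq hsk hj
      have h1 := hxt j
      rw [hz] at h1
      refine h1.congr' ?_
      filter_upwards [hν] with i hi
      refine integral_congr_ae ?_
      filter_upwards [hi] with x hx
      rw [hz, sub_zero, abs_of_nonneg (hx j).1]
  · -- convergence of the demand of the opponents of node `k`
    have hS2 : Tendsto (fun i => ∫ x, ((∑ j, x j - x k) - (∑ j, xb j - xb k)) ^ 2 ∂ν i) U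
        (𝓝 0) := by
      obtain ⟨m, hm, q, h⟩ := jensen_S k (xb k) ⟨hk, (hxb k).2⟩
      -- At `y = xb k` the limit of the main terms is zero, so the regret bound is left controlling
      -- the variance.
      have hl := hlim k q (xb k)
      rw [hback, ← hAeq k, hFeq k, sub_self] at hl
      refine tendsto_zero_of_eventually_le
        (Eventually.of_forall fun i => integral_nonneg fun x => sq_nonneg _) fun δ hδ => ?_
      have hδm : 0 < δ * m / 2 := by positivity
      filter_upwards [h, hreg k (xb k) ⟨hk, (hxb k).2⟩ _ hδm,
        hl.eventually (lt_mem_nhds (neg_lt_zero.2 hδm))] with i h1 h2 h3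
      rw [hback, ← hAeq k] at h1
      have : m * ∫ x, ((∑ j, x j - x k) - (∑ j, xb j - xb k)) ^ 2 ∂ν i ≤ m * δ := by linarith
      exact le_of_mul_le_mul_left this hm
    have hS1 := tendsto_integral_abs_of_sq hν ((mS k).sub_const _) (bS k) hS2
    have hAk : 0 < 1 - A k := by
      rw [hAeq k, sub_pos, div_lt_one hs]; linarith
    have hcancel : ∀ x : Fin K → ℝ, (∀ k, x k ∈ Set.Icc (0 : ℝ) 1) → ∀ j,
        x j = (∑ i, x i) * (x j / ∑ i, x i) := by
      intro x hx j
      rcases (sum_nonneg_of_cube hx).eq_or_lt with hz | hz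
      · rw [← hz, zero_mul]
        exact (Finset.sum_eq_zero_iff_of_nonneg fun i _ => (hx i).1).1 hz.symm j
          (Finset.mem_univ j)
      · field_simp
    -- The opponents demand `s * (1 - a)`, where `s` is the total and `a` the share of `k`. Since `A
    -- k < 1`, the total is recovered from the two quantities already known to converge; the single
    -- demands are then total times share.
    have hs1 : Tendsto (fun i => ∫ x, |∑ j, x j - ∑ j, xb j| ∂ν i) U (𝓝 0) := by
      refine tendsto_integral_abs_mono hν ((mS k).sub_const _) ((ma k).sub_const _) (bS k) (ba k)
        hS1 (hA1 k) (B := 1 / (1 - A k)) (D := K / (1 - A k)) fun x hx => ?_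
      have e1 : (∑ j, x j - ∑ j, xb j) * (1 - A k) =
          ((∑ j, x j - x k) - (∑ j, xb j - xb k)) + (∑ j, x j) * (x k / ∑ j, x j - A k) := by
        have e2 := hcancel x hx k
        have e3 : xb k = (∑ j, xb j) * A k := by rw [hAeq k]; field_simp
        linear_combination e2 - e3
      have e4 : |∑ j, x j - ∑ j, xb j| * (1 - A k) ≤
          |(∑ j, x j - x k) - (∑ j, xb j - xb k)| + K * |x k / ∑ j, x j - A k| := by
        rw [← abs_of_pos hAk, ← abs_mul, e1]
        refine (abs_add_le _ _).trans ?_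
        rw [abs_mul (∑ j, x j), abs_of_nonneg (sum_nonneg_of_cube hx)]
        gcongr
        exact sum_le_of_cube hx
      rw [← le_div_iff₀ hAk] at e4
      refine e4.trans_eq ?_
      ring
    intro j
    refine tendsto_integral_abs_mono hν ((ma j).sub_const _) (ms.sub_const _) (ba j) (C := K) ?_
      (hA1 j) hs1 (B := K) (D := 1) fun x hx => ?_
    · intro x hx
      have h1 := sum_nonneg_of_cube hx
      have h2 := sum_le_of_cube hx
      have h3 := sum_nonneg_of_cube hxb
      have h4 := sum_le_of_cube hxb
      rw [abs_le]; constructor <;> linarith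
    · have e1 : x j - xb j = (∑ i, x i) * (x j / ∑ i, x i - A j) +
          A j * (∑ i, x i - ∑ i, xb i) := by
        have e2 := hcancel x hx j
        have e3 : xb j = (∑ i, xb i) * A j := by rw [hAeq j]; field_simp
        linear_combination e2 - e3
      rw [e1]
      refine (abs_add_le _ _).trans ?_
      rw [abs_mul (∑ i, x i), abs_of_nonneg (sum_nonneg_of_cube hx), abs_mul (A j),
        abs_of_nonneg (hA j).1]
      gcongr
      · exact sum_le_of_cube hx
      · exact (hA j).2

end FogGame

/-! The repeated game on the space of all random draws -/

namespace FogGame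

variable {K M : ℕ}

/-- All random draws of the repeated game. -/
abbrev Data (K M : ℕ) := (Source K M → ℝ) × (Fin K → Fin M → ℕ → ℕ)

/-- The round in which a random number is used. -/
def round : Source K M → ℕ
  | .sgn _ _ t => t
  | .arm _ _ t => t
  | .pos _ _ t => t
  | .noise _ _ t => t

/-- The node by which a random number is used. -/
def node : Source K M → Fin K
  | .sgn k _ _ => k
  | .arm k _ _ => k
  | .pos k _ _ => k
  | .noise k _ _ => k

namespace Data

/-- Here and in `joint`, `states`, `play` the definitions of `Randomness` are repeated on the
canonical space, where single random numbers can be replaced. -/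
def draw (d : Data K M) (k : Fin K) (m : Fin M) (t : ℕ) : Draw where
  sgn := d.1 (.sgn k m t)
  arm := d.1 (.arm k m t)
  pos := d.1 (.pos k m t)
  order := d.2 k m t

def joint (ℓ : Fin K → Fin M → Learner) (t : ℕ) (d : Data K M)
    (s : ∀ k m, (ℓ k m).State) (k : Fin K) (m : Fin M) : ℝ :=
  (ℓ k m).act t (d.draw k m t) (s k m)

noncomputable def states (G : TaskGame K M) (ℓ : Fin K → Fin M → Learner) (d : Data K M) :
    ℕ → ∀ k m, (ℓ k m).State
  | 0 => fun k m => (ℓ k m).init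
  | t + 1 => fun k m =>
      (ℓ k m).upd (t + 1) (d.draw k m (t + 1))
        (G.taskUtility k m (fun i => d.joint ℓ (t + 1) (states G ℓ d t) i m)
          + d.1 (.noise k m (t + 1)))
        (states G ℓ d t k m)

noncomputable def play (G : TaskGame K M) (ℓ : Fin K → Fin M → Learner) (t : ℕ) (d : Data K M) :
    Fin K → Fin M → ℝ :=
  d.joint ℓ (t + 1) (d.states G ℓ t)

open Classical in
/-- Replace one random number. -/
noncomputable def set (s : Source K M) (d : Data K M) (z : ℝ) : Data K M :=
  (Function.update d.1 s z, d.2)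

lemma set_apply (s : Source K M) (d : Data K M) (z : ℝ) : (d.set s z).1 s = z := by
  simp [set]

lemma set_apply_of_ne {s s' : Source K M} (h : s' ≠ s) (d : Data K M) (z : ℝ) :
    (d.set s z).1 s' = d.1 s' := by
  simp [set, h]

lemma set_snd (s : Source K M) (d : Data K M) (z : ℝ) : (d.set s z).2 = d.2 := rfl

lemma draw_set_of_round {s : Source K M} {t : ℕ} (h : round s ≠ t) (d : Data K M) (z : ℝ)
    (k : Fin K) (m : Fin M) : (d.set s z).draw k m t = d.draw k m t := by
  have h1 : ∀ s', round s' = t → s' ≠ s := fun s' h1 h2 => h (h2 ▸ h1)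
  simp only [draw, set_apply_of_ne (h1 (.sgn k m t) rfl), set_apply_of_ne (h1 (.arm k m t) rfl),
    set_apply_of_ne (h1 (.pos k m t) rfl), set_snd]

lemma draw_set_of_node {s : Source K M} {k : Fin K} (h : node s ≠ k) (d : Data K M) (z : ℝ)
    (m : Fin M) (t : ℕ) : (d.set s z).draw k m t = d.draw k m t := by
  have h1 : ∀ s', node s' = k → s' ≠ s := fun s' h1 h2 => h (h2 ▸ h1)
  simp only [draw, set_apply_of_ne (h1 (.sgn k m t) rfl), set_apply_of_ne (h1 (.arm k m t) rfl),
    set_apply_of_ne (h1 (.pos k m t) rfl), set_snd]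

/-- Causality: the state after `t` rounds is built from the draws of rounds up to `t`, so later
numbers can be resampled freely. -/
lemma states_set {s : Source K M} (G : TaskGame K M) (ℓ : Fin K → Fin M → Learner) (d : Data K M)
    (z : ℝ) : ∀ t, t < round s → (d.set s z).states G ℓ t = d.states G ℓ t := by
  intro t
  induction t with
  | zero => intro _; rfl
  | succ t ih =>
    intro ht
    have h1 := ih (by omega)
    funext k m
    have h2 : ∀ k, (d.set s z).draw k m (t + 1) = d.draw k m (t + 1) :=
      fun k => draw_set_of_round (by omega) d z k m
    have h3 : (Source.noise k m (t + 1) : Source K M) ≠ s := by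
      rintro rfl; simp [round] at ht
    simp only [states, joint, h1, h2, set_apply_of_ne h3]

end Data

/-! ### Resampling a single random number -/

section Law

variable {v : Fin K → Fin M → ℝ≥0}

instance (s : Source K M) : IsProbabilityMeasure (s.law v) := by
  cases s
  · constructor
    simp [Source.law, ENNReal.inv_two_add_inv_two]
  · constructor; simp [Source.law]
  · constructor; simp [Source.law]
  · simp only [Source.law]; infer_instance

/-- A law of the random draws that is invariant under resampling any random number. -/
def IsLaw (v : Fin K → Fin M → ℝ≥0) (π : Measure (Data K M)) : Prop :=
  ∀ s : Source K M, MeasurePreserving (fun p : Data K M × ℝ => p.1.set s p.2) (π.prod (s.law v)) π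

lemma measurable_set (s : Source K M) :
    Measurable (fun p : Data K M × ℝ => p.1.set s p.2) := by
  classical
  unfold Data.set
  refine Measurable.prodMk ?_ (by fun_prop)
  refine measurable_pi_iff.2 fun i => ?_
  by_cases h : i = s
  · subst h; simpa using measurable_snd
  · simp only [Function.update_of_ne h]; fun_prop

variable {π : Measure (Data K M)}

lemma IsLaw.measurePreserving_eval [IsProbabilityMeasure π] (h : IsLaw v π) (s : Source K M) :
    MeasurePreserving (fun d : Data K M => d.1 s) π (s.law v) := by
  have hm : Measurable (fun d : Data K M => d.1 s) := by fun_prop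
  refine ⟨hm, ?_⟩
  conv_lhs => rw [← (h s).map_eq]
  rw [Measure.map_map hm (measurable_set s)]
  have : (fun d : Data K M => d.1 s) ∘ (fun p : Data K M × ℝ => p.1.set s p.2) = Prod.snd := by
    ext p; simp [Data.set_apply]
  rw [this]
  exact measurePreserving_snd.map_eq

variable {F F' : Data K M → ℝ}

lemma IsLaw.integrable_set (h : IsLaw v π) (hF : Integrable F π) (s : Source K M) :
    Integrable (fun p : Data K M × ℝ => F (p.1.set s p.2)) (π.prod (s.law v)) :=
  (h s).integrable_comp_of_integrable hF

lemma IsLaw.integrable_resample (h : IsLaw v π) (hF : Integrable F π) (s : Source K M) :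
    Integrable (fun d => ∫ z, F (d.set s z) ∂s.law v) π :=
  (h.integrable_set hF s).integral_prod_left

variable [IsProbabilityMeasure π]

/-- Fubini's theorem for the resampled law. The inner integral plays the role of the conditional
expectation given all other draws. -/
lemma IsLaw.integral_resample (h : IsLaw v π) (hF : Integrable F π) (s : Source K M) :
    ∫ d, F d ∂π = ∫ d, ∫ z, F (d.set s z) ∂s.law v ∂π := by
  rw [← integral_prod _ (h.integrable_set hF s)]
  have h1 := integral_map (μ := π.prod (s.law v)) (measurable_set s).aemeasurable (f := F)
    (by rw [(h s).map_eq]; exact hF.aestronglyMeasurable)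
  rwa [(h s).map_eq] at h1

/-- Comparison of expectations by averaging over two of the random numbers. -/
lemma IsLaw.integral_le_of_resample (h : IsLaw v π) (hF : Integrable F π) (hF' : Integrable F' π)
    (s s' : Source K M)
    (hle : ∀ᵐ d ∂π, ∫ a, ∫ z, F ((d.set s a).set s' z) ∂s'.law v ∂s.law v ≤
      ∫ a, ∫ z, F' ((d.set s a).set s' z) ∂s'.law v ∂s.law v) :
    ∫ d, F d ∂π ≤ ∫ d, F' d ∂π := by
  have hI := h.integrable_resample hF s'
  have hI' := h.integrable_resample hF' s'
  rw [h.integral_resample hF s', h.integral_resample hI s, h.integral_resample hF' s',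
    h.integral_resample hI' s]
  exact integral_mono_ae (h.integrable_resample hI s) (h.integrable_resample hI' s) hle

end Law

/-! ### Measurability of states and demands -/

section Measurability

variable {α : Type*} [MeasurableSpace α]

/-- Arms and numbers of arms are random indices with countably many values; splitting by the value
reduces to a fixed index. -/
lemma measurable_apply_nat {β : Type*} [MeasurableSpace β] {n : α → ℕ} {f : ℕ → α → β}
    (hn : Measurable n) (hf : ∀ i, Measurable (f i)) : Measurable (fun a => f (n a) a) := by
  intro s hs
  have : (fun a => f (n a) a) ⁻¹' s = ⋃ i, n ⁻¹' {i} ∩ f i ⁻¹' s := by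
    ext a; simp
  rw [this]
  exact MeasurableSet.iUnion fun i => (hn (measurableSet_singleton i)).inter (hf i hs)

lemma measurable_update_nat {w : α → ℕ → ℝ} {j : α → ℕ} {r : α → ℝ} (hw : Measurable w)
    (hj : Measurable j) (hr : Measurable r) :
    Measurable (fun a => Function.update (w a) (j a) (r a)) := by
  refine measurable_pi_iff.2 fun i => ?_
  simp only [Function.update_apply]
  exact Measurable.ite (measurableSet_eq_fun measurable_const hj) hr (measurable_pi_iff.1 hw i)

lemma measurable_eval_nat {w : α → ℕ → ℝ} {j : α → ℕ} (hw : Measurable w)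
    (hj : Measurable j) : Measurable (fun a => w a (j a)) :=
  measurable_apply_nat (f := fun i a => w a i) hj fun i => measurable_pi_iff.1 hw i

lemma measurable_sum_range {w : α → ℕ → ℝ} {n : α → ℕ} (hw : Measurable w)
    (hn : Measurable n) : Measurable (fun a => ∑ i ∈ Finset.range (n a), w a i) :=
  measurable_apply_nat (f := fun n a => ∑ i ∈ Finset.range n, w a i) hn fun _ =>
    Finset.measurable_fun_sum _ fun i _ => measurable_pi_iff.1 hw i

lemma measurable_prob {γ : ℝ} {w : α → ℕ → ℝ} {n : α → ℕ} (hw : Measurable w)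
    (hn : Measurable n) : Measurable (fun a => LBWI.prob γ (n a) (w a)) := by
  refine measurable_pi_iff.2 fun i => ?_
  unfold LBWI.prob
  have h1 := measurable_sum_range hw hn
  have h2 := measurable_pi_iff.1 hw i
  have h3 : Measurable (fun a => (n a : ℝ)) := measurable_from_nat.comp hn
  fun_prop

lemma measurable_select {q : α → ℕ → ℝ} {n : α → ℕ} {r : α → ℝ} (hq : Measurable q)
    (hn : Measurable n) (hr : Measurable r) :
    Measurable (fun a => LBWI.select (n a) (q a) (r a)) := by
  unfold LBWI.select
  simp only [Finset.card_filter]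
  refine measurable_apply_nat (f := fun n a => ∑ j ∈ Finset.range (n - 1),
    if ∑ i ∈ Finset.range (j + 1), q a i ≤ r a then 1 else 0) hn fun n => ?_
  refine Finset.measurable_fun_sum _ fun j _ => Measurable.ite ?_ measurable_const measurable_const
  exact measurableSet_le (measurable_sum_range hq measurable_const) hr

lemma measurable_reweight {γ : ℝ} {w : α → ℕ → ℝ} {n j : α → ℕ} {u : α → ℝ} (hw : Measurable w)
    (hn : Measurable n) (hj : Measurable j) (hu : Measurable u) :
    Measurable (fun a => LBWI.reweight γ (n a) (w a) (j a) (u a)) := by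
  unfold LBWI.reweight
  have h3 : Measurable (fun a => (n a : ℝ)) := measurable_from_nat.comp hn
  have h4 := measurable_eval_nat (measurable_prob (γ := γ) hw hn) hj
  have h5 := measurable_eval_nat hw hj
  exact measurable_update_nat hw hj
    (h5.mul ((hu.const_mul γ).div (h3.mul h4)).exp)

lemma measurable_Ntilde (p : LBWI) (T : ℕ) {f : α → ℕ → ℝ} (hf : Measurable f) :
    Measurable (fun a => p.Ntilde T (f a)) := by
  have h1 : Measurable (fun a => p.Lhat (f a)) := by
    unfold LBWI.Lhat
    refine Measurable.const_mul (Measurable.iSup fun j => ?_) _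
    have h1 := measurable_pi_iff.1 hf (j : ℕ)
    have h2 := measurable_pi_iff.1 hf (j + 1 : ℕ)
    exact (h1.sub h2).abs
  unfold LBWI.Ntilde LBWI.Ltilde
  refine Measurable.const_mul (Nat.measurable_ceil.comp ?_) _
  fun_prop

/-- Measurability of a random state of the Lipschitz bandit. -/
structure MeasStateLBWI (f : α → LBWI.State) : Prop where
  count : Measurable fun a => (f a).count
  mean : Measurable fun a => (f a).mean
  n : Measurable fun a => (f a).n
  w : Measurable fun a => (f a).w

/-- Measurability of a random state of a learner. -/
def MeasState {T : ℕ} : (P : Policy) → (α → (P.learner T).State) → Prop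
  | .bgam _, f => Measurable (β := ℝ × ℝ) f
  | .lbwi _, f => MeasStateLBWI f

structure MeasDraw (δ : α → Draw) : Prop where
  sgn : Measurable fun a => (δ a).sgn
  arm : Measurable fun a => (δ a).arm
  pos : Measurable fun a => (δ a).pos
  order : Measurable fun a => (δ a).order

lemma measurable_arm (p : LBWI) (T t : ℕ) {δ : α → Draw} (hδ : MeasDraw δ) {f : α → LBWI.State}
    (hn : Measurable fun a => (f a).n) (hw : Measurable fun a => (f a).w) :
    Measurable fun a => p.arm T t (δ a) (f a) := by
  unfold LBWI.arm
  split_ifs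
  · exact (measurable_from_nat (f := fun n => n % p.N)).comp hδ.order
  · exact measurable_select (measurable_prob hw hn) hn hδ.arm

lemma measState_init (T : ℕ) (P : Policy) : MeasState P (fun _ : α => (P.learner T).init) := by
  cases P
  · exact measurable_const
  · exact ⟨measurable_const, measurable_const, measurable_const, measurable_const⟩

lemma MeasState.act {T : ℕ} {P : Policy} {f : α → (P.learner T).State} (hf : MeasState P f)
    {δ : α → Draw} (hδ : MeasDraw δ) (t : ℕ) :
    Measurable fun a => (P.learner T).act t (δ a) (f a) := by
  cases P with
  | bgam p =>
    have h2 := hδ.sgn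
    -- The field `State` of a learner carries no σ-algebra, so the claim is proved for the concrete
    -- type.
    have key : ∀ f : α → ℝ × ℝ, Measurable f →
        Measurable fun a => (p.learner T).act t (δ a) (f a) := by
      intro f hf
      simp only [BGAM.learner]
      fun_prop
    exact key f hf
  | lbwi p =>
    have key : ∀ f : α → LBWI.State, MeasStateLBWI f →
        Measurable fun a => (p.learner T).act t (δ a) (f a) := by
      intro f hf
      have h1 := measurable_arm p T t hδ hf.n hf.w
      have h3 : Measurable fun a => ((f a).n : ℝ) := measurable_from_nat.comp hf.n
      have h4 : Measurable fun a => (p.arm T t (δ a) (f a) : ℝ) := measurable_from_nat.comp h1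
      exact (h4.add hδ.pos).div h3
    exact key f hf

lemma MeasState.upd {T : ℕ} {P : Policy} {f : α → (P.learner T).State} (hf : MeasState P f)
    {δ : α → Draw} (hδ : MeasDraw δ) {u : α → ℝ} (hu : Measurable u) (t : ℕ) :
    MeasState P fun a => (P.learner T).upd t (δ a) (u a) (f a) := by
  cases P with
  | bgam p =>
    have h2 := hδ.sgn
    have key : ∀ f : α → ℝ × ℝ, Measurable f →
        Measurable (β := ℝ × ℝ) fun a => (p.learner T).upd t (δ a) (u a) (f a) := by
      intro f hf
      simp only [BGAM.learner, BGAM.proj]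
      fun_prop
    exact key f hf
  | lbwi p =>
    have key : ∀ f : α → LBWI.State, MeasStateLBWI f →
        MeasStateLBWI fun a => (p.learner T).upd t (δ a) (u a) (f a) := by
      intro f hf
      have hj := measurable_arm p T t hδ hf.n hf.w
      have hcj := measurable_eval_nat hf.count hj
      have hmj := measurable_eval_nat hf.mean hj
      have hc' := measurable_update_nat hf.count hj (hcj.const_add 1)
      have hm' := measurable_update_nat hf.mean hj (((hmj.mul hcj).add hu).div (hcj.add_const 1))
      have hw' := measurable_reweight (γ := p.γ T) hf.w hf.n hj hu
      have hN := measurable_Ntilde p T hm'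
      simp only [LBWI.learner]
      by_cases h1 : t < p.T₁
      · simp only [h1, if_true]
        exact ⟨hc', hm', hf.n, hw'⟩
      · by_cases h2 : t = p.T₁
        · simp only [h2, lt_irrefl, if_false, if_true]
          subst h2
          refine ⟨hc', hm', hN, measurable_pi_iff.2 fun i => ?_⟩
          refine Measurable.mul ?_ ?_
          · exact (measurable_from_nat (f := fun n : ℕ => (p.N : ℝ) / n)).comp hN
          · exact measurable_eval_nat hf.w
              ((measurable_from_nat (f := fun n : ℕ => i * p.N / n)).comp hN)
        · simp only [h1, h2, if_false]
          exact ⟨hf.count, hf.mean, hf.n, hw'⟩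
    exact key f hf

end Measurability

lemma measDraw (k : Fin K) (m : Fin M) (t : ℕ) : MeasDraw fun d : Data K M => d.draw k m t := by
  constructor <;> simp only [Data.draw] <;> fun_prop

lemma measurable_taskUtility (G : TaskGame K M) (k : Fin K) (m : Fin M) :
    Measurable (G.taskUtility k m) := by
  unfold TaskGame.taskUtility TaskGame.share
  fun_prop

lemma measState_states (G : TaskGame K M) (pol : Fin K → Fin M → Policy) (T t : ℕ) :
    ∀ k m, MeasState (pol k m)
      fun d : Data K M => d.states G (fun k m => (pol k m).learner T) t k m := by
  induction t with
  | zero => exact fun k m => measState_init T (pol k m)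
  | succ t ih =>
    intro k m
    refine (ih k m).upd (measDraw k m (t + 1)) ?_ (t + 1)
    refine Measurable.add ?_ (by fun_prop)
    refine (measurable_taskUtility G k m).comp (measurable_pi_iff.2 fun i => ?_)
    exact (ih i m).act (measDraw i m (t + 1)) (t + 1)

lemma measurable_play (G : TaskGame K M) (pol : Fin K → Fin M → Policy) (T t : ℕ) (k : Fin K)
    (m : Fin M) :
    Measurable fun d : Data K M => d.play G (fun k m => (pol k m).learner T) t k m :=
  (measState_states G pol T t k m).act (measDraw k m (t + 1)) (t + 1)

/-! Demands lie in the unit interval -/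

/-- Draws in the supports of their laws. -/
structure GoodDraw (δ : Draw) : Prop where
  sgn : δ.sgn = 1 ∨ δ.sgn = -1
  pos : δ.pos ∈ Set.Icc (0 : ℝ) 1

/-- Horizons for which the policy is well defined. -/
def GoodHorizon (T : ℕ) : Policy → Prop
  | .bgam p => p.α T ≤ 1
  | .lbwi _ => 0 < T

lemma BGAM_σ_pos (p : BGAM) {T : ℕ} (hT : 0 < T) : 0 < p.σ T := by
  have h1 := p.L_pos
  have h2 := p.U_pos
  have h3 : (0 : ℝ) < T := by exact_mod_cast hT
  unfold BGAM.σ BGAM.ξ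
  positivity

lemma BGAM_tendsto_σ (p : BGAM) : Tendsto p.σ atTop (𝓝 0) := by
  have h := ((tendsto_rpow_neg_atTop (show (0 : ℝ) < 1 / 4 by norm_num)).comp
    tendsto_natCast_atTop_atTop).mul_const
    (√(BGAM.ξ * p.U * BGAM.ξ / (3 * (p.L * BGAM.ξ + p.U))))
  rw [zero_mul] at h
  exact h

lemma eventually_goodHorizon (P : Policy) : ∀ᶠ T in atTop, GoodHorizon T P := by
  cases P with
  | bgam p =>
    filter_upwards [(BGAM_tendsto_σ p).eventually (gt_mem_nhds (show (0 : ℝ) < 1 / 2 by norm_num))]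
      with T hT
    simp only [GoodHorizon, BGAM.α, BGAM.ξ]
    linarith
  | lbwi p => exact eventually_gt_atTop 0

lemma select_lt {n : ℕ} (hn : 0 < n) (q : ℕ → ℝ) (a : ℝ) : LBWI.select n q a < n := by
  have h := Finset.card_filter_le (Finset.range (n - 1))
    (fun j => ∑ i ∈ Finset.range (j + 1), q i ≤ a)
  rw [Finset.card_range] at h
  unfold LBWI.select
  omega

/-- Even if all averages coincide, the confidence term is positive, since `2NT > 1`. This guarantees
at least one arm in the second phase. -/
lemma Ltilde_pos (p : LBWI) {T : ℕ} (hT : 0 < T) (mean : ℕ → ℝ) : 0 < p.Ltilde T mean := by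
  have h1 : (0 : ℝ) < p.N := by exact_mod_cast p.N_pos
  have h2 : (0 : ℝ) < p.A := by exact_mod_cast p.A_pos
  have h3 : (1 : ℝ) < 2 * p.N * T := by
    have : 1 < 2 * p.N * T := by
      have := p.N_pos
      nlinarith
    exact_mod_cast this
  have h4 := Real.log_pos h3
  have h5 : 0 ≤ p.Lhat mean := mul_nonneg h1.le (Real.iSup_nonneg fun j => abs_nonneg _)
  unfold LBWI.Ltilde
  positivity

lemma Ntilde_pos (p : LBWI) {T : ℕ} (hT : 0 < T) (mean : ℕ → ℝ) : 0 < p.Ntilde T mean := by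
  have h1 : (0 : ℝ) < p.N := by exact_mod_cast p.N_pos
  have h2 := Ltilde_pos p hT mean
  have h3 : (0 : ℝ) < T := by exact_mod_cast hT
  exact Nat.mul_pos p.N_pos (Nat.ceil_pos.2 (by positivity))

/-- Invariant of the states: the played demand is in the unit interval. -/
def ValidState {T : ℕ} (t : ℕ) : (P : Policy) → (P.learner T).State → Prop
  | .bgam p, s => |(show ℝ × ℝ from s).1| ≤ (1 - p.α T) * BGAM.ξ
  | .lbwi p, s => 0 < (show LBWI.State from s).n ∧
      (t < p.T₁ → (show LBWI.State from s).n = p.N)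

lemma validState_init {T : ℕ} {P : Policy} (h : GoodHorizon T P) :
    ValidState 0 P (P.learner T).init := by
  cases P with
  | bgam p =>
    have h1 : 0 ≤ (1 - p.α T) * BGAM.ξ := by
      have : p.α T ≤ 1 := h
      unfold BGAM.ξ; linarith
    simpa [ValidState, Policy.learner, BGAM.learner] using h1
  | lbwi p => exact ⟨p.N_pos, fun _ => rfl⟩

lemma ValidState.upd {T t : ℕ} {P : Policy} {s : (P.learner T).State} (h : GoodHorizon T P)
    (hs : ValidState t P s) (δ : Draw) (u : ℝ) :
    ValidState (t + 1) P ((P.learner T).upd (t + 1) δ u s) := by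
  cases P with
  | bgam p =>
    have h1 : 0 ≤ (1 - p.α T) * BGAM.ξ := by
      have : p.α T ≤ 1 := h
      unfold BGAM.ξ; linarith
    simp only [ValidState, Policy.learner, BGAM.learner, BGAM.proj]
    rw [abs_le]
    refine ⟨le_max_left _ _, max_le (by linarith) (min_le_left _ _)⟩
  | lbwi p =>
    obtain ⟨h1, h2⟩ := hs
    simp only [ValidState, Policy.learner, LBWI.learner]
    by_cases h3 : t + 1 < p.T₁
    · simp only [h3, if_true]
      exact ⟨h1, fun _ => h2 (by omega)⟩
    · by_cases h4 : t + 1 = p.T₁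
      · simp only [h4, lt_irrefl, if_false, if_true]
        exact ⟨Ntilde_pos p h _, fun h => absurd h (by simp)⟩
      · simp only [h3, h4, if_false]
        exact ⟨h1, fun h => absurd h (by simp)⟩

lemma ValidState.act {T t : ℕ} (hT : 0 < T) {P : Policy} {s : (P.learner T).State}
    (hs : ValidState t P s) {δ : Draw} (hδ : GoodDraw δ) :
    (P.learner T).act (t + 1) δ s ∈ Set.Icc (0 : ℝ) 1 := by
  cases P with
  | bgam p =>
    have h1 := BGAM_σ_pos p hT
    simp only [ValidState, BGAM.α, BGAM.ξ, abs_le] at hs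
    simp only [Policy.learner, BGAM.learner, BGAM.ξ]
    rcases hδ.sgn with h | h <;> rw [h] <;> constructor <;> linarith [hs.1, hs.2]
  | lbwi p =>
    obtain ⟨h1, h2⟩ := hs
    have h3 : p.arm T (t + 1) δ s < (show LBWI.State from s).n := by
      unfold LBWI.arm
      split_ifs with h
      · rw [h2 (by omega)]; exact Nat.mod_lt _ p.N_pos
      · exact select_lt h1 _ _
    have h4 : (p.arm T (t + 1) δ s : ℝ) + 1 ≤ (show LBWI.State from s).n := by exact_mod_cast h3
    have h5 : (0 : ℝ) < (show LBWI.State from s).n := by exact_mod_cast h1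
    have h6 : (0 : ℝ) ≤ p.arm T (t + 1) δ s := Nat.cast_nonneg _
    have e : (Policy.learner T (.lbwi p)).act (t + 1) δ s =
      ((p.arm T (t + 1) δ s : ℝ) + δ.pos) / (show LBWI.State from s).n := rfl
    rw [e]
    have h7 := hδ.pos
    constructor
    · have := h7.1
      positivity
    · rw [div_le_one h5]; linarith [h7.2]

lemma validState_states (G : TaskGame K M) (pol : Fin K → Fin M → Policy) {T : ℕ}
    (hT : ∀ k m, GoodHorizon T (pol k m)) (d : Data K M) (t : ℕ) :
    ∀ k m, ValidState t (pol k m) (d.states G (fun k m => (pol k m).learner T) t k m) := by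
  induction t with
  | zero => exact fun k m => validState_init (hT k m)
  | succ t ih => exact fun k m => (ih k m).upd (hT k m) _ _

lemma play_mem (G : TaskGame K M) (pol : Fin K → Fin M → Policy) {T : ℕ} (h0 : 0 < T)
    (hT : ∀ k m, GoodHorizon T (pol k m)) {d : Data K M}
    (hd : ∀ k m t, GoodDraw (d.draw k m t)) (t : ℕ) (k : Fin K) (m : Fin M) :
    d.play G (fun k m => (pol k m).learner T) t k m ∈ Set.Icc (0 : ℝ) 1 :=
  (validState_states G pol hT d t k m).act h0 (hd k m (t + 1))

lemma IsLaw.ae_goodDraw {v : Fin K → Fin M → ℝ≥0} {π : Measure (Data K M)}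
    [IsProbabilityMeasure π] (h : IsLaw v π) : ∀ᵐ d ∂π, ∀ k m t, GoodDraw (d.draw k m t) := by
  simp only [ae_all_iff]
  intro k m t
  have h1 : ∀ᵐ d ∂π, d.1 (.sgn k m t) = 1 ∨ d.1 (.sgn k m t) = -1 := by
    refine (h.measurePreserving_eval (.sgn k m t)).quasiMeasurePreserving.ae
      (p := fun z => z = 1 ∨ z = -1) ?_
    simp only [Source.law]
    rw [ae_add_measure_iff]
    constructor <;> refine Measure.ae_smul_measure ?_ _ <;> rw [ae_dirac_eq] <;> simp
  have h2 : ∀ᵐ d ∂π, d.1 (.pos k m t) ∈ Set.Icc (0 : ℝ) 1 := by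
    refine (h.measurePreserving_eval (.pos k m t)).quasiMeasurePreserving.ae
      (p := fun z => z ∈ Set.Icc (0 : ℝ) 1) ?_
    exact ae_restrict_mem measurableSet_Icc
  filter_upwards [h1, h2] with d h1 h2
  exact ⟨h1, h2⟩

/-! The law of the draws -/

section Randomness

variable {v : Fin K → Fin M → ℝ≥0} {Ω : Type*} [MeasurableSpace Ω] {μ : Measure Ω}
  (R : Randomness K M v μ)

def data (ω : Ω) : Data K M := (fun s => R.X s ω, fun k m t => R.order k m t ω)

lemma measurable_data : Measurable (data R) := by
  refine Measurable.prodMk (measurable_pi_iff.2 R.measurable_X) ?_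
  exact measurable_pi_iff.2 fun k => measurable_pi_iff.2 fun m => measurable_pi_iff.2 fun t =>
    R.measurable_order k m t

lemma states_data (G : TaskGame K M) (ℓ : Fin K → Fin M → Learner) (ω : Ω) (t : ℕ) :
    R.states G ℓ ω t = (data R ω).states G ℓ t := by
  induction t with
  | zero => rfl
  | succ t ih =>
    funext k m
    simp only [Randomness.states, Data.states, ih]
    rfl

lemma play_data (G : TaskGame K M) (ℓ : Fin K → Fin M → Learner) (ω : Ω) (t : ℕ) :
    R.play G ℓ t ω = (data R ω).play G ℓ t := by
  unfold Randomness.play Data.play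
  rw [states_data]
  rfl

/-- On a box, replacing the coordinate `s` only exchanges the factor of `s`, and finite boxes
determine the product measure. -/
lemma measurePreserving_update_infinitePi {ι : Type*} [DecidableEq ι] (ν : ι → Measure ℝ)
    [∀ i, IsProbabilityMeasure (ν i)] (s : ι) :
    MeasurePreserving (fun p : (ι → ℝ) × ℝ => Function.update p.1 s p.2)
      ((Measure.infinitePi ν).prod (ν s)) (Measure.infinitePi ν) := by
  have hm : Measurable (fun p : (ι → ℝ) × ℝ => Function.update p.1 s p.2) := by
    refine measurable_pi_iff.2 fun i => ?_
    by_cases h : i = s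
    · subst h; simpa using measurable_snd
    · simp only [Function.update_of_ne h]; fun_prop
  refine ⟨hm, Measure.eq_infinitePi _ fun I t ht => ?_⟩
  rw [Measure.map_apply hm (MeasurableSet.pi I.countable_toSet fun i _ => ht i)]
  by_cases hs : s ∈ I
  · have e : (fun p : (ι → ℝ) × ℝ => Function.update p.1 s p.2) ⁻¹' (Set.pi I t) =
        (Set.pi (I.erase s : Finset ι) t) ×ˢ t s := by
      ext p
      simp only [Set.mem_preimage, Set.mem_pi, Set.mem_prod, Finset.mem_coe, Finset.mem_erase]
      constructor
      · intro h
        exact ⟨fun i hi => by simpa [hi.1] using h i hi.2, by simpa using h s hs⟩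
      · rintro ⟨h1, h2⟩ i hi
        by_cases h : i = s
        · subst h; simpa using h2
        · simpa [h] using h1 i ⟨h, hi⟩
    rw [e, Measure.prod_prod, Measure.infinitePi_pi _ fun i _ => ht i,
      Finset.prod_erase_mul _ _ hs]
  · have e : (fun p : (ι → ℝ) × ℝ => Function.update p.1 s p.2) ⁻¹' (Set.pi I t) =
        (Set.pi (I : Set ι) t) ×ˢ Set.univ := by
      ext p
      simp only [Set.mem_preimage, Set.mem_pi, Set.mem_prod, Finset.mem_coe, Set.mem_univ, and_true]
      refine forall_congr' fun i => forall_congr' fun hi => ?_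
      rw [Function.update_of_ne (fun h => hs (by rw [← h]; exact hi))]
    rw [e, Measure.prod_prod, Measure.infinitePi_pi _ fun i _ => ht i, measure_univ, mul_one]

/-- The orders may depend on each other in any way: only their independence from the random numbers
is used, which makes the law a product. An infinite product is invariant under resampling a
coordinate, and the order component is untouched. -/
theorem isLaw_data [IsProbabilityMeasure μ] : IsLaw v (μ.map (data R)) := by
  classical
  intro s
  set O : Ω → (Fin K → Fin M → ℕ → ℕ) := fun ω k m t => R.order k m t ω
  set X : Ω → (Source K M → ℝ) := fun ω s => R.X s ω
  have hO : Measurable O := measurable_pi_iff.2 fun k => measurable_pi_iff.2 fun m =>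
    measurable_pi_iff.2 fun t => R.measurable_order k m t
  have hX : Measurable X := measurable_pi_iff.2 R.measurable_X
  have h1 : μ.map (data R) = (μ.map X).prod (μ.map O) :=
    (indepFun_iff_map_prod_eq_prod_map_map hX.aemeasurable hO.aemeasurable).1 R.indep_order.symm
  have h2 : μ.map X = Measure.infinitePi fun s : Source K M => s.law v := by
    have := R.indep_X.map_fun_eq_infinitePi_map R.measurable_X
    simp only [R.law_X] at this
    exact this
  have := Measure.isProbabilityMeasure_map (μ := μ) hO.aemeasurable
  rw [h1, h2]
  set P := Measure.infinitePi fun s : Source K M => s.law v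
  have m1 : MeasurePreserving
      (fun p : ((Source K M → ℝ) × (Fin K → Fin M → ℕ → ℕ)) × ℝ => ((p.1.1, p.2), p.1.2))
      ((P.prod (μ.map O)).prod (s.law v)) ((P.prod (s.law v)).prod (μ.map O)) := by
    have a1 := measurePreserving_prodAssoc P (μ.map O) (s.law v)
    have a2 : MeasurePreserving (Prod.map id Prod.swap) (P.prod ((μ.map O).prod (s.law v)))
      (P.prod ((s.law v).prod (μ.map O))) :=
      (MeasurePreserving.id P).prod Measure.measurePreserving_swap
    have a3 := (measurePreserving_prodAssoc P (s.law v) (μ.map O)).symm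
    exact a3.comp (a2.comp a1)
  have m2 := (measurePreserving_update_infinitePi (fun s : Source K M => s.law v) s).prod
    (MeasurePreserving.id (μ.map O))
  have m3 := m2.comp m1
  convert m3 using 1
  ext p
  · simp only [Data.set, Function.comp, Prod.map]
  · rfl

end Randomness

end FogGame

/-! A single learner in the environment formed by the other nodes -/

namespace FogGame

variable {K M : ℕ}

lemma measurable_payoff (ρ ε κ : ℝ) : Measurable fun p : ℝ × ℝ => payoff ρ ε κ p.1 p.2 := by
  unfold payoff gain; fun_prop

/-- A learner with the policy `P` and the horizon `T` that is used by the node `k` for the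
task `m`; its states are `st t` after `t` rounds, and the total demand of the other nodes is `S t` in
round `t + 1`. -/
structure Env (v : Fin K → Fin M → ℝ≥0) (π : Measure (Data K M)) (k : Fin K) (m : Fin M) (T : ℕ)
    (P : Policy) (ρ ε κ B : ℝ) (st : ℕ → Data K M → (P.learner T).State)
    (S : ℕ → Data K M → ℝ) : Prop where
  law : IsLaw v π
  T_pos : 0 < T
  good : GoodHorizon T P
  ρ_pos : 0 < ρ
  init : ∀ d, st 0 d = (P.learner T).init
  step : ∀ t d, st (t + 1) d = (P.learner T).upd (t + 1) (d.draw k m (t + 1))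
    (payoff ρ ε κ ((P.learner T).act (t + 1) (d.draw k m (t + 1)) (st t d)) (S t d)
      + d.1 (.noise k m (t + 1))) (st t d)
  meas : ∀ t, MeasState P (st t)
  S_meas : ∀ t, Measurable (S t)
  S_mem : ∀ᵐ d ∂π, ∀ t, S t d ∈ Set.Icc 0 B
  -- The condition `t < round s` includes the numbers of round `t + 1`. Those of node `k` leave both
  -- the state and `S t` unchanged; those of other nodes may change `S t`, hence the restriction on
  -- `node s` below.
  st_set : ∀ s d z t, t < round s → st t (d.set s z) = st t d
  S_set : ∀ s d z t, t < round s → node s = k → S t (d.set s z) = S t d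

namespace Env

variable {v : Fin K → Fin M → ℝ≥0} {π : Measure (Data K M)} {k : Fin K}
  {m : Fin M} {T : ℕ} {P : Policy} {ρ ε κ B : ℝ} {st : ℕ → Data K M → (P.learner T).State}
  {S : ℕ → Data K M → ℝ}

/-- The demand of the learner. -/
noncomputable def demand (k : Fin K) (m : Fin M) (T : ℕ) (P : Policy) (st : ℕ → Data K M → (P.learner T).State)
    (t : ℕ) (d : Data K M) : ℝ :=
  (P.learner T).act (t + 1) (d.draw k m (t + 1)) (st t d)

/-- Bound for the utility of the learner. -/
noncomputable def bound (ε κ B : ℝ) : ℝ := 1 + |ε| * (1 + B) + |κ|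

lemma measurable_demand (h : Env v π k m T P ρ ε κ B st S) (t : ℕ) :
    Measurable (demand k m T P st t) :=
  (h.meas t).act (measDraw k m (t + 1)) (t + 1)

lemma measurable_payoff_demand (h : Env v π k m T P ρ ε κ B st S) (t : ℕ) :
    Measurable fun d => payoff ρ ε κ (demand k m T P st t d) (S t d) :=
  Measurable.comp (g := fun p : ℝ × ℝ => payoff ρ ε κ p.1 p.2)
    (f := fun d => (demand k m T P st t d, S t d)) (measurable_payoff ρ ε κ)
    ((h.measurable_demand t).prodMk (h.S_meas t))

lemma measurable_payoff_const (h : Env v π k m T P ρ ε κ B st S) (y : ℝ) (t : ℕ) :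
    Measurable fun d => payoff ρ ε κ y (S t d) :=
  Measurable.comp (g := fun p : ℝ × ℝ => payoff ρ ε κ p.1 p.2)
    (f := fun d => (y, S t d)) (measurable_payoff ρ ε κ)
    (measurable_const.prodMk (h.S_meas t))

variable [IsProbabilityMeasure π]

lemma ae_demand_mem (h : Env v π k m T P ρ ε κ B st S) :
    ∀ᵐ d ∂π, ∀ t, demand k m T P st t d ∈ Set.Icc (0 : ℝ) 1 := by
  filter_upwards [h.law.ae_goodDraw] with d hd t
  have h1 : ∀ t, ValidState t P (st t d) := by
    intro t
    induction t with
    | zero => rw [h.init]; exact validState_init h.good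
    | succ t ih => rw [h.step]; exact ih.upd h.good _ _
  exact (h1 t).act h.T_pos (hd k m (t + 1))

lemma ae_abs_payoff_le (h : Env v π k m T P ρ ε κ B st S) :
    ∀ᵐ d ∂π, ∀ t, |payoff ρ ε κ (demand k m T P st t d) (S t d)| ≤ bound ε κ B := by
  filter_upwards [h.ae_demand_mem, h.S_mem] with d h1 h2 t
  exact abs_payoff_le h.ρ_pos (h1 t) (h2 t)

lemma integrable_payoff_demand (h : Env v π k m T P ρ ε κ B st S) (t : ℕ) :
    Integrable (fun d => payoff ρ ε κ (demand k m T P st t d) (S t d)) π :=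
  Integrable.of_bound (h.measurable_payoff_demand t).aestronglyMeasurable (bound ε κ B)
    (h.ae_abs_payoff_le.mono fun _ hd => hd t)

lemma integrable_payoff_const (h : Env v π k m T P ρ ε κ B st S) {y : ℝ}
    (hy : y ∈ Set.Icc (0 : ℝ) 1) (t : ℕ) : Integrable (fun d => payoff ρ ε κ y (S t d)) π :=
  Integrable.of_bound (h.measurable_payoff_const y t).aestronglyMeasurable (bound ε κ B)
    (h.S_mem.mono fun _ hd => abs_payoff_le h.ρ_pos hy (hd t))

lemma bound_pos (h : Env v π k m T P ρ ε κ B st S) : 0 < bound ε κ B := by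
  obtain ⟨d, hd⟩ := h.S_mem.exists
  have : 0 ≤ B := (hd 0).1.trans (hd 0).2
  unfold bound; positivity

lemma integrable_noise (h : Env v π k m T P ρ ε κ B st S) {φ : ℝ → ℝ}
    (hφ : Integrable φ (gaussianReal 0 (v k m))) (t : ℕ) :
    Integrable (fun d => φ (d.1 (.noise k m t))) π :=
  (h.law.measurePreserving_eval (.noise k m t)).integrable_comp_of_integrable hφ

lemma integral_noise (h : Env v π k m T P ρ ε κ B st S) {φ : ℝ → ℝ}
    (hφ : Integrable φ (gaussianReal 0 (v k m))) (t : ℕ) :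
    ∫ d, φ (d.1 (.noise k m t)) ∂π = ∫ z, φ z ∂gaussianReal 0 (v k m) := by
  have hp := h.law.measurePreserving_eval (.noise k m t)
  have h1 := integral_map (μ := π) hp.measurable.aemeasurable (f := φ)
    (by rw [hp.map_eq]; exact hφ.aestronglyMeasurable)
  rw [hp.map_eq] at h1
  exact h1.symm

end Env

lemma integrable_id_gaussian (w : ℝ≥0) : Integrable (fun z : ℝ => z) (gaussianReal 0 w) :=
  memLp_one_iff_integrable.1 (memLp_id_gaussianReal (μ := 0) (v := w) 1)

lemma integrable_abs_gaussian (w : ℝ≥0) : Integrable (fun z : ℝ => |z|) (gaussianReal 0 w) :=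
  (integrable_id_gaussian w).abs

lemma integrable_sq_gaussian (b : ℝ) (w : ℝ≥0) :
    Integrable (fun z : ℝ => (b + |z|) ^ 2) (gaussianReal 0 w) := by
  have h1 : MemLp (fun z : ℝ => z) 2 (gaussianReal 0 w) := memLp_id_gaussianReal (μ := 0) (v := w) 2
  have h2 : MemLp (fun z : ℝ => b + |z|) 2 (gaussianReal 0 w) := (memLp_const b).add h1.abs
  exact h2.integrable_sq

lemma integral_sgn (f : ℝ → ℝ) :
    ∫ z, f z ∂((1 / 2 : ℝ≥0∞) • Measure.dirac (1 : ℝ) + (1 / 2 : ℝ≥0∞) • Measure.dirac (-1)) =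
      (f 1 + f (-1)) / 2 := by
  have h : ∀ a : ℝ, Integrable f ((1 / 2 : ℝ≥0∞) • Measure.dirac a) := fun a =>
    (integrable_dirac (by finiteness)).smul_measure (by simp)
  rw [integral_add_measure (h 1) (h (-1)), integral_smul_measure, integral_smul_measure,
    integral_dirac, integral_dirac]
  simp
  ring

/-! Gradient ascent with momentum -/

/-- Regret of projected gradient ascent with momentum for the linear rewards `g t`. -/
lemma momentum_regret {β ν z : ℝ} {y w g : ℕ → ℝ} (hν : 0 < ν) (hβ0 : 0 ≤ β) (hβ1 : β < 1)
    (hw0 : w 0 = 0) (hw : ∀ t, w (t + 1) = β * w t + g t) (hz : ∀ t, |y t - z| ≤ 1)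
    (h1 : ∀ t : ℕ, |y (t + 1) - z| ≤ |y t + ν / √(t + 1 : ℝ) * w (t + 1) - z|)
    (h2 : ∀ t : ℕ, |y (t + 1) - y t| ≤ ν / √(t + 1 : ℝ) * |w (t + 1)|) (n : ℕ) :
    ∑ t ∈ Finset.range n, g t * (z - y t) ≤
      √(n : ℝ) / (2 * ν) + (1 + w n ^ 2)
        + 2 * ∑ t ∈ Finset.range n, ν / √(t + 1 : ℝ) * w (t + 1) ^ 2 := by
  set E : ℕ → ℝ := fun n => ∑ t ∈ Finset.range n, ν / √(t + 1 : ℝ) * w (t + 1) ^ 2 with hE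
  have hE0 : ∀ n, 0 ≤ E n := fun n => Finset.sum_nonneg fun t _ => by positivity
  have hEs : ∀ n, E (n + 1) = E n + ν / √(n + 1 : ℝ) * w (n + 1) ^ 2 := fun n =>
    Finset.sum_range_succ _ _
  -- Ordinary gradient ascent with the momentum as gradient. Keeping the term `(y n - z) ^ 2` in the
  -- induction absorbs the growth of the inverse step size, as `|y n - z| ≤ 1`.
  have hA : ∀ n, ∑ t ∈ Finset.range n, w (t + 1) * (z - y t) ≤
      (1 - (y n - z) ^ 2) * √(n : ℝ) / (2 * ν) + E n / 2 := by
    intro n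
    induction n with
    | zero => simp [hE]
    | succ n ih =>
      rw [Finset.sum_range_succ, hEs]
      push_cast
      have hr : 0 < √(n + 1 : ℝ) := by positivity
      have hmono : √(n : ℝ) ≤ √(n + 1 : ℝ) := Real.sqrt_le_sqrt (by linarith)
      have hd : (y n - z) ^ 2 ≤ 1 := by
        rw [← sq_abs]; exact pow_le_one₀ (abs_nonneg _) (hz n)
      have hsq := pow_le_pow_left₀ (abs_nonneg _) (h1 n) 2
      rw [sq_abs, sq_abs] at hsq
      set r := √(n + 1 : ℝ)
      have e1 : w (n + 1) * (z - y n) ≤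
          ((y n - z) ^ 2 - (y (n + 1) - z) ^ 2) * r / (2 * ν) + ν / r * w (n + 1) ^ 2 / 2 := by
        have e2 : w (n + 1) * (z - y n) =
            ((y n - z) ^ 2 - (y n + ν / r * w (n + 1) - z) ^ 2) * r / (2 * ν)
              + ν / r * w (n + 1) ^ 2 / 2 := by
          field_simp; ring
        rw [e2]
        gcongr
      have e3 : (1 - (y n - z) ^ 2) * √(n : ℝ) / (2 * ν) ≤ (1 - (y n - z) ^ 2) * r / (2 * ν) := by
        have : 0 ≤ 1 - (y n - z) ^ 2 := by linarith
        gcongr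
      have e4 : (1 - (y (n + 1) - z) ^ 2) * r / (2 * ν) = (1 - (y n - z) ^ 2) * r / (2 * ν) +
          ((y n - z) ^ 2 - (y (n + 1) - z) ^ 2) * r / (2 * ν) := by ring
      linarith
  -- Shifting the index of `w` costs a boundary term and the moves of `y`, which are at most step
  -- size times `|w|`.
  have hb : ∀ n, ∑ t ∈ Finset.range n, w (t + 1) * (z - y t) - w n * (z - y n) - E n ≤
      ∑ t ∈ Finset.range n, w t * (z - y t) := by
    intro n
    induction n with
    | zero => simp [hE, hw0]
    | succ n ih =>
      rw [Finset.sum_range_succ, Finset.sum_range_succ, hEs]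
      have h3 : w (n + 1) * (y (n + 1) - y n) ≤ ν / √(n + 1 : ℝ) * w (n + 1) ^ 2 := by
        refine (le_abs_self _).trans ?_
        rw [abs_mul, ← sq_abs (w (n + 1))]
        have := mul_le_mul_of_nonneg_left (h2 n) (abs_nonneg (w (n + 1)))
        refine this.trans_eq ?_
        ring
      linarith
  -- Since `g t = w (t + 1) - β * w t`, the regret for `g` is a combination of the two sums just
  -- estimated.
  have hg : ∑ t ∈ Finset.range n, g t * (z - y t) =
      ∑ t ∈ Finset.range n, w (t + 1) * (z - y t) - β * ∑ t ∈ Finset.range n, w t * (z - y t) := by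
    rw [Finset.mul_sum, ← Finset.sum_sub_distrib]
    refine Finset.sum_congr rfl fun t _ => ?_
    rw [hw]; ring
  have hA' : ∑ t ∈ Finset.range n, w (t + 1) * (z - y t) ≤ √(n : ℝ) / (2 * ν) + E n / 2 := by
    refine (hA n).trans ?_
    have : (1 - (y n - z) ^ 2) * √(n : ℝ) ≤ √(n : ℝ) := by
      have := Real.sqrt_nonneg (n : ℝ)
      nlinarith [sq_nonneg (y n - z)]
    gcongr
  have hwn : w n * (z - y n) ≤ 1 + w n ^ 2 := by
    refine (le_abs_self _).trans ?_
    rw [abs_mul, abs_sub_comm z]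
    have := mul_le_mul_of_nonneg_left (hz n) (abs_nonneg (w n))
    nlinarith [sq_nonneg (|w n| - 1), sq_abs (w n)]
  have h3 := mul_le_mul_of_nonneg_left (hb n) hβ0
  have h4 := mul_le_mul_of_nonneg_left hA' (sub_nonneg.2 hβ1.le)
  have h5 := mul_le_mul_of_nonneg_left hwn hβ0
  have h6 : 0 ≤ √(n : ℝ) / (2 * ν) := by positivity
  have h7 := hE0 n
  have h8 : β * (1 + w n ^ 2) ≤ 1 + w n ^ 2 := mul_le_of_le_one_left (by positivity) hβ1.le
  have h9 : β * (√(n : ℝ) / (2 * ν)) ≥ 0 := by positivity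
  have h10 : β * E n ≤ E n := mul_le_of_le_one_left h7 hβ1.le
  have h11 : 0 ≤ β * E n := by positivity
  rw [hg]
  change _ ≤ √(n : ℝ) / (2 * ν) + (1 + w n ^ 2) + 2 * E n
  nlinarith

lemma sum_inv_sqrt_le (n : ℕ) : ∑ t ∈ Finset.range n, 1 / √(t + 1 : ℝ) ≤ 2 * √(n : ℝ) := by
  induction n with
  | zero => simp
  | succ n ih =>
    rw [Finset.sum_range_succ]
    push_cast
    have h1 : 0 < √(n + 1 : ℝ) := by positivity
    have h2 : 0 ≤ √(n : ℝ) := by positivity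
    have h3 : √(n + 1 : ℝ) ^ 2 = n + 1 := Real.sq_sqrt (by positivity)
    have h4 : √(n : ℝ) ^ 2 = n := Real.sq_sqrt (by positivity)
    have h5 : 1 / √(n + 1 : ℝ) ≤ 2 * √(n + 1 : ℝ) - 2 * √(n : ℝ) := by
      rw [div_le_iff₀ h1]
      nlinarith [sq_nonneg (√(n + 1 : ℝ) - √(n : ℝ))]
    linarith

/-! ### Expected regret of gradient ascent with momentum -/

section BGAM

lemma abs_clamp_sub_le {b x z : ℝ} (hb : 0 ≤ b) (hz : |z| ≤ b) :
    |max (-b) (min b x) - z| ≤ |x - z| := by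
  rw [abs_le] at hz
  rcases le_total b x with h1 | h1
  · rw [min_eq_left h1, max_eq_right (by linarith), abs_of_nonneg (by linarith),
      abs_of_nonneg (by linarith)]
    linarith
  · rw [min_eq_right h1]
    rcases le_total (-b) x with h2 | h2
    · rw [max_eq_right h2]
    · rw [max_eq_left h2, abs_of_nonpos (by linarith), abs_of_nonpos (by linarith)]
      linarith

variable {v : Fin K → Fin M → ℝ≥0} {π : Measure (Data K M)} [IsProbabilityMeasure π] {k : Fin K}
  {m : Fin M} {T : ℕ} {p : BGAM} {ρ ε κ B : ℝ} {st : ℕ → Data K M → ℝ × ℝ}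
  {S : ℕ → Data K M → ℝ}

open Env

/-- Given the past, utility times sign has mean `(h (x + σ) - h (x - σ)) / 2` for the payoff `h`, so
linear regret is divided by `σ` and the two-point inequality costs `O(σ)` per round. The rewards are
unbounded because of the noise, so the momentum is controlled in mean square instead of uniformly.
-/
lemma bgam_regret_le (h : Env v π k m T (.bgam p) ρ ε κ B st S) {y : ℝ} (hy4 : 4 * p.σ T ≤ y)
    (hy1 : y ≤ 1 - p.σ T) :
    ∑ t ∈ Finset.range T, ∫ d, (payoff ρ ε κ y (S t d)
        - payoff ρ ε κ (demand k m T (.bgam p) st t d) (S t d)) ∂π ≤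
      (√(T : ℝ) / (2 * p.ν) + (1 + (∫ z, (bound ε κ B + |z|) ^ 2 ∂gaussianReal 0 (v k m)) /
          (1 - p.β) ^ 2)
        + 4 * p.ν * √(T : ℝ) * ((∫ z, (bound ε κ B + |z|) ^ 2 ∂gaussianReal 0 (v k m)) /
          (1 - p.β) ^ 2)) / p.σ T
      + T * ((2 / y + |ε - κ|) * (2 * p.σ T)) := by
  have hσ := BGAM_σ_pos p h.T_pos
  have hβ : 0 < 1 - p.β := sub_pos.2 p.β_lt_one
  set σ := p.σ T with hσd
  set b := bound ε κ B with hb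
  set b1 : ℝ := (1 - p.α T) * BGAM.ξ with hb1d
  have hb1 : b1 = 1 / 2 - σ := by rw [hb1d, BGAM.α, BGAM.ξ]; ring
  have hb10 : 0 ≤ b1 := by
    have : p.α T ≤ 1 := h.good
    rw [hb1d, BGAM.ξ]; linarith
  -- The comparison demand in shifted coordinates; the conditions on `y` place it in the interval
  -- onto which the algorithm projects.
  set z0 : ℝ := y - 1 / 2 with hz0
  have hz0b : |z0| ≤ b1 := by rw [abs_le]; constructor <;> linarith
  set Y : ℕ → Data K M → ℝ := fun t d => (st t d).1 with hY
  set W : ℕ → Data K M → ℝ := fun t d => (st t d).2 with hW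
  set X : ℕ → Data K M → ℝ := demand k m T (.bgam p) st with hX
  have hXe : ∀ t d, X t d = Y t d + σ * d.1 (.sgn k m (t + 1)) + 1 / 2 := fun t d => rfl
  set u : ℕ → Data K M → ℝ := fun t d =>
    payoff ρ ε κ (X t d) (S t d) + d.1 (.noise k m (t + 1)) with hu
  set g : ℕ → Data K M → ℝ := fun t d => u t d * d.1 (.sgn k m (t + 1)) with hg
  have hW0 : ∀ d, W 0 d = 0 := fun d => by
    have := h.init d
    simp only [hW, this]; rfl
  have hY0 : ∀ d, Y 0 d = 0 := fun d => by
    have := h.init d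
    simp only [hY, this]; rfl
  have hWs : ∀ t d, W (t + 1) d = p.β * W t d + g t d := fun t d => by
    have := h.step t d
    simp only [hW, this]; rfl
  have hYs : ∀ t d, Y (t + 1) d =
      max (-b1) (min b1 (Y t d + p.ν / √(t + 1 : ℝ) * W (t + 1) d)) := fun t d => by
    have h1 := h.step t d
    have h2 : (((t + 1 : ℕ) : ℝ)) = (t : ℝ) + 1 := by push_cast; ring
    rw [hWs, ← h2]
    simp only [hY, h1]; rfl
  have hYb : ∀ t d, |Y t d| ≤ b1 := by
    intro t d
    cases t with
    | zero => rw [hY0, abs_zero]; exact hb10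
    | succ t =>
      rw [hYs, abs_le]
      exact ⟨le_max_left _ _, max_le (by linarith) (min_le_left _ _)⟩
  have hmst : ∀ t, Measurable (st t) := fun t => h.meas t
  have hmY : ∀ t, Measurable (Y t) := fun t => measurable_fst.comp (hmst t)
  have hmW : ∀ t, Measurable (W t) := fun t => measurable_snd.comp (hmst t)
  have hmu : ∀ t, Measurable (u t) := fun t =>
    (h.measurable_payoff_demand t).add (by fun_prop)
  have hmg : ∀ t, Measurable (g t) := fun t => (hmu t).mul (by fun_prop)
  -- a bound for the reward estimates
  have hgb : ∀ᵐ d ∂π, ∀ t, |g t d| ≤ b + |d.1 (.noise k m (t + 1))| := by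
    filter_upwards [h.ae_abs_payoff_le, h.law.ae_goodDraw] with d h1 h2 t
    have h3 : |d.1 (.sgn k m (t + 1))| = 1 := by
      rcases (h2 k m (t + 1)).sgn with h | h
      · have : d.1 (.sgn k m (t + 1)) = 1 := h
        rw [this]; simp
      · have : d.1 (.sgn k m (t + 1)) = -1 := h
        rw [this]; simp
    simp only [hg, hu]
    rw [abs_mul, h3, mul_one]
    exact (abs_add_le _ _).trans (add_le_add (h1 t) le_rfl)
  set G : ℝ := ∫ z, (b + |z|) ^ 2 ∂gaussianReal 0 (v k m) with hG
  have hG0 : 0 ≤ G := integral_nonneg fun z => sq_nonneg _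
  -- second moments of the momentum
  have hmom : ∀ t, Integrable (fun d => W t d ^ 2) π ∧ ∫ d, W t d ^ 2 ∂π ≤ G / (1 - p.β) ^ 2 := by
    intro t
    induction t with
    | zero =>
      have e : (fun d => W 0 d ^ 2) = fun _ => (0 : ℝ) := by ext d; rw [hW0]; simp
      rw [e]
      exact ⟨integrable_const _, by rw [integral_const, smul_zero]; positivity⟩
    | succ t ih =>
      obtain ⟨ih1, ih2⟩ := ih
      have hn := h.integrable_noise (integrable_sq_gaussian b (v k m)) (t + 1)
      have hd : Integrable (fun d => p.β * W t d ^ 2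
          + (b + |d.1 (.noise k m (t + 1))|) ^ 2 / (1 - p.β)) π :=
        (ih1.const_mul _).add (hn.div_const _)
      -- Convexity of the square with weights `β` and `1 - β`. The resulting recursion for the
      -- second moment has fixed point `G / (1 - β) ^ 2`.
      have hle : ∀ᵐ d ∂π, W (t + 1) d ^ 2 ≤ p.β * W t d ^ 2
          + (b + |d.1 (.noise k m (t + 1))|) ^ 2 / (1 - p.β) := by
        filter_upwards [hgb] with d hd
        have h1 : g t d ^ 2 ≤ (b + |d.1 (.noise k m (t + 1))|) ^ 2 := by
          rw [← sq_abs]; exact pow_le_pow_left₀ (abs_nonneg _) (hd t) 2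
        have h2 : g t d ^ 2 / (1 - p.β) ≤ (b + |d.1 (.noise k m (t + 1))|) ^ 2 / (1 - p.β) := by
          gcongr
        refine le_trans ?_ (add_le_add le_rfl h2)
        rw [hWs, ← sub_nonneg]
        have e : p.β * W t d ^ 2 + g t d ^ 2 / (1 - p.β) - (p.β * W t d + g t d) ^ 2 =
            p.β / (1 - p.β) * ((1 - p.β) * W t d - g t d) ^ 2 := by
          field_simp; ring
        rw [e]
        have := p.β_nonneg
        positivity
      refine ⟨hd.mono' ((hmW (t + 1)).pow_const 2).aestronglyMeasurable ?_, ?_⟩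
      · filter_upwards [hle] with d hd
        rwa [Real.norm_eq_abs, abs_of_nonneg (sq_nonneg _)]
      · calc ∫ d, W (t + 1) d ^ 2 ∂π ≤ ∫ d, (p.β * W t d ^ 2
              + (b + |d.1 (.noise k m (t + 1))|) ^ 2 / (1 - p.β)) ∂π :=
            integral_mono_of_nonneg (Eventually.of_forall fun d => sq_nonneg _) hd hle
          _ = p.β * (∫ d, W t d ^ 2 ∂π) + G / (1 - p.β) := by
            rw [integral_add (ih1.const_mul _) (hn.div_const _), integral_const_mul, integral_div,
              h.integral_noise (integrable_sq_gaussian b (v k m)) (t + 1)]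
          _ ≤ p.β * (G / (1 - p.β) ^ 2) + G / (1 - p.β) := by
            have := p.β_nonneg
            gcongr
          _ = G / (1 - p.β) ^ 2 := by field_simp; ring
  set V := G / (1 - p.β) ^ 2 with hV
  have hV0 : 0 ≤ V := by positivity
  -- one round
  have hgi : ∀ t, Integrable (g t) π := fun t =>
    ((integrable_const b).add (h.integrable_noise (integrable_abs_gaussian (v k m)) (t + 1))).mono'
      (hmg t).aestronglyMeasurable (hgb.mono fun d hd => hd t)
  have hzY : ∀ t d, |Y t d - z0| ≤ 1 := fun t d => by
    have h1 := abs_le.1 (hYb t d)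
    have h2 := abs_le.1 hz0b
    rw [abs_le]; constructor <;> linarith
  have hgYi : ∀ t, Integrable (fun d => g t d * (z0 - Y t d)) π := fun t => by
    refine (hgi t).abs.mono' ((hmg t).mul (measurable_const.sub (hmY t))).aestronglyMeasurable ?_
    refine Eventually.of_forall fun d => ?_
    rw [Real.norm_eq_abs, abs_mul, abs_sub_comm z0]
    exact mul_le_of_le_one_right (abs_nonneg _) (hzY t d)
  have hy01 : y ∈ Set.Icc (0 : ℝ) 1 := ⟨by linarith, by linarith⟩
  set err := (2 / y + |ε - κ|) * (2 * σ) with herr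
  have hround : ∀ t, ∫ d, (payoff ρ ε κ y (S t d) - payoff ρ ε κ (X t d) (S t d)) ∂π ≤
      (∫ d, g t d * (z0 - Y t d) ∂π) / σ + err := by
    intro t
    have e : (∫ d, g t d * (z0 - Y t d) ∂π) / σ + err =
        ∫ d, (g t d * (z0 - Y t d) / σ + err) ∂π := by
      rw [integral_add ((hgYi t).div_const σ) (integrable_const _), integral_div]; simp
    rw [e]
    -- Average over the own sign and noise of this round, with state and demand of the others
    -- frozen: the centred noise drops out and the two signs give the two evaluations.
    refine h.law.integral_le_of_resample
      ((h.integrable_payoff_const hy01 t).sub (h.integrable_payoff_demand t))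
      (((hgYi t).div_const σ).add (integrable_const _)) (.sgn k m (t + 1)) (.noise k m (t + 1)) ?_
    filter_upwards [h.S_mem] with d hd
    have hne : (Source.sgn k m (t + 1) : Source K M) ≠ .noise k m (t + 1) := by simp
    have hst : ∀ a z, st t ((d.set (.sgn k m (t + 1)) a).set (.noise k m (t + 1)) z) = st t d := by
      intro a z
      rw [h.st_set _ _ _ _ (by simp [round]), h.st_set _ _ _ _ (by simp [round])]
    have hS : ∀ a z, S t ((d.set (.sgn k m (t + 1)) a).set (.noise k m (t + 1)) z) = S t d := by
      intro a z
      rw [h.S_set _ _ _ _ (by simp [round]) rfl, h.S_set _ _ _ _ (by simp [round]) rfl]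
    have hYa : ∀ a z, Y t ((d.set (.sgn k m (t + 1)) a).set (.noise k m (t + 1)) z) = Y t d :=
      fun a z => by simp only [hY, hst]
    have hsa : ∀ a z, ((d.set (.sgn k m (t + 1)) a).set (.noise k m (t + 1)) z).1
        (.sgn k m (t + 1)) = a := fun a z => by
      rw [Data.set_apply_of_ne hne, Data.set_apply]
    have hXa : ∀ a z, X t ((d.set (.sgn k m (t + 1)) a).set (.noise k m (t + 1)) z) =
        Y t d + σ * a + 1 / 2 := fun a z => by rw [hXe, hYa, hsa]
    have hga : ∀ a z, g t ((d.set (.sgn k m (t + 1)) a).set (.noise k m (t + 1)) z) =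
        (payoff ρ ε κ (Y t d + σ * a + 1 / 2) (S t d) + z) * a := fun a z => by
      simp only [hg, hu, hXa, hS, hsa, Data.set_apply]
    simp only [hYa, hXa, hS, hga]
    have hz : ∀ a : ℝ, ∫ z, ((payoff ρ ε κ (Y t d + σ * a + 1 / 2) (S t d) + z) * a *
        (z0 - Y t d) / σ + err) ∂(Source.noise k m (t + 1)).law v =
        payoff ρ ε κ (Y t d + σ * a + 1 / 2) (S t d) * a * (z0 - Y t d) / σ + err := by
      intro a
      have e1 : ∀ z, (payoff ρ ε κ (Y t d + σ * a + 1 / 2) (S t d) + z) * a *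
          (z0 - Y t d) / σ + err =
          (payoff ρ ε κ (Y t d + σ * a + 1 / 2) (S t d) * a * (z0 - Y t d) / σ + err) +
          (a * (z0 - Y t d) / σ) * z := fun z => by ring
      simp only [e1, Source.law]
      rw [integral_add (integrable_const _) ((integrable_id_gaussian _).const_mul _),
        integral_const_mul, integral_id_gaussianReal]
      simp
    simp only [hz]
    simp only [integral_const, Source.law, probReal_univ, one_smul]
    rw [integral_sgn, integral_sgn]
    have hYt := abs_le.1 (hYb t d)
    have key := payoff_sub_average_le (ε := ε) (κ := κ) h.ρ_pos (x := Y t d + 1 / 2) (hd t).1 hσ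
      (by linarith) hy4
    have e2 : Y t d + σ * 1 + 1 / 2 = Y t d + 1 / 2 + σ := by ring
    have e3 : Y t d + σ * -1 + 1 / 2 = Y t d + 1 / 2 - σ := by ring
    rw [e2, e3]
    have e4 : y - (Y t d + 1 / 2) = z0 - Y t d := by rw [hz0]; ring
    rw [e4] at key
    calc _ = _ := by ring
      _ ≤ _ := key
      _ = _ := by rw [herr]; ring
  -- summation
  have hpath : ∀ d, ∑ t ∈ Finset.range T, g t d * (z0 - Y t d) ≤
      √(T : ℝ) / (2 * p.ν) + (1 + W T d ^ 2)
        + 2 * ∑ t ∈ Finset.range T, p.ν / √(t + 1 : ℝ) * W (t + 1) d ^ 2 := by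
    intro d
    refine momentum_regret (y := fun t => Y t d) (w := fun t => W t d) (g := fun t => g t d) p.ν_pos
      p.β_nonneg p.β_lt_one (hW0 d) (fun t => hWs t d) (fun t => hzY t d) (fun t => ?_)
      (fun t => ?_) T
    · simp only [hYs]; exact abs_clamp_sub_le hb10 hz0b
    · have h1 := abs_clamp_sub_le (x := Y t d + p.ν / √(t + 1 : ℝ) * W (t + 1) d) hb10 (hYb t d)
      rw [← hYs] at h1
      refine h1.trans_eq ?_
      have h2 : 0 ≤ p.ν / √(t + 1 : ℝ) := div_nonneg p.ν_pos.le (Real.sqrt_nonneg _)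
      rw [add_sub_cancel_left, abs_mul, abs_of_nonneg h2]
  have hsum : ∑ t ∈ Finset.range T, ∫ d, g t d * (z0 - Y t d) ∂π ≤
      √(T : ℝ) / (2 * p.ν) + (1 + V) + 4 * p.ν * √(T : ℝ) * V := by
    rw [← integral_finsetSum _ fun t _ => hgYi t]
    have hi1 : Integrable (fun d => √(T : ℝ) / (2 * p.ν) + (1 + W T d ^ 2)) π :=
      (integrable_const _).add ((integrable_const _).add (hmom T).1)
    have hi2 : ∀ t ∈ Finset.range T,
        Integrable (fun d => p.ν / √(t + 1 : ℝ) * W (t + 1) d ^ 2) π := fun t _ =>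
      (hmom (t + 1)).1.const_mul _
    have hi3 : Integrable (fun d => 2 * ∑ t ∈ Finset.range T,
        p.ν / √(t + 1 : ℝ) * W (t + 1) d ^ 2) π := (integrable_finsetSum _ hi2).const_mul 2
    refine (integral_mono (integrable_finsetSum _ fun t _ => hgYi t) (hi1.add hi3) hpath).trans ?_
    have e1 : ∫ d, ((√(T : ℝ) / (2 * p.ν) + (1 + W T d ^ 2))
        + 2 * ∑ t ∈ Finset.range T, p.ν / √(t + 1 : ℝ) * W (t + 1) d ^ 2) ∂π =
        √(T : ℝ) / (2 * p.ν) + (1 + ∫ d, W T d ^ 2 ∂π)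
        + 2 * ∑ t ∈ Finset.range T, p.ν / √(t + 1 : ℝ) * ∫ d, W (t + 1) d ^ 2 ∂π := by
      have h1 := integral_affine₂ (hmom T).1 (hmom T).1 (√(T : ℝ) / (2 * p.ν) + 1) 1 0
      simp only [one_mul, zero_mul, add_zero, add_assoc] at h1
      rw [integral_add hi1 hi3, integral_const_mul, integral_finsetSum _ hi2, h1]
      simp only [integral_const_mul]
    refine e1.trans_le ?_
    have h1 : ∑ t ∈ Finset.range T, p.ν / √(t + 1 : ℝ) * ∫ d, W (t + 1) d ^ 2 ∂π ≤
        p.ν * V * (2 * √(T : ℝ)) := by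
      calc _ ≤ ∑ t ∈ Finset.range T, p.ν * V * (1 / √(t + 1 : ℝ)) := by
            refine Finset.sum_le_sum fun t _ => ?_
            have h3 : 0 ≤ p.ν / √(t + 1 : ℝ) := div_nonneg p.ν_pos.le (Real.sqrt_nonneg _)
            refine (mul_le_mul_of_nonneg_left (hmom (t + 1)).2 h3).trans_eq ?_
            ring
        _ = p.ν * V * ∑ t ∈ Finset.range T, 1 / √(t + 1 : ℝ) := by rw [Finset.mul_sum]
        _ ≤ _ := mul_le_mul_of_nonneg_left (sum_inv_sqrt_le T) (mul_nonneg p.ν_pos.le hV0)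
    have h2 := (hmom T).2
    linarith
  calc _ ≤ ∑ t ∈ Finset.range T, ((∫ d, g t d * (z0 - Y t d) ∂π) / σ + err) :=
        Finset.sum_le_sum fun t _ => hround t
    _ = (∑ t ∈ Finset.range T, ∫ d, g t d * (z0 - Y t d) ∂π) / σ + T * err := by
        rw [Finset.sum_add_distrib, Finset.sum_div]; simp
    _ ≤ _ := by gcongr

omit [IsProbabilityMeasure π] in
lemma payoff_le_of_abs_sub_le {x y r S : ℝ} (hρ : 0 < ρ) (hy : 0 < y) (hx : y / 2 ≤ x)
    (hxy : |y - x| ≤ r) (hS : 0 ≤ S) :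
    payoff ρ ε κ y S ≤ payoff ρ ε κ x S + (2 / y + |ε - κ|) * r := by
  have h1 := abs_payoff_sub_le (ε := ε) (κ := κ) hρ (half_pos hy) (by linarith : y / 2 ≤ y) hx hS
  have e : 1 / (y / 2) = 2 / y := by field_simp
  rw [e] at h1
  have h2 : (2 / y + |ε - κ|) * |y - x| ≤ (2 / y + |ε - κ|) * r := by gcongr
  linarith [le_abs_self (payoff ρ ε κ y S - payoff ρ ε κ x S)]

/-- Gradient ascent with momentum has sublinear expected regret. -/
theorem bgam_regret {st : ∀ T, ℕ → Data K M → ((Policy.bgam p).learner T).State}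
    {S : ℕ → ℕ → Data K M → ℝ}
    (h : ∀ᶠ T in atTop, Env v π k m T (.bgam p) ρ ε κ B (st T) (S T)) {y : ℝ}
    (hy : y ∈ Set.Ioc (0 : ℝ) 1) {δ : ℝ} (hδ : 0 < δ) :
    ∀ᶠ T in atTop, ∑ t ∈ Finset.range T, ∫ d, (payoff ρ ε κ y (S T t d)
        - payoff ρ ε κ (demand k m T (.bgam p) (st T) t d) (S T t d)) ∂π ≤ δ * T := by
  set c := √(BGAM.ξ * p.U * BGAM.ξ / (3 * (p.L * BGAM.ξ + p.U))) with hc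
  have hc0 : 0 < c := by
    have h1 := p.L_pos
    have h2 := p.U_pos
    rw [hc, BGAM.ξ]; positivity
  have hν := p.ν_pos
  have hy0 := hy.1
  set V := (∫ z, (bound ε κ B + |z|) ^ 2 ∂gaussianReal 0 (v k m)) / (1 - p.β) ^ 2 with hV
  have hV0 : 0 ≤ V := div_nonneg (integral_nonneg fun z => sq_nonneg _) (sq_nonneg _)
  set C := 1 / (2 * p.ν) + (1 + V) + 4 * p.ν * V with hC
  have hC0 : 0 < C := by positivity
  -- The whole regret will be at most `D * σ * T`. The factor `3` collects two units from the
  -- two-point estimate and one from moving `y` to `y'`.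
  set D := C / c ^ 2 + (4 / y + |ε - κ|) * 3 with hD
  have hD0 : 0 < D := by positivity
  have hlim := BGAM_tendsto_σ p
  filter_upwards [h, hlim.eventually (gt_mem_nhds (show 0 < y / 8 by linarith)),
    hlim.eventually (gt_mem_nhds (show 0 < 1 / 4 by norm_num)),
    hlim.eventually (gt_mem_nhds (show 0 < δ / D by positivity))] with T hT h1 h2 h3
  have hσ := BGAM_σ_pos p hT.T_pos
  have hT0 : (0 : ℝ) < T := by exact_mod_cast hT.T_pos
  have hT1 : (1 : ℝ) ≤ T := by exact_mod_cast hT.T_pos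
  have hσe : p.σ T = (T : ℝ) ^ (-(1 / 4) : ℝ) * c := rfl
  set σ := p.σ T
  -- Demands within `σ` of `1` are not admissible for `bgam_regret_le`; lowering `y` by at most `σ`
  -- costs only a Lipschitz error.
  set y' := min y (1 - σ) with hy'
  have hy'1 : y / 2 ≤ y' := by rw [hy', le_min_iff]; constructor <;> linarith [hy.2]
  have hyy : |y - y'| ≤ σ := by
    rcases min_cases y (1 - σ) with h | h
    · rw [hy', h.1, sub_self, abs_zero]; exact hσ.le
    · rw [hy', h.1, abs_le]; constructor <;> linarith [hy.2, h.2]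
  have hb := bgam_regret_le hT (y := y') (by linarith) (min_le_right _ _)
  have hy'm : y' ∈ Set.Icc (0 : ℝ) 1 := ⟨by linarith, (min_le_left _ _).trans hy.2⟩
  have hdiff : ∀ t, ∫ d, (payoff ρ ε κ y (S T t d)
        - payoff ρ ε κ (demand k m T (.bgam p) (st T) t d) (S T t d)) ∂π ≤
      ∫ d, (payoff ρ ε κ y' (S T t d)
        - payoff ρ ε κ (demand k m T (.bgam p) (st T) t d) (S T t d)) ∂π
        + (2 / y + |ε - κ|) * σ := by
    intro t
    have i1 := (hT.integrable_payoff_const (Set.Ioc_subset_Icc_self hy) t).sub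
      (hT.integrable_payoff_demand t)
    have i2 := (hT.integrable_payoff_const hy'm t).sub (hT.integrable_payoff_demand t)
    have e : (2 / y + |ε - κ|) * σ = ∫ _, (2 / y + |ε - κ|) * σ ∂π := by simp
    rw [e]
    refine (integral_mono_ae i1 (i2.add (integrable_const _)) ?_).trans_eq
      (integral_add i2 (integrable_const _))
    filter_upwards [hT.S_mem] with d hd
    have := payoff_le_of_abs_sub_le (ε := ε) (κ := κ) hT.ρ_pos hy0 hy'1 hyy (hd t).1
    simp only [Pi.sub_apply, Pi.add_apply]
    linarith
  -- As `σ = c * T^(-1/4)`, the term `√T / σ` equals `T * σ / c^2`: this exploration radius balances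
  -- both sources of regret.
  have hsq : √(T : ℝ) = T * (σ / c) ^ 2 := by
    have e1 : σ / c = (T : ℝ) ^ (-(1 / 4) : ℝ) := by rw [hσe]; field_simp
    rw [e1, ← Real.rpow_natCast, ← Real.rpow_mul hT0.le, Real.sqrt_eq_rpow]
    nth_rewrite 2 [← Real.rpow_one (T : ℝ)]
    rw [← Real.rpow_add hT0]
    norm_num
  have hsq1 : 1 ≤ √(T : ℝ) := Real.one_le_sqrt.2 hT1
  have hfirst : (√(T : ℝ) / (2 * p.ν) + (1 + V) + 4 * p.ν * √(T : ℝ) * V) / σ ≤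
      T * (C / c ^ 2 * σ) := by
    calc _ ≤ (C * √(T : ℝ)) / σ := by
          gcongr
          have : 1 + V ≤ (1 + V) * √(T : ℝ) := le_mul_of_one_le_right (by positivity) hsq1
          have e : C * √(T : ℝ) = √(T : ℝ) / (2 * p.ν) + (1 + V) * √(T : ℝ)
              + 4 * p.ν * √(T : ℝ) * V := by rw [hC]; ring
          rw [e]; linarith
      _ = _ := by rw [hsq]; field_simp
  have h4 : 2 / y' ≤ 4 / y := by
    rw [div_le_div_iff₀ (by linarith) hy0]; linarith
  have h5 : 2 / y ≤ 4 / y := by gcongr; norm_num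
  calc _ ≤ ∑ t ∈ Finset.range T, (∫ d, (payoff ρ ε κ y' (S T t d)
        - payoff ρ ε κ (demand k m T (.bgam p) (st T) t d) (S T t d)) ∂π
        + (2 / y + |ε - κ|) * σ) := Finset.sum_le_sum fun t _ => hdiff t
    _ = (∑ t ∈ Finset.range T, ∫ d, (payoff ρ ε κ y' (S T t d)
        - payoff ρ ε κ (demand k m T (.bgam p) (st T) t d) (S T t d)) ∂π)
        + T * ((2 / y + |ε - κ|) * σ) := by rw [Finset.sum_add_distrib]; simp
    _ ≤ (T * (C / c ^ 2 * σ) + T * ((4 / y + |ε - κ|) * (2 * σ)))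
        + T * ((4 / y + |ε - κ|) * σ) := by
      refine add_le_add (hb.trans (add_le_add hfirst ?_)) ?_ <;> gcongr
    _ = T * (D * σ) := by rw [hD]; ring
    _ ≤ T * (D * (δ / D)) := by gcongr
    _ = δ * T := by field_simp

end BGAM

end FogGame

/-! Exponential weights -/

namespace FogGame

section Prob

variable {γ : ℝ} {n : ℕ} {w : ℕ → ℝ}

lemma sum_weights_pos (hn : 0 < n) (hw : ∀ i, 0 < w i) : 0 < ∑ i ∈ Finset.range n, w i :=
  Finset.sum_pos (fun i _ => hw i) (Finset.nonempty_range_iff.2 hn.ne')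

lemma prob_ge (hγ1 : γ ≤ 1) (hw : ∀ i, 0 < w i) (j : ℕ) :
    γ / n ≤ LBWI.prob γ n w j := by
  have h1 : 0 ≤ ∑ i ∈ Finset.range n, w i := Finset.sum_nonneg fun i _ => (hw i).le
  have h2 : 0 ≤ (1 - γ) * (w j / ∑ i ∈ Finset.range n, w i) :=
    mul_nonneg (by linarith) (div_nonneg (hw j).le h1)
  unfold LBWI.prob
  linarith

lemma prob_pos (hn : 0 < n) (hγ0 : 0 < γ) (hγ1 : γ ≤ 1) (hw : ∀ i, 0 < w i) (j : ℕ) :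
    0 < LBWI.prob γ n w j :=
  lt_of_lt_of_le (div_pos hγ0 (by exact_mod_cast hn)) (prob_ge hγ1 hw j)

lemma sum_prob (hn : 0 < n) (hw : ∀ i, 0 < w i) :
    ∑ j ∈ Finset.range n, LBWI.prob γ n w j = 1 := by
  have h1 := (sum_weights_pos hn hw).ne'
  have h2 : (n : ℝ) ≠ 0 := by exact_mod_cast hn.ne'
  unfold LBWI.prob
  rw [Finset.sum_add_distrib, ← Finset.mul_sum, ← Finset.sum_div, div_self h1]
  simp
  field_simp
  ring

/-- Uniform exploration keeps `n * p j ≥ γ`, so the exponent of an update never exceeds `|u|`,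
whatever arm is played. -/
lemma rate_le_one (hn : 0 < n) (hγ0 : 0 < γ) (hγ1 : γ ≤ 1) (hw : ∀ i, 0 < w i) (j : ℕ) :
    γ / (n * LBWI.prob γ n w j) ≤ 1 := by
  have h0 : (0 : ℝ) < n := by exact_mod_cast hn
  have h1 := prob_ge hγ1 hw j (n := n)
  have h2 := prob_pos hn hγ0 hγ1 hw j
  rw [div_le_one (by positivity)]
  rw [div_le_iff₀ h0] at h1
  linarith

lemma abs_exponent_le (hn : 0 < n) (hγ0 : 0 < γ) (hγ1 : γ ≤ 1) (hw : ∀ i, 0 < w i) (j : ℕ)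
    (u : ℝ) : |γ * u / (n * LBWI.prob γ n w j)| ≤ |u| := by
  have h1 := rate_le_one hn hγ0 hγ1 hw j
  have h2 := prob_pos hn hγ0 hγ1 hw j
  rw [mul_div_right_comm, abs_mul, abs_of_nonneg (by positivity)]
  exact mul_le_of_le_one_left (abs_nonneg _) h1

lemma reweight_pos (hw : ∀ i, 0 < w i) (j : ℕ) (u : ℝ) (i : ℕ) :
    0 < LBWI.reweight γ n w j u i := by
  unfold LBWI.reweight
  rw [Function.update_apply]
  split_ifs
  · exact mul_pos (hw j) (Real.exp_pos _)
  · exact hw i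

/-- Expectation over the arm that is selected by a uniform random number. -/
lemma integral_select {q : ℕ → ℝ} (hn : 0 < n) (hq : ∀ i, 0 ≤ q i)
    (hq1 : ∑ i ∈ Finset.range n, q i = 1) (G : ℕ → ℝ) :
    ∫ a in Set.Icc (0 : ℝ) 1, G (LBWI.select n q a) = ∑ j ∈ Finset.range n, q j * G j := by
  set c : ℕ → ℝ := fun j => ∑ i ∈ Finset.range j, q i with hc
  have hc0 : c 0 = 0 := by simp [hc]
  have hcn : c n = 1 := hq1
  have hcs : ∀ j, c (j + 1) = c j + q j := fun j => Finset.sum_range_succ _ _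
  have hmono : Monotone c := monotone_nat_of_le_succ fun j => by rw [hcs]; linarith [hq j]
  have hsel : ∀ j < n, ∀ a ∈ Set.Ioo (c j) (c (j + 1)), LBWI.select n q a = j := by
    intro j hj a ha
    unfold LBWI.select
    have : (Finset.range (n - 1)).filter (fun j => ∑ i ∈ Finset.range (j + 1), q i ≤ a) =
        Finset.range j := by
      ext i
      simp only [Finset.mem_filter, Finset.mem_range]
      constructor
      · rintro ⟨-, h2⟩
        by_contra! h3
        exact absurd (ha.2.trans_le (hmono (Nat.succ_le_succ h3))) (not_lt.2 h2)
      · intro h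
        exact ⟨by omega, (hmono (Nat.succ_le_of_lt h)).trans ha.1.le⟩
    rw [this, Finset.card_range]
  have hae : ∀ j < n, ∀ᵐ a ∂(volume : Measure ℝ), a ∈ Set.uIoc (c j) (c (j + 1)) →
      G (LBWI.select n q a) = G j := by
    intro j hj
    have h1 : ∀ᵐ a ∂(volume : Measure ℝ), a ≠ c (j + 1) := by
      rw [ae_iff]; simp
    filter_upwards [h1] with a ha hm
    rw [Set.uIoc_of_le (hmono (Nat.le_succ j))] at hm
    rw [hsel j hj a ⟨hm.1, lt_of_le_of_ne hm.2 ha⟩]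
  have hint : ∀ j < n, IntervalIntegrable (fun a => G (LBWI.select n q a)) volume (c j)
      (c (j + 1)) := by
    intro j hj
    refine (intervalIntegrable_const (c := G j)).congr_ae ?_
    rw [Filter.EventuallyEq, ae_restrict_iff' measurableSet_uIoc]
    filter_upwards [hae j hj] with a ha hm
    exact (ha hm).symm
  rw [integral_Icc_eq_integral_Ioc, ← intervalIntegral.integral_of_le zero_le_one, ← hc0, ← hcn,
    ← intervalIntegral.sum_integral_adjacent_intervals hint]
  refine Finset.sum_congr rfl fun j hj => ?_
  rw [intervalIntegral.integral_congr_ae (hae j (Finset.mem_range.1 hj)),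
    intervalIntegral.integral_const, hcs]
  simp

/-- A second-order bound without a size restriction, needed because rewards are unbounded; `exp |x|`
is later integrated against the Gaussian noise. -/
lemma exp_le_one_add {x : ℝ} : Real.exp x ≤ 1 + x + x ^ 2 * Real.exp |x| := by
  have h1 : ∀ x : ℝ, 0 ≤ x → Real.exp x ≤ 1 + x + x ^ 2 * Real.exp x := by
    intro x hx
    have h2 := Real.one_sub_le_exp_neg x
    have h3 : Real.exp x * Real.exp (-x) = 1 := by rw [← Real.exp_add]; simp
    have h4 := Real.exp_pos x
    have h5 := Real.add_one_le_exp x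
    nlinarith [mul_le_mul_of_nonneg_left h2 h4.le]
  rcases le_total 0 x with hx | hx
  · rw [abs_of_nonneg hx]; exact h1 x hx
  · have h2 : 1 ≤ Real.exp |x| := Real.one_le_exp (abs_nonneg x)
    have h3 : Real.exp x ≤ 1 + x + x ^ 2 := by
      rcases le_total (-1) x with h | h
      · exact (Real.abs_exp_sub_one_sub_id_le (abs_le.2 ⟨h, by linarith⟩) |> fun h => by
          linarith [le_abs_self (Real.exp x - 1 - x)])
      · have : Real.exp x ≤ 1 := Real.exp_le_one_iff.2 hx
        nlinarith
    nlinarith [sq_nonneg x]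

/-- Normalized logarithm of the total weight, relative to the arm `i`. -/
noncomputable def potential (γ : ℝ) (n : ℕ) (w : ℕ → ℝ) (i : ℕ) : ℝ :=
  n / γ * (Real.log (∑ j ∈ Finset.range n, w j) - Real.log (w i))

lemma potential_nonneg (hγ0 : 0 < γ) (hw : ∀ i, 0 < w i) {i : ℕ} (hi : i < n) :
    0 ≤ potential γ n w i := by
  refine mul_nonneg (by positivity) (sub_nonneg.2 (Real.log_le_log (hw i) ?_))
  exact Finset.single_le_sum (f := w) (fun j _ => (hw j).le) (Finset.mem_range.2 hi)

lemma sum_reweight {j : ℕ} (hj : j < n) (u : ℝ) :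
    ∑ i ∈ Finset.range n, LBWI.reweight γ n w j u i =
      ∑ i ∈ Finset.range n, w i +
        w j * (Real.exp (γ * u / (n * LBWI.prob γ n w j)) - 1) := by
  have hm := Finset.mem_range.2 hj
  unfold LBWI.reweight
  rw [Finset.sum_update_of_mem hm, Finset.sdiff_singleton_eq_erase,
    ← Finset.add_sum_erase _ w hm]
  ring

/-- Bound for the change of the potential, if the arm `j` yields the reward `u`. -/
noncomputable def drift (γ : ℝ) (n : ℕ) (w : ℕ → ℝ) (i j : ℕ) (u Γ : ℝ) : ℝ :=
  (w j / (∑ l ∈ Finset.range n, w l) / LBWI.prob γ n w j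
      - if j = i then 1 / LBWI.prob γ n w j else 0) * u
    + γ * (w j / (∑ l ∈ Finset.range n, w l) / (n * LBWI.prob γ n w j ^ 2)) * Γ

/-- Change of the potential in one step of the exponential weights algorithm. -/
lemma potential_step (hn : 0 < n) (hγ0 : 0 < γ) (hγ1 : γ ≤ 1) (hw : ∀ i, 0 < w i) {j : ℕ}
    (hj : j < n) (i : ℕ) {u Γ : ℝ} (hΓ : u ^ 2 * Real.exp |u| ≤ Γ) :
    potential γ n (LBWI.reweight γ n w j u) i - potential γ n w i ≤ drift γ n w i j u Γ := by
  have hW := sum_weights_pos hn hw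
  set W := ∑ l ∈ Finset.range n, w l with hWd
  have hp := prob_pos hn hγ0 hγ1 hw j
  have hl1 := rate_le_one hn hγ0 hγ1 hw j
  set pj := LBWI.prob γ n w j with hpj
  have hn0 : (0 : ℝ) < n := by exact_mod_cast hn
  set lam := γ / (n * pj) with hlam
  have hl0 : 0 < lam := by positivity
  have hE : γ * u / (n * pj) = lam * u := by rw [hlam]; ring
  have hlog1 : Real.log (∑ l ∈ Finset.range n, LBWI.reweight γ n w j u l) - Real.log W ≤
      w j / W * (lam * u + lam ^ 2 * Γ) := by
    have hpos : 0 < ∑ l ∈ Finset.range n, LBWI.reweight γ n w j u l :=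
      sum_weights_pos hn (reweight_pos hw j u)
    rw [← Real.log_div hpos.ne' hW.ne']
    refine (Real.log_le_sub_one_of_pos (div_pos hpos hW)).trans ?_
    rw [sum_reweight hj, ← hpj, ← hWd, hE]
    have e1 : (W + w j * (Real.exp (lam * u) - 1)) / W - 1 =
        w j / W * (Real.exp (lam * u) - 1) := by field_simp; ring
    rw [e1]
    refine mul_le_mul_of_nonneg_left ?_ (div_pos (hw j) hW).le
    have h1 := exp_le_one_add (x := lam * u)
    have h2 : |lam * u| ≤ |u| := by
      rw [abs_mul, abs_of_pos hl0]; exact mul_le_of_le_one_left (abs_nonneg _) hl1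
    have h3 : (lam * u) ^ 2 * Real.exp |lam * u| ≤ lam ^ 2 * Γ := by
      rw [mul_pow, mul_assoc]
      refine mul_le_mul_of_nonneg_left (le_trans ?_ hΓ) (sq_nonneg _)
      exact mul_le_mul_of_nonneg_left (Real.exp_le_exp.2 h2) (sq_nonneg _)
    linarith
  have hlog2 : Real.log (LBWI.reweight γ n w j u i) - Real.log (w i) =
      if j = i then lam * u else 0 := by
    unfold LBWI.reweight
    rw [← hpj, hE, Function.update_apply]
    by_cases h : i = j
    · subst h
      simp only [if_true]
      rw [Real.log_mul (hw i).ne' (Real.exp_pos _).ne', Real.log_exp]; ring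
    · rw [if_neg h, if_neg (Ne.symm h), sub_self]
  have e : potential γ n (LBWI.reweight γ n w j u) i - potential γ n w i =
      n / γ * ((Real.log (∑ l ∈ Finset.range n, LBWI.reweight γ n w j u l) - Real.log W) -
        (Real.log (LBWI.reweight γ n w j u i) - Real.log (w i))) := by
    unfold potential; ring
  rw [e, hlog2]
  refine (mul_le_mul_of_nonneg_left (sub_le_sub_right hlog1 _) (by positivity)).trans_eq ?_
  unfold drift
  rw [← hWd, ← hpj, hlam]
  split_ifs with h
  · field_simp; ring
  · field_simp; ring

/-- Comparison of the average rewards in one round. -/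
lemma average_reward_le (hn : 0 < n) (hγ0 : 0 < γ) (hw : ∀ i, 0 < w i)
    {H : ℕ → ℝ} {b : ℝ} (hH : ∀ j < n, |H j| ≤ b) :
    (∑ j ∈ Finset.range n, w j / (∑ l ∈ Finset.range n, w l) * H j) ≤
      (∑ j ∈ Finset.range n, LBWI.prob γ n w j * H j) + 2 * γ * b := by
  have hW := sum_weights_pos hn hw
  set W := ∑ l ∈ Finset.range n, w l with hWd
  have hn0 : (0 : ℝ) < n := by exact_mod_cast hn
  have hq : ∑ j ∈ Finset.range n, w j / W = 1 := by rw [← Finset.sum_div, div_self hW.ne']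
  have e : 2 * γ * b = ∑ j ∈ Finset.range n, (γ * (w j / W) * b + γ / n * b) := by
    rw [Finset.sum_add_distrib, ← Finset.sum_mul, ← Finset.mul_sum, hq]
    simp
    field_simp
    ring
  rw [e, ← Finset.sum_add_distrib]
  refine Finset.sum_le_sum fun j hj => ?_
  have h1 := abs_le.1 (hH j (Finset.mem_range.1 hj))
  have h2 : 0 < w j / W := div_pos (hw j) hW
  have h3 : 0 < γ / n := div_pos hγ0 hn0
  unfold LBWI.prob
  rw [← hWd]
  have h4 : 0 ≤ γ * (w j / W) * (b - H j) := by
    have : 0 ≤ b - H j := by linarith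
    positivity
  have h5 : 0 ≤ γ / n * (b + H j) := by
    have : 0 ≤ b + H j := by linarith
    positivity
  nlinarith

/-- The probability is at least `1 - γ ≥ 1/2` times the normalized weight. -/
lemma ratio_le_two (hn : 0 < n) (hγ0 : 0 < γ) (hγ1 : γ ≤ 1 / 2) (hw : ∀ i, 0 < w i) (j : ℕ) :
    w j / (∑ l ∈ Finset.range n, w l) / LBWI.prob γ n w j ≤ 2 := by
  have hW := sum_weights_pos hn hw
  have hp := prob_pos hn hγ0 (by linarith) hw j
  rw [div_le_iff₀ hp]
  unfold LBWI.prob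
  have h2 : 0 < w j / ∑ l ∈ Finset.range n, w l := div_pos (hw j) hW
  have h3 : 0 ≤ γ / n := by positivity
  nlinarith

/-- A crude bound, of order `n / γ`, which serves for integrability only. -/
lemma abs_drift_le (hn : 0 < n) (hγ0 : 0 < γ) (hγ1 : γ ≤ 1 / 2) (hw : ∀ i, 0 < w i) (i j : ℕ)
    (u : ℝ) {Γ : ℝ} (hΓ : 0 ≤ Γ) : |drift γ n w i j u Γ| ≤ (2 + n / γ) * |u| + 2 * Γ := by
  have hW := sum_weights_pos hn hw
  have hp := prob_pos hn hγ0 (by linarith) hw j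
  have hr := ratio_le_two hn hγ0 hγ1 hw j
  have hl := rate_le_one hn hγ0 (by linarith) hw j
  have hg := prob_ge (by linarith : γ ≤ 1) hw j (n := n)
  have hn0 : (0 : ℝ) < n := by exact_mod_cast hn
  set pj := LBWI.prob γ n w j
  have hq : 0 < w j / ∑ l ∈ Finset.range n, w l := div_pos (hw j) hW
  set q := w j / ∑ l ∈ Finset.range n, w l
  have h1 : |q / pj - if j = i then 1 / pj else 0| ≤ 2 + n / γ := by
    have h2 : 1 / pj ≤ n / γ := by
      rw [div_le_div_iff₀ hp hγ0]
      rw [div_le_iff₀ hn0] at hg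
      linarith
    have h3 : 0 < 1 / pj := by positivity
    have h4 : 0 < q / pj := by positivity
    split_ifs
    · rw [abs_le]; constructor <;> linarith
    · rw [sub_zero, abs_of_pos h4]; linarith
  have h5 : γ * (q / (n * pj ^ 2)) ≤ 2 := by
    have e : γ * (q / (n * pj ^ 2)) = (q / pj) * (γ / (n * pj)) := by field_simp
    rw [e]
    have : 0 ≤ γ / (n * pj) := by positivity
    have h4 : 0 < q / pj := by positivity
    nlinarith
  unfold drift
  refine (abs_add_le _ _).trans (add_le_add ?_ ?_)
  · rw [abs_mul]; gcongr
  · rw [abs_mul, abs_of_nonneg (by positivity), abs_of_nonneg hΓ]; gcongr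

/-- Average of the drift over the selected arm. -/
lemma sum_prob_mul_drift_le (hn : 0 < n) (hγ0 : 0 < γ) (hγ1 : γ ≤ 1 / 2) (hw : ∀ i, 0 < w i)
    {i : ℕ} (hi : i < n) {H : ℕ → ℝ} {b C : ℝ} (hH : ∀ j < n, |H j| ≤ b) (hC : 0 ≤ C) :
    ∑ j ∈ Finset.range n, LBWI.prob γ n w j * drift γ n w i j (H j) C ≤
      (∑ j ∈ Finset.range n, LBWI.prob γ n w j * H j) - H i + 2 * γ * b + 2 * γ * C := by
  have hn0 : (0 : ℝ) < n := by exact_mod_cast hn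
  -- Importance weighting: the probability cancels the `1 / p` in the drift, leaving the weighted
  -- average reward minus the reward of arm `i`.
  have e : ∀ j, LBWI.prob γ n w j * drift γ n w i j (H j) C =
      w j / (∑ l ∈ Finset.range n, w l) * H j - (if j = i then H j else 0)
        + γ / n * C * (w j / (∑ l ∈ Finset.range n, w l) / LBWI.prob γ n w j) := by
    intro j
    have hp := prob_pos hn hγ0 (by linarith) hw j
    unfold drift
    split_ifs <;> (field_simp; try ring)
  simp only [e]
  rw [Finset.sum_add_distrib, Finset.sum_sub_distrib, Finset.sum_ite_eq' (Finset.range n) i H,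
    if_pos (Finset.mem_range.2 hi)]
  have h1 := average_reward_le hn hγ0 hw hH
  have h2 : ∑ j ∈ Finset.range n,
      γ / n * C * (w j / (∑ l ∈ Finset.range n, w l) / LBWI.prob γ n w j) ≤ 2 * γ * C := by
    calc _ ≤ ∑ j ∈ Finset.range n, γ / n * C * 2 := by
          refine Finset.sum_le_sum fun j _ => ?_
          exact mul_le_mul_of_nonneg_left (ratio_le_two hn hγ0 hγ1 hw j) (by positivity)
      _ = 2 * γ * C := by simp; field_simp
  linarith

lemma measurable_drift {α : Type*} [MeasurableSpace α] {n i j : α → ℕ} {w : α → ℕ → ℝ}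
    {u Γ : α → ℝ} (hn : Measurable n) (hi : Measurable i) (hj : Measurable j) (hw : Measurable w)
    (hu : Measurable u) (hΓ : Measurable Γ) :
    Measurable fun a => drift γ (n a) (w a) (i a) (j a) (u a) (Γ a) := by
  have h1 := measurable_sum_range hw hn
  have h2 := measurable_eval_nat hw hj
  have h3 := measurable_eval_nat (measurable_prob (γ := γ) hw hn) hj
  have h4 : Measurable (fun a => (n a : ℝ)) := measurable_from_nat.comp hn
  have h5 : Measurable fun a => if j a = i a then 1 / LBWI.prob γ (n a) (w a) (j a) else 0 :=
    Measurable.ite (measurableSet_eq_fun hj hi) (measurable_const.div h3) measurable_const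
  exact ((((h2.div h1).div h3).sub h5).mul hu).add
    ((((h2.div h1).div (h4.mul (h3.pow_const 2))).const_mul γ).mul hΓ)

end Prob

end FogGame

/-! The Lipschitz bandit with initialization -/

namespace FogGame

/-! ### Bounds along a single path of the Lipschitz bandit -/

section Sequence

variable {p : LBWI} {T : ℕ} {s : ℕ → LBWI.State} {δ : ℕ → Draw} {u q : ℕ → ℝ}

lemma abs_update_mean_le {f c : ℕ → ℝ} {j : ℕ} {x Q Q' : ℝ} (hf : ∀ i, |f i| ≤ Q)
    (hc : ∀ i, 0 ≤ c i) (hQ : Q ≤ Q') (hx : |x| ≤ Q') (i : ℕ) :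
    |Function.update f j ((f j * c j + x) / (c j + 1)) i| ≤ Q' := by
  rw [Function.update_apply]
  split_ifs
  · have h1 : 0 < c j + 1 := by linarith [hc j]
    rw [abs_div, abs_of_pos h1, div_le_iff₀ h1]
    refine (abs_add_le _ _).trans ?_
    rw [abs_mul, abs_of_nonneg (hc j)]
    have := mul_le_mul_of_nonneg_right ((hf j).trans hQ) (hc j)
    linarith
  · exact (hf i).trans hQ

lemma update_count_nonneg {c : ℕ → ℝ} (hc : ∀ i, 0 ≤ c i) (j i : ℕ) :
    0 ≤ Function.update c j (1 + c j) i := by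
  rw [Function.update_apply]
  split_ifs
  · linarith [hc j]
  · exact hc i

lemma sum_range_mono (hq : ∀ t, |u t| ≤ q t) (t : ℕ) :
    ∑ i ∈ Finset.range t, q i ≤ ∑ i ∈ Finset.range (t + 1), q i := by
  rw [Finset.sum_range_succ]
  linarith [(abs_nonneg (u t)).trans (hq t)]

lemma abs_le_sum_range (hq : ∀ t, |u t| ≤ q t) (t : ℕ) :
    |u t| ≤ ∑ i ∈ Finset.range (t + 1), q i := by
  rw [Finset.sum_range_succ]
  have : 0 ≤ ∑ i ∈ Finset.range t, q i :=
    Finset.sum_nonneg fun i _ => (abs_nonneg (u i)).trans (hq i)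
  linarith [hq t]

/-- One update multiplies a weight by a factor between `exp (-q t)` and `exp (q t)`, and an average
never exceeds the sum of the reward bounds. Hence unbounded rewards do harm only through their sum.
-/
lemma first_phase (h0 : s 0 = (p.learner T).init)
    (hs : ∀ t, s (t + 1) = (p.learner T).upd (t + 1) (δ t) (u t) (s t))
    (hq : ∀ t, |u t| ≤ q t) (t : ℕ) (ht : t < p.T₁) :
    (s t).n = p.N ∧
      (∀ i, Real.exp (-∑ i ∈ Finset.range t, q i) ≤ (s t).w i ∧
        (s t).w i ≤ Real.exp (∑ i ∈ Finset.range t, q i)) ∧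
      (∀ i, 0 ≤ (s t).count i) ∧ ∀ i, |(s t).mean i| ≤ ∑ i ∈ Finset.range t, q i := by
  induction t with
  | zero => rw [h0]; simp [LBWI.learner]
  | succ t ih =>
    obtain ⟨h1, h2, h3, h4⟩ := ih (by omega)
    rw [hs]
    simp only [LBWI.learner, ht, if_true]
    refine ⟨h1, fun i => ?_, fun i => update_count_nonneg h3 _ i,
      fun i => abs_update_mean_le h4 h3 (sum_range_mono hq t) (abs_le_sum_range hq t) i⟩
    have hw : ∀ i, 0 < (s t).w i := fun i => (Real.exp_pos _).trans_le (h2 i).1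
    have hm := sum_range_mono hq t
    unfold LBWI.reweight
    rw [Function.update_apply]
    split_ifs
    · have hn : 0 < (s t).n := by rw [h1]; exact p.N_pos
      have h5 := abs_le.1 ((abs_exponent_le hn (p.γ_pos T) (p.γ_le_one T) hw
        (p.arm T (t + 1) (δ t) (s t)) (u t)).trans (hq t))
      rw [Finset.sum_range_succ, neg_add, Real.exp_add, Real.exp_add]
      have h6 := h2 (p.arm T (t + 1) (δ t) (s t))
      constructor
      · exact mul_le_mul h6.1 (Real.exp_le_exp.2 h5.1) (Real.exp_pos _).le (hw _).le
      · exact mul_le_mul h6.2 (Real.exp_le_exp.2 h5.2) (Real.exp_pos _).le (Real.exp_pos _).le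
    · exact ⟨(Real.exp_le_exp.2 (neg_le_neg hm)).trans (h2 i).1,
        (h2 i).2.trans (Real.exp_le_exp.2 hm)⟩

lemma T₁_pos (p : LBWI) : 0 < p.T₁ := Nat.mul_pos p.A_pos p.N_pos

/-- Splitting the intervals multiplies all weights by the same factor `c`, which is left unspecified
because the potential is invariant under scaling. -/
lemma second_phase_start (hT : 0 < T) (h0 : s 0 = (p.learner T).init)
    (hs : ∀ t, s (t + 1) = (p.learner T).upd (t + 1) (δ t) (u t) (s t))
    (hq : ∀ t, |u t| ≤ q t) :
    ∃ mean : ℕ → ℝ, (∀ i, |mean i| ≤ ∑ i ∈ Finset.range p.T₁, q i) ∧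
      (s p.T₁).n = p.Ntilde T mean ∧ ∃ c > 0, ∀ i,
        c * Real.exp (-∑ i ∈ Finset.range p.T₁, q i) ≤ (s p.T₁).w i ∧
        (s p.T₁).w i ≤ c * Real.exp (∑ i ∈ Finset.range p.T₁, q i) := by
  -- The update in round `T₁` uses the averages including that round, but the weights from before
  -- it; so the weight bounds are needed after `T₁ - 1` rounds.
  obtain ⟨t, ht⟩ : ∃ t, p.T₁ = t + 1 := ⟨p.T₁ - 1, by have := T₁_pos p; omega⟩
  obtain ⟨h1, h2, h3, h4⟩ := first_phase h0 hs hq t (by omega)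
  rw [ht, hs]
  have hm := sum_range_mono hq t
  simp only [LBWI.learner, ht.symm, if_true, if_false, lt_irrefl]
  have hmean := fun i => abs_update_mean_le (j := p.arm T p.T₁ (δ t) (s t)) h4 h3 hm
    (abs_le_sum_range hq t) i
  rw [← ht] at hmean hm
  generalize Function.update (s t).mean (p.arm T p.T₁ (δ t) (s t)) _ = f at hmean ⊢
  have hc : ∀ f, (0 : ℝ) < p.N / p.Ntilde T f := fun f =>
    div_pos (Nat.cast_pos.2 p.N_pos) (Nat.cast_pos.2 (Ntilde_pos p hT f))
  refine ⟨f, hmean, rfl, _, hc f, fun i => ⟨?_, ?_⟩⟩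
  · refine mul_le_mul_of_nonneg_left ?_ (by positivity)
    exact (Real.exp_le_exp.2 (neg_le_neg hm)).trans (h2 _).1
  · refine mul_le_mul_of_nonneg_left ?_ (by positivity)
    exact (h2 _).2.trans (Real.exp_le_exp.2 hm)

lemma arm_of_le {t : ℕ} (ht : p.T₁ ≤ t) (d : Draw) (σ : LBWI.State) :
    p.arm T (t + 1) d σ = LBWI.select σ.n (LBWI.prob (p.γ T) σ.n σ.w) d.arm := by
  unfold LBWI.arm
  rw [if_neg (by omega)]

lemma second_phase_step (hs : ∀ t, s (t + 1) = (p.learner T).upd (t + 1) (δ t) (u t) (s t))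
    {t : ℕ} (ht : p.T₁ ≤ t) :
    (s (t + 1)).n = (s t).n ∧ (s (t + 1)).w =
      LBWI.reweight (p.γ T) (s t).n (s t).w (p.arm T (t + 1) (δ t) (s t)) (u t) := by
  have h1 : ¬ (t + 1 < p.T₁) := by omega
  have h2 : ¬ (t + 1 = p.T₁) := by omega
  rw [hs]
  simp only [LBWI.learner, h1, h2, if_false, and_self]

lemma second_phase (hT : 0 < T) (h0 : s 0 = (p.learner T).init)
    (hs : ∀ t, s (t + 1) = (p.learner T).upd (t + 1) (δ t) (u t) (s t))
    {t : ℕ} (ht : p.T₁ ≤ t) :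
    (s t).n = (s p.T₁).n ∧ 0 < (s t).n ∧ ∀ i, 0 < (s t).w i := by
  induction t, ht using Nat.le_induction with
  | base =>
    obtain ⟨f, -, hn, c, hc, hw⟩ := second_phase_start hT h0 hs (fun t => le_rfl)
    exact ⟨rfl, by rw [hn]; exact Ntilde_pos p hT f,
      fun i => (mul_pos hc (Real.exp_pos _)).trans_le (hw i).1⟩
  | succ t ht ih =>
    obtain ⟨h1, h2, h3⟩ := ih
    obtain ⟨h4, h5⟩ := second_phase_step hs ht
    rw [h4, h5]
    exact ⟨h1, h2, reweight_pos h3 _ _⟩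

end Sequence

/-! ### Growth of the number of arms and of the initial potential -/

section Arms

/-- Lower bound for the number of arms of the second phase. -/
noncomputable def armsLower (p : LBWI) (T : ℕ) : ℝ :=
  (p.N * √(2 / p.A * Real.log (2 * p.N * T))) ^ (2 / 3 : ℝ) * (T : ℝ) ^ (1 / 3 : ℝ)

/-- Upper bound for the number of arms of the second phase, if the total reward in the first phase is
at most `R`. -/
noncomputable def armsUpper (p : LBWI) (R : ℝ) (T : ℕ) : ℝ :=
  (p.N * (2 * R) + p.N * √(2 / p.A * Real.log (2 * p.N * T))) ^ (2 / 3 : ℝ) * (T : ℝ) ^ (1 / 3 : ℝ)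
    + p.N

variable (p : LBWI) (T : ℕ) (mean : ℕ → ℝ)

lemma armsLower_le : armsLower p T ≤ p.Ntilde T mean := by
  have h1 : (0 : ℝ) < p.N := by exact_mod_cast p.N_pos
  have h2 : 0 ≤ p.Lhat mean := mul_nonneg h1.le (Real.iSup_nonneg fun j => abs_nonneg _)
  have h3 := Nat.le_ceil (p.Ltilde T mean ^ (2 / 3 : ℝ) * (T : ℝ) ^ (1 / 3 : ℝ) / p.N)
  rw [div_le_iff₀ h1] at h3
  unfold LBWI.Ntilde armsLower
  push_cast
  rw [mul_comm (p.N : ℝ) (_ : ℝ)] at *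
  refine le_trans ?_ (h3.trans_eq ?_)
  · unfold LBWI.Ltilde
    gcongr
    rw [mul_comm]
    linarith
  · ring

lemma le_armsUpper {R : ℝ} (hR : ∀ i, |mean i| ≤ R) : (p.Ntilde T mean : ℝ) ≤ armsUpper p R T := by
  have h1 : (0 : ℝ) < p.N := by exact_mod_cast p.N_pos
  have hR0 : 0 ≤ R := (abs_nonneg _).trans (hR 0)
  have h2 : p.Lhat mean ≤ p.N * (2 * R) := by
    refine mul_le_mul_of_nonneg_left (Real.iSup_le (fun j => ?_) (by positivity)) h1.le
    refine (abs_sub _ _).trans ?_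
    linarith [hR j, hR (j + 1)]
  have h2' : 0 ≤ p.Lhat mean := mul_nonneg h1.le (Real.iSup_nonneg fun j => abs_nonneg _)
  have h4 : 0 ≤ p.Ltilde T mean := by
    unfold LBWI.Ltilde; positivity
  have h3 := (Nat.ceil_lt_add_one (a := p.Ltilde T mean ^ (2 / 3 : ℝ) * (T : ℝ) ^ (1 / 3 : ℝ) / p.N)
    (by positivity)).le
  have h5 := mul_le_mul_of_nonneg_left h3 h1.le
  unfold LBWI.Ntilde armsUpper
  push_cast
  refine h5.trans ?_
  rw [mul_add, mul_one, mul_div_cancel₀ _ h1.ne']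
  have h6 : p.Ltilde T mean ≤ p.N * (2 * R) + p.N * √(2 / p.A * Real.log (2 * p.N * T)) := by
    unfold LBWI.Ltilde; linarith
  gcongr

lemma tendsto_armsLower : Tendsto (armsLower p) atTop atTop := by
  have h1 : (0 : ℝ) < p.N := by exact_mod_cast p.N_pos
  have h2 : (0 : ℝ) < p.A := by exact_mod_cast p.A_pos
  have t0 : Tendsto (fun T : ℕ => (T : ℝ)) atTop atTop := tendsto_natCast_atTop_atTop
  have t1 : Tendsto (fun T : ℕ => 2 * p.N * (T : ℝ)) atTop atTop :=
    t0.const_mul_atTop (by positivity)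
  have t2 := (Real.tendsto_log_atTop.comp t1).const_mul_atTop (show 0 < 2 / (p.A : ℝ) by positivity)
  have t3 := (Real.tendsto_sqrt_atTop.comp t2).const_mul_atTop h1
  have t4 := (tendsto_rpow_atTop (show (0 : ℝ) < 2 / 3 by norm_num)).comp t3
  have t5 := (tendsto_rpow_atTop (show (0 : ℝ) < 1 / 3 by norm_num)).comp t0
  exact t4.atTop_mul_atTop₀ t5

/-- With `l = log T`, the number `b` of arms is `O((l * T)^(1/3))` and `log b = O(l)`, so `b * (log
b + 2R) = O(l^(4/3) * T^(1/3))`. Division by `γ` gives `o(T)` by the assumption `γ_rate`. -/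
lemma eventually_armsUpper_le {R δ : ℝ} (hR : 0 ≤ R) (hδ : 0 < δ) :
    ∀ᶠ T : ℕ in atTop, 1 ≤ armsUpper p R T ∧
      armsUpper p R T / p.γ T * (Real.log (armsUpper p R T) + 2 * R) ≤ δ * T := by
  have h1 : (1 : ℝ) ≤ p.N := by exact_mod_cast p.N_pos
  have h2 : (1 : ℝ) ≤ p.A := by exact_mod_cast p.A_pos
  set D : ℝ := p.N * (2 * R) + p.N * √(2 * (Real.log (2 * p.N) + 1)) with hD
  have hlN : 0 ≤ Real.log (2 * p.N) := Real.log_nonneg (by linarith)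
  have hD0 : 0 ≤ D := by positivity
  set C : ℝ := D ^ (2 / 3 : ℝ) + p.N with hC
  have hC1 : 1 ≤ C := by
    have : 0 ≤ D ^ (2 / 3 : ℝ) := by positivity
    linarith
  have hlC : 0 ≤ Real.log C := Real.log_nonneg hC1
  set C' : ℝ := C * (Real.log C + 1 + 2 * R) with hC'
  filter_upwards [p.γ_rate.eventually_ge_atTop (C' / δ),
    (Real.tendsto_log_atTop.comp tendsto_natCast_atTop_atTop).eventually_ge_atTop 1,
    eventually_ge_atTop 1] with T hγ hl hT
  simp only [Function.comp] at hl
  have hT1 : (1 : ℝ) ≤ T := by exact_mod_cast hT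
  have hT0 : (0 : ℝ) < T := by linarith
  have hγ0 := p.γ_pos T
  set l := Real.log T with hld
  set b := armsUpper p R T with hb
  have hb1 : 1 ≤ b := by
    have h3 : 0 ≤ p.N * (2 * R) + p.N * √(2 / p.A * Real.log (2 * p.N * T)) := by positivity
    have : 0 ≤ (p.N * (2 * R) + p.N * √(2 / p.A * Real.log (2 * p.N * T))) ^ (2 / 3 : ℝ) *
      (T : ℝ) ^ (1 / 3 : ℝ) := by positivity
    rw [hb, armsUpper]; linarith
  refine ⟨hb1, ?_⟩
  have hbase : p.N * (2 * R) + p.N * √(2 / p.A * Real.log (2 * p.N * T)) ≤ D * √l := by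
    have e1 : Real.log (2 * p.N * T) ≤ (Real.log (2 * p.N) + 1) * l := by
      rw [Real.log_mul (by positivity) (by positivity)]
      nlinarith
    have e2 : 2 / p.A * Real.log (2 * p.N * T) ≤ 2 * (Real.log (2 * p.N) + 1) * l := by
      have e3 : 0 ≤ Real.log (2 * p.N * T) := Real.log_nonneg (by nlinarith)
      have e4 : 2 / (p.A : ℝ) ≤ 2 := div_le_self (by norm_num) h2
      nlinarith
    have e5 := Real.sqrt_le_sqrt e2
    rw [Real.sqrt_mul (show 0 ≤ 2 * (Real.log (2 * p.N) + 1) by positivity) l] at e5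
    have e6 : 1 ≤ √l := Real.one_le_sqrt.2 hl
    have e7 : (p.N : ℝ) * (2 * R) ≤ p.N * (2 * R) * √l :=
      le_mul_of_one_le_right (by positivity) e6
    rw [hD, add_mul]
    have := mul_le_mul_of_nonneg_left e5 (by linarith : (0 : ℝ) ≤ p.N)
    linarith
  have hl0 : 0 < l := by linarith
  have hbC : b ≤ C * (l ^ (1 / 3 : ℝ) * (T : ℝ) ^ (1 / 3 : ℝ)) := by
    have e1 : (D * √l) ^ (2 / 3 : ℝ) = D ^ (2 / 3 : ℝ) * l ^ (1 / 3 : ℝ) := by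
      rw [Real.mul_rpow hD0 (Real.sqrt_nonneg _), Real.sqrt_eq_rpow, ← Real.rpow_mul hl0.le]
      norm_num
    have e2 : 1 ≤ l ^ (1 / 3 : ℝ) := Real.one_le_rpow hl (by norm_num)
    have e3 : 1 ≤ (T : ℝ) ^ (1 / 3 : ℝ) := Real.one_le_rpow hT1 (by norm_num)
    have e4 : 1 ≤ l ^ (1 / 3 : ℝ) * (T : ℝ) ^ (1 / 3 : ℝ) := by nlinarith
    have e5 : (p.N * (2 * R) + p.N * √(2 / p.A * Real.log (2 * p.N * T))) ^ (2 / 3 : ℝ) ≤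
        D ^ (2 / 3 : ℝ) * l ^ (1 / 3 : ℝ) := by
      rw [← e1]
      exact Real.rpow_le_rpow (by positivity) hbase (by norm_num)
    rw [hb, armsUpper, hC, add_mul]
    refine add_le_add ?_ (le_mul_of_one_le_right (by linarith) e4)
    exact (mul_le_mul_of_nonneg_right e5 (by positivity)).trans_eq (mul_assoc _ _ _)
  have hlogb : Real.log b ≤ (Real.log C + 1) * l := by
    have e1 : Real.log b ≤ Real.log (C * (l ^ (1 / 3 : ℝ) * (T : ℝ) ^ (1 / 3 : ℝ))) :=
      Real.log_le_log (by linarith) hbC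
    rw [Real.log_mul (by positivity) (by positivity), Real.log_mul (by positivity) (by positivity),
      Real.log_rpow hl0, Real.log_rpow hT0, ← hld] at e1
    have e2 := Real.log_le_sub_one_of_pos hl0
    nlinarith
  have hprod : b * (Real.log b + 2 * R) ≤ C' * (l ^ (4 / 3 : ℝ) * (T : ℝ) ^ (1 / 3 : ℝ)) := by
    have e1 : Real.log b + 2 * R ≤ (Real.log C + 1 + 2 * R) * l := by nlinarith
    have e2 : l ^ (4 / 3 : ℝ) = l ^ (1 / 3 : ℝ) * l := by
      nth_rewrite 3 [← Real.rpow_one l]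
      rw [← Real.rpow_add hl0]; norm_num
    calc b * (Real.log b + 2 * R) ≤
          C * (l ^ (1 / 3 : ℝ) * (T : ℝ) ^ (1 / 3 : ℝ)) * ((Real.log C + 1 + 2 * R) * l) := by
          refine mul_le_mul hbC e1 ?_ (by positivity)
          have := Real.log_nonneg hb1
          positivity
      _ = _ := by rw [hC', e2]; ring
  rw [div_le_div_iff₀ hδ (by positivity)] at hγ
  have hTT : (T : ℝ) ^ (2 / 3 : ℝ) * (T : ℝ) ^ (1 / 3 : ℝ) = T := by
    rw [← Real.rpow_add hT0]; norm_num
  rw [div_mul_eq_mul_div, div_le_iff₀ hγ0]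
  calc b * (Real.log b + 2 * R) ≤ C' * l ^ (4 / 3 : ℝ) * (T : ℝ) ^ (1 / 3 : ℝ) := by
        rw [mul_assoc]; exact hprod
    _ ≤ p.γ T * (T : ℝ) ^ (2 / 3 : ℝ) * δ * (T : ℝ) ^ (1 / 3 : ℝ) := by gcongr
    _ = δ * ((T : ℝ) ^ (2 / 3 : ℝ) * (T : ℝ) ^ (1 / 3 : ℝ)) * p.γ T := by ring
    _ = _ := by rw [hTT]

/-- Both the logarithm of the total and that of a single weight contain `log c`, which cancels; what
remains is `log n` and the spread `2 * Q`. -/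
lemma potential_le {γ : ℝ} {n : ℕ} {w : ℕ → ℝ} {c Q b : ℝ} (hγ : 0 < γ) (hn : 0 < n) (hc : 0 < c)
    (hw : ∀ i, c * Real.exp (-Q) ≤ w i ∧ w i ≤ c * Real.exp Q) (hnb : (n : ℝ) ≤ b) (hQ : 0 ≤ Q)
    (i : ℕ) : potential γ n w i ≤ b / γ * (Real.log b + 2 * Q) := by
  have hn1 : (1 : ℝ) ≤ n := by exact_mod_cast hn
  have hw0 : ∀ i, 0 < w i := fun i => (mul_pos hc (Real.exp_pos _)).trans_le (hw i).1
  have h1 : ∑ j ∈ Finset.range n, w j ≤ n * (c * Real.exp Q) := by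
    refine (Finset.sum_le_sum fun j _ => (hw j).2).trans_eq ?_
    simp
  have h2 := Real.log_le_log (sum_weights_pos hn hw0) h1
  have h3 := Real.log_le_log (mul_pos hc (Real.exp_pos _)) (hw i).1
  rw [Real.log_mul (by positivity) (by positivity), Real.log_mul hc.ne' (Real.exp_pos _).ne',
    Real.log_exp] at h2
  rw [Real.log_mul hc.ne' (Real.exp_pos _).ne', Real.log_exp] at h3
  have h4 : Real.log n ≤ Real.log b := Real.log_le_log (by linarith) hnb
  have h5 : Real.log (∑ j ∈ Finset.range n, w j) - Real.log (w i) ≤ Real.log b + 2 * Q := by linarith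
  have h6 : 0 ≤ Real.log b + 2 * Q := by
    have := Real.log_nonneg (hn1.trans hnb)
    linarith
  unfold potential
  calc _ ≤ n / γ * (Real.log b + 2 * Q) := by gcongr
    _ ≤ _ := by gcongr

end Arms

/-- A bound for `u ^ 2 * exp |u|`, where `|u| ≤ b + |z|`. -/
noncomputable def noiseBound (b z : ℝ) : ℝ :=
  2 * Real.exp (2 * b) * (Real.exp (2 * z) + Real.exp (-2 * z))

lemma noiseBound_pos (b z : ℝ) : 0 < noiseBound b z := by unfold noiseBound; positivity

/-- Combine `u² ≤ 2 exp |u|` with `exp (2|z|) ≤ exp (2z) + exp (-2z)`; the right side has finite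
Gaussian mean. -/
lemma sq_mul_exp_le_noiseBound {u b z : ℝ} (h : |u| ≤ b + |z|) :
    u ^ 2 * Real.exp |u| ≤ noiseBound b z := by
  have h1 := Real.quadratic_le_exp_of_nonneg (abs_nonneg u)
  have h2 : u ^ 2 ≤ 2 * Real.exp |u| := by
    rw [sq_abs] at h1
    linarith [abs_nonneg u]
  have h3 : Real.exp |u| * Real.exp |u| ≤ Real.exp (2 * b) * Real.exp (2 * |z|) := by
    rw [← Real.exp_add, ← Real.exp_add]
    exact Real.exp_le_exp.2 (by linarith)
  have h4 : Real.exp (2 * |z|) ≤ Real.exp (2 * z) + Real.exp (-2 * z) := by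
    rcases abs_cases z with h | h
    · rw [h.1]; linarith [Real.exp_pos (-2 * z)]
    · rw [h.1, mul_neg, ← neg_mul]; linarith [Real.exp_pos (2 * z)]
  unfold noiseBound
  calc u ^ 2 * Real.exp |u| ≤ 2 * Real.exp |u| * Real.exp |u| := by gcongr
    _ = 2 * (Real.exp |u| * Real.exp |u|) := by ring
    _ ≤ 2 * (Real.exp (2 * b) * Real.exp (2 * |z|)) := by gcongr
    _ ≤ 2 * (Real.exp (2 * b) * (Real.exp (2 * z) + Real.exp (-2 * z))) := by gcongr
    _ = _ := by ring

lemma integrable_noiseBound (b : ℝ) (w : ℝ≥0) : Integrable (noiseBound b) (gaussianReal 0 w) :=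
  ((integrable_exp_mul_gaussianReal 2).add (integrable_exp_mul_gaussianReal (-2))).const_mul _

lemma measurable_noiseBound (b : ℝ) : Measurable (noiseBound b) := by
  unfold noiseBound; fun_prop

/-- The arm whose interval contains `y`. -/
noncomputable def targetArm (y : ℝ) (n : ℕ) : ℕ := min ⌊y * n⌋₊ (n - 1)

lemma targetArm_lt (y : ℝ) {n : ℕ} (hn : 0 < n) : targetArm y n < n := by
  unfold targetArm; omega

/-- The interval with index `⌊y * n⌋` contains `y`, except at `y = 1`, where the minimum in
`targetArm` selects the last interval. -/
lemma abs_sub_targetArm_le {y z : ℝ} (hy : y ∈ Set.Ioc (0 : ℝ) 1) {n : ℕ} (hn : 0 < n)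
    (hz : z ∈ Set.Icc (0 : ℝ) 1) : |y - (targetArm y n + z) / n| ≤ 1 / n := by
  have hn0 : (0 : ℝ) < n := by exact_mod_cast hn
  have e : y - (targetArm y n + z) / n = (y * n - (targetArm y n + z)) / n := by field_simp
  rw [e, abs_div, abs_of_pos hn0]
  gcongr
  have h0 : 0 ≤ y * n := mul_nonneg hy.1.le hn0.le
  have h1 := Nat.floor_le h0
  have h2 := Nat.lt_floor_add_one (y * n)
  have h3 : y * n ≤ n := mul_le_of_le_one_left hn0.le hy.2
  unfold targetArm
  rcases min_cases ⌊y * n⌋₊ (n - 1) with h | h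
  · rw [h.1, abs_le]; constructor <;> linarith [hz.1, hz.2]
  · have h4 : n ≤ ⌊y * n⌋₊ := by omega
    have h5 : (n : ℝ) ≤ ⌊y * n⌋₊ := by exact_mod_cast h4
    have h6 : ((n - 1 : ℕ) : ℝ) = n - 1 := by
      rw [Nat.cast_sub hn]; simp
    rw [h.1, h6, abs_le]; constructor <;> linarith [hz.1, hz.2]

end FogGame

/-! Regret of the Lipschitz bandit with initialization -/

namespace FogGame

variable {K M : ℕ}

/-- The drift is affine in the reward and in the second-order bound, so centred noise disappears
from the first and only the mean of the second survives. -/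
lemma integral_drift (γ : ℝ) (n : ℕ) (w : ℕ → ℝ) (i j : ℕ) (H b : ℝ) (s : ℝ≥0) :
    ∫ z, drift γ n w i j (H + z) (noiseBound b z) ∂gaussianReal 0 s =
      drift γ n w i j H (∫ z, noiseBound b z ∂gaussianReal 0 s) := by
  unfold drift
  generalize (w j / (∑ l ∈ Finset.range n, w l) / LBWI.prob γ n w j
      - if j = i then 1 / LBWI.prob γ n w j else 0) = A
  generalize γ * (w j / (∑ l ∈ Finset.range n, w l) / (n * LBWI.prob γ n w j ^ 2)) = B
  have e : ∀ z, A * (H + z) + B * noiseBound b z = A * H + (A * z + B * noiseBound b z) :=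
    fun z => by ring
  simp only [e]
  have i1 := (integrable_id_gaussian s).const_mul A
  have i2 := (integrable_noiseBound b s).const_mul B
  have i3 : Integrable (fun z => A * z + B * noiseBound b z) (gaussianReal 0 s) := i1.add i2
  rw [integral_add (integrable_const _) i3, integral_add i1 i2, integral_const_mul, integral_const_mul, integral_const_mul,
    integral_id_gaussianReal]
  simp

/-! ### Expected regret of the Lipschitz bandit -/

section LBWI

variable {v : Fin K → Fin M → ℝ≥0} {π : Measure (Data K M)} {k : Fin K}
  {m : Fin M} {T : ℕ} {p : LBWI} {ρ ε κ B : ℝ} {st : ℕ → Data K M → LBWI.State}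
  {S : ℕ → Data K M → ℝ}

open Env

/-- Bound for the sum of the rewards of the first phase. -/
noncomputable def firstReward (k : Fin K) (m : Fin M) (p : LBWI) (b : ℝ) (d : Data K M) : ℝ :=
  ∑ t ∈ Finset.range p.T₁, (b + |d.1 (.noise k m (t + 1))|)

lemma measurable_firstReward (k : Fin K) (m : Fin M) (p : LBWI) (b : ℝ) :
    Measurable (firstReward k m p b) := by
  unfold firstReward; fun_prop

lemma firstReward_set {s : Source K M} (hs : p.T₁ < round s) (b : ℝ) (d : Data K M) (z : ℝ) :
    firstReward k m p b (d.set s z) = firstReward k m p b d := by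
  refine Finset.sum_congr rfl fun t ht => ?_
  have h1 : (Source.noise k m (t + 1) : Source K M) ≠ s := by
    rintro rfl
    have := Finset.mem_range.1 ht
    simp only [round] at hs
    omega
  rw [Data.set_apply_of_ne h1]

/-- Indicator of the event that the sum of the rewards of the first phase is not large. -/
noncomputable def moderate (k : Fin K) (m : Fin M) (p : LBWI) (b R : ℝ) (d : Data K M) : ℝ :=
  if firstReward k m p b d ≤ R then 1 else 0

lemma measurable_moderate (k : Fin K) (m : Fin M) (p : LBWI) (b R : ℝ) :
    Measurable (moderate k m p b R) :=
  Measurable.ite (measurableSet_le (measurable_firstReward k m p b) measurable_const)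
    measurable_const measurable_const

lemma moderate_mem (k : Fin K) (m : Fin M) (p : LBWI) (b R : ℝ) (d : Data K M) :
    moderate k m p b R d = 0 ∨ moderate k m p b R d = 1 ∧ firstReward k m p b d ≤ R := by
  unfold moderate
  split_ifs with h
  · exact Or.inr ⟨rfl, h⟩
  · exact Or.inl rfl

lemma lbwi_state (h : Env v π k m T (.lbwi p) ρ ε κ B st S) {t : ℕ} (ht : p.T₁ ≤ t)
    (d : Data K M) :
    (st t d).n = (st p.T₁ d).n ∧ 0 < (st t d).n ∧ ∀ i, 0 < (st t d).w i :=
  second_phase (p := p) (s := fun t => st t d) h.T_pos (h.init d) (fun t => h.step t d) ht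

lemma lbwi_demand {t : ℕ} (ht : p.T₁ ≤ t)
    (d : Data K M) :
    demand k m T (.lbwi p) st t d = ((LBWI.select (st t d).n
      (LBWI.prob (p.γ T) (st t d).n (st t d).w) (d.1 (.arm k m (t + 1))) : ℝ)
        + d.1 (.pos k m (t + 1))) / (st t d).n := by
  change ((p.arm T (t + 1) (d.draw k m (t + 1)) (st t d) : ℝ) + _) / _ = _
  rw [arm_of_le ht]
  rfl

/-- The bound for the change of the potential in round `t + 1`. -/
noncomputable def roundDrift (k : Fin K) (m : Fin M) (T : ℕ) (p : LBWI) (ρ ε κ b y : ℝ)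
    (st : ℕ → Data K M → LBWI.State) (S : ℕ → Data K M → ℝ) (t : ℕ) (d : Data K M) : ℝ :=
  drift (p.γ T) (st t d).n (st t d).w (targetArm y (st t d).n)
    (LBWI.select (st t d).n (LBWI.prob (p.γ T) (st t d).n (st t d).w) (d.1 (.arm k m (t + 1))))
    (payoff ρ ε κ (demand k m T (.lbwi p) st t d) (S t d) + d.1 (.noise k m (t + 1)))
    (noiseBound b (d.1 (.noise k m (t + 1))))

lemma measurable_roundDrift (h : Env v π k m T (.lbwi p) ρ ε κ B st S) (b y : ℝ) (t : ℕ) :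
    Measurable (roundDrift k m T p ρ ε κ b y st S t) := by
  have hm : MeasStateLBWI (st t) := h.meas t
  refine measurable_drift hm.n ((measurable_from_nat (f := targetArm y)).comp hm.n) ?_ hm.w
    ((h.measurable_payoff_demand t).add (by fun_prop))
    ((measurable_noiseBound b).comp (by fun_prop))
  exact measurable_select (measurable_prob hm.w hm.n) hm.n (by fun_prop)

variable [IsProbabilityMeasure π]

lemma ae_reward_le (h : Env v π k m T (.lbwi p) ρ ε κ B st S) :
    ∀ᵐ d ∂π, ∀ t, |payoff ρ ε κ (demand k m T (.lbwi p) st t d) (S t d)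
      + d.1 (.noise k m (t + 1))| ≤ bound ε κ B + |d.1 (.noise k m (t + 1))| := by
  filter_upwards [h.ae_abs_payoff_le] with d hd t
  exact (abs_add_le _ _).trans (add_le_add (hd t) le_rfl)

lemma second_phase_arms_le {R : ℝ} (h : Env v π k m T (.lbwi p) ρ ε κ B st S) :
    ∀ᵐ d ∂π, armsLower p T ≤ (st p.T₁ d).n ∧ (firstReward k m p (bound ε κ B) d ≤ R →
      ((st p.T₁ d).n : ℝ) ≤ armsUpper p R T ∧ ∀ i,
        potential (p.γ T) (st p.T₁ d).n (st p.T₁ d).w i ≤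
          armsUpper p R T / p.γ T * (Real.log (armsUpper p R T) + 2 * R)) := by
  filter_upwards [ae_reward_le h] with d hd
  obtain ⟨f, hf, hn, c, hc, hw⟩ := second_phase_start (p := p) (s := fun t => st t d)
    (δ := fun t => d.draw k m (t + 1)) h.T_pos (h.init d) (fun t => h.step t d) hd
  refine ⟨by rw [hn]; exact armsLower_le p T f, fun hR => ?_⟩
  have hle : ((st p.T₁ d).n : ℝ) ≤ armsUpper p R T := by
    rw [hn]; exact le_armsUpper p T f fun i => (hf i).trans hR
  have hR0 : 0 ≤ R := ((abs_nonneg _).trans (hf 0)).trans hR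
  have hn0 : 0 < (st p.T₁ d).n := by rw [hn]; exact Ntilde_pos p h.T_pos f
  refine ⟨hle, fun i => potential_le (p.γ_pos T) hn0 hc (fun i => ⟨le_trans ?_ (hw i).1,
    (hw i).2.trans ?_⟩) hle hR0 i⟩
  · exact mul_le_mul_of_nonneg_left (Real.exp_le_exp.2 (neg_le_neg hR)) hc.le
  · exact mul_le_mul_of_nonneg_left (Real.exp_le_exp.2 hR) hc.le

/-- The number of arms is random and depends on the noise of the first phase; the indicator
`moderate` bounds it by a constant. -/
lemma integrable_roundDrift (h : Env v π k m T (.lbwi p) ρ ε κ B st S) (hγ : p.γ T ≤ 1 / 2)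
    (R y : ℝ) {t : ℕ} (ht : p.T₁ ≤ t) :
    Integrable (fun d => moderate k m p (bound ε κ B) R d
      * roundDrift k m T p ρ ε κ (bound ε κ B) y st S t d) π := by
  set b := bound ε κ B
  have hγ0 := p.γ_pos T
  have i1 : Integrable (fun d : Data K M =>
      (2 + |armsUpper p R T| / p.γ T) * (b + |d.1 (.noise k m (t + 1))|)
        + 2 * noiseBound b (d.1 (.noise k m (t + 1)))) π := by
    refine Integrable.add (Integrable.const_mul ?_ _) (Integrable.const_mul ?_ _)
    · exact (integrable_const b).add (h.integrable_noise (integrable_abs_gaussian (v k m)) (t + 1))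
    · exact h.integrable_noise (integrable_noiseBound b (v k m)) (t + 1)
  refine i1.mono' ((measurable_moderate k m p b R).mul
    (measurable_roundDrift h b y t)).aestronglyMeasurable ?_
  filter_upwards [ae_reward_le h, second_phase_arms_le (R := R) h] with d h1 h2
  obtain ⟨hn, hn0, hw⟩ := lbwi_state h ht d
  rw [Real.norm_eq_abs]
  have hb0 : 0 ≤ b + |d.1 (.noise k m (t + 1))| := (abs_nonneg _).trans (h1 t)
  have hN := (noiseBound_pos b (d.1 (.noise k m (t + 1)))).le
  rcases moderate_mem k m p b R d with h3 | ⟨h3, h4⟩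
  · rw [h3, zero_mul, abs_zero]
    positivity
  · rw [h3, one_mul]
    refine (abs_drift_le hn0 hγ0 hγ hw _ _ _ hN).trans ?_
    have h5 := ((h2.2 h4).1).trans (le_abs_self _)
    rw [← hn] at h5
    have h6 : ((st t d).n : ℝ) / p.γ T ≤ |armsUpper p R T| / p.γ T := by gcongr
    have h7 : 0 ≤ ((st t d).n : ℝ) / p.γ T := by positivity
    refine add_le_add (mul_le_mul (by linarith) (h1 t) (abs_nonneg _) (by linarith)) le_rfl

/-- The drifts dominate the increments of the potential. These telescope to a final value that is
nonnegative minus an initial value that is bounded on the moderate event. -/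
lemma sum_roundDrift_ge (h : Env v π k m T (.lbwi p) ρ ε κ B st S) (hγ : p.γ T ≤ 1 / 2)
    {R y : ℝ} (r : ℕ)
    (hU : 0 ≤ armsUpper p R T / p.γ T * (Real.log (armsUpper p R T) + 2 * R)) :
    ∀ᵐ d ∂π, -(armsUpper p R T / p.γ T * (Real.log (armsUpper p R T) + 2 * R)) ≤
      ∑ t ∈ Finset.range r, moderate k m p (bound ε κ B) R d
        * roundDrift k m T p ρ ε κ (bound ε κ B) y st S (p.T₁ + t) d := by
  have hγ0 := p.γ_pos T
  filter_upwards [ae_reward_le h, second_phase_arms_le (R := R) h] with d h1 h2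
  rcases moderate_mem k m p (bound ε κ B) R d with h3 | ⟨h3, h4⟩
  · simp only [h3, zero_mul, Finset.sum_const_zero]; linarith
  · simp only [h3, one_mul]
    have key : ∀ r : ℕ, potential (p.γ T) (st (p.T₁ + r) d).n (st (p.T₁ + r) d).w
          (targetArm y (st (p.T₁ + r) d).n)
        - potential (p.γ T) (st p.T₁ d).n (st p.T₁ d).w (targetArm y (st p.T₁ d).n) ≤
        ∑ t ∈ Finset.range r, roundDrift k m T p ρ ε κ (bound ε κ B) y st S (p.T₁ + t) d := by
      intro r
      induction r with
      | zero => simp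
      | succ r ih =>
        rw [Finset.sum_range_succ]
        obtain ⟨hn, hn0, hw⟩ := lbwi_state h (Nat.le_add_right p.T₁ r) d
        obtain ⟨e1, e2⟩ := second_phase_step (p := p) (s := fun t => st t d)
          (δ := fun t => d.draw k m (t + 1)) (fun t => h.step t d) (Nat.le_add_right p.T₁ r)
        have h5 := potential_step hn0 hγ0 (by linarith) hw (select_lt hn0
          (LBWI.prob (p.γ T) (st (p.T₁ + r) d).n (st (p.T₁ + r) d).w)
          (d.1 (.arm k m (p.T₁ + r + 1)))) (targetArm y (st (p.T₁ + r) d).n)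
          (sq_mul_exp_le_noiseBound (h1 (p.T₁ + r)))
        rw [arm_of_le (Nat.le_add_right p.T₁ r)] at e2
        have e3 : st (p.T₁ + (r + 1)) d = st (p.T₁ + r + 1) d := rfl
        rw [e3]
        rw [e1, e2]
        exact (sub_add_sub_cancel' _ _ _).symm.le.trans (add_le_add ih h5)
    obtain ⟨-, hn0, hw⟩ := lbwi_state h (Nat.le_add_right p.T₁ r) d
    have h5 := potential_nonneg hγ0 hw (targetArm_lt y hn0)
    have h6 := (h2.2 h4).2 (targetArm y (st p.T₁ d).n)
    linarith [key r]

/-- The averaged drift compares the expected reward with that of the arm near `y`. Replacing `y` by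
a point of that arm costs `1 / n` times a Lipschitz constant; `hlow` keeps the point above `y / 2`.
-/
lemma lbwi_round (h : Env v π k m T (.lbwi p) ρ ε κ B st S) (hγ : p.γ T ≤ 1 / 2) {y : ℝ}
    (hy : y ∈ Set.Ioc (0 : ℝ) 1) (hlow : 2 / y ≤ armsLower p T) (R : ℝ) {t : ℕ} (ht : p.T₁ ≤ t) :
    ∫ d, moderate k m p (bound ε κ B) R d * (payoff ρ ε κ y (S t d)
        - payoff ρ ε κ (demand k m T (.lbwi p) st t d) (S t d)) ∂π ≤
      ∫ d, (-(moderate k m p (bound ε κ B) R d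
        * roundDrift k m T p ρ ε κ (bound ε κ B) y st S t d)
        + ((2 / y + |ε - κ|) / armsLower p T + 2 * p.γ T * (bound ε κ B
          + ∫ z, noiseBound (bound ε κ B) z ∂gaussianReal 0 (v k m)))) ∂π := by
  have hb := h.bound_pos
  set b := bound ε κ B with hbd
  have hγ0 := p.γ_pos T
  have hy01 := Set.Ioc_subset_Icc_self hy
  have hy0 := hy.1
  set C := ∫ z, noiseBound b z ∂gaussianReal 0 (v k m) with hC
  have hC0 : 0 ≤ C := integral_nonneg fun z => (noiseBound_pos b z).le
  have hA0 : 0 < armsLower p T := lt_of_lt_of_le (by positivity) hlow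
  set err := (2 / y + |ε - κ|) / armsLower p T + 2 * p.γ T * (b + C) with herr
  have herr0 : 0 ≤ err := by positivity
  set χ := moderate k m p b R with hχ
  have hχm : Measurable χ := measurable_moderate k m p b R
  have hχ1 : ∀ d, ‖χ d‖ ≤ 1 := fun d => by
    rcases moderate_mem k m p b R d with h3 | ⟨h3, -⟩ <;> rw [hχ, h3] <;> simp
  have hF := ((h.integrable_payoff_const hy01 t).sub (h.integrable_payoff_demand t)).bdd_mul
    (c := 1) hχm.aestronglyMeasurable (Eventually.of_forall hχ1)
  have hF' := (integrable_roundDrift h hγ R y ht).neg.add (integrable_const err)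
  -- Only the arm and the noise are averaged, the position in the interval stays fixed. The
  -- indicator `χ` depends on noise from the first phase only, so it acts as a constant.
  refine h.law.integral_le_of_resample hF hF' (.arm k m (t + 1)) (.noise k m (t + 1)) ?_
  filter_upwards [h.S_mem, h.law.ae_goodDraw, second_phase_arms_le (R := R) h] with d hd hg hlo
  obtain ⟨hn, hn0, hw⟩ := lbwi_state h ht d
  have hpos : d.1 (.pos k m (t + 1)) ∈ Set.Icc (0 : ℝ) 1 := (hg k m (t + 1)).pos
  have hst : ∀ a z, st t ((d.set (.arm k m (t + 1)) a).set (.noise k m (t + 1)) z) = st t d := by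
    intro a z
    rw [h.st_set _ _ _ _ (by simp [round]), h.st_set _ _ _ _ (by simp [round])]
  have hS : ∀ a z, S t ((d.set (.arm k m (t + 1)) a).set (.noise k m (t + 1)) z) = S t d := by
    intro a z
    rw [h.S_set _ _ _ _ (by simp [round]) rfl, h.S_set _ _ _ _ (by simp [round]) rfl]
  have hχs : ∀ a z, χ ((d.set (.arm k m (t + 1)) a).set (.noise k m (t + 1)) z) = χ d := by
    intro a z
    simp only [hχ, moderate]
    rw [firstReward_set (by simp only [round]; omega), firstReward_set (by simp only [round]; omega)]
  have ha : ∀ a z, ((d.set (.arm k m (t + 1)) a).set (.noise k m (t + 1)) z).1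
      (.arm k m (t + 1)) = a := fun a z => by
    rw [Data.set_apply_of_ne (by simp), Data.set_apply]
  have hp : ∀ a z, ((d.set (.arm k m (t + 1)) a).set (.noise k m (t + 1)) z).1
      (.pos k m (t + 1)) = d.1 (.pos k m (t + 1)) := fun a z => by
    rw [Data.set_apply_of_ne (by simp), Data.set_apply_of_ne (by simp)]
  simp only [roundDrift, lbwi_demand ht, hst, hS, hχs, ha,
    hp, Data.set_apply]
  set n := (st t d).n
  set w := (st t d).w
  set τ := d.1 (.pos k m (t + 1))
  set H : ℕ → ℝ := fun j => payoff ρ ε κ ((j + τ) / n) (S t d) with hH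
  set i := targetArm y n
  have hi : i < n := targetArm_lt y hn0
  have hn1 : (0 : ℝ) < n := by exact_mod_cast hn0
  have hz : ∀ j : ℕ, ∫ z, (-(χ d * drift (p.γ T) n w i j (H j + z) (noiseBound b z)) + err)
      ∂(Source.noise k m (t + 1)).law v = -(χ d * drift (p.γ T) n w i j (H j) C) + err := by
    intro j
    have i1 : Integrable (fun z => drift (p.γ T) n w i j (H j + z) (noiseBound b z))
        (gaussianReal 0 (v k m)) :=
      (((integrable_const (H j)).add (integrable_id_gaussian _)).const_mul _).add
        ((integrable_noiseBound b _).const_mul _)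
    simp only [Source.law]
    rw [integral_add (i1.const_mul (χ d)).fun_neg (integrable_const _), integral_neg,
      integral_const_mul, integral_drift]
    simp [hC]
  have hl : ∀ a, ∫ z, (-(χ d * drift (p.γ T) n w i (LBWI.select n (LBWI.prob (p.γ T) n w) a)
      (payoff ρ ε κ (((LBWI.select n (LBWI.prob (p.γ T) n w) a : ℕ) + τ) / n) (S t d) + z)
      (noiseBound b z)) + err) ∂(Source.noise k m (t + 1)).law v =
      -(χ d * drift (p.γ T) n w i (LBWI.select n (LBWI.prob (p.γ T) n w) a)
        (H (LBWI.select n (LBWI.prob (p.γ T) n w) a)) C) + err := fun a => hz _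
  simp only [hl, integral_const, probReal_univ, one_smul]
  have hq := fun j => (prob_pos hn0 hγ0 (p.γ_le_one T) hw j).le
  have hq1 := sum_prob (γ := p.γ T) hn0 hw
  have e1 := integral_select hn0 hq hq1 fun j => χ d * (payoff ρ ε κ y (S t d) - H j)
  have e2 := integral_select hn0 hq hq1 fun j => -(χ d * drift (p.γ T) n w i j (H j) C) + err
  change ∫ a in Set.Icc (0 : ℝ) 1, _ ≤ ∫ a in Set.Icc (0 : ℝ) 1, _
  refine (le_of_eq e1).trans (le_trans ?_ (le_of_eq e2.symm))
  have e3 : ∑ j ∈ Finset.range n, LBWI.prob (p.γ T) n w j *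
      (χ d * (payoff ρ ε κ y (S t d) - H j)) = χ d * (payoff ρ ε κ y (S t d)
        - ∑ j ∈ Finset.range n, LBWI.prob (p.γ T) n w j * H j) := by
    have : payoff ρ ε κ y (S t d) = ∑ j ∈ Finset.range n, LBWI.prob (p.γ T) n w j *
        payoff ρ ε κ y (S t d) := by rw [← Finset.sum_mul, hq1, one_mul]
    rw [this, ← Finset.sum_sub_distrib, Finset.mul_sum, ← this]
    exact Finset.sum_congr rfl fun j _ => by ring
  have e4 : ∑ j ∈ Finset.range n, LBWI.prob (p.γ T) n w j *
      (-(χ d * drift (p.γ T) n w i j (H j) C) + err) = err - χ d *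
        ∑ j ∈ Finset.range n, LBWI.prob (p.γ T) n w j * drift (p.γ T) n w i j (H j) C := by
    have : err = ∑ j ∈ Finset.range n, LBWI.prob (p.γ T) n w j * err := by
      rw [← Finset.sum_mul, hq1, one_mul]
    rw [Finset.mul_sum]
    nth_rewrite 2 [this]
    rw [← Finset.sum_sub_distrib]
    exact Finset.sum_congr rfl fun j _ => by ring
  rw [e3, e4]
  rcases moderate_mem k m p b R d with h3 | ⟨h3, -⟩
  · rw [← hχ] at h3
    rw [h3]; linarith
  rw [← hχ] at h3
  rw [h3, one_mul, one_mul]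
  have hHb : ∀ j < n, |H j| ≤ b := by
    intro j hj
    have hj1 : (j : ℝ) + 1 ≤ n := by exact_mod_cast hj
    refine abs_payoff_le h.ρ_pos ⟨?_, ?_⟩ (hd t)
    · have := hpos.1; positivity
    · rw [div_le_one hn1]; linarith [hpos.2]
  have h4 := sum_prob_mul_drift_le hn0 hγ0 hγ hw hi hHb hC0
  have h5 := abs_sub_targetArm_le hy hn0 hpos
  have hlo' : armsLower p T ≤ n := by rw [hn]; exact hlo.1
  have h6 : 1 / (n : ℝ) ≤ y / 2 := by
    rw [div_le_div_iff₀ hn1 (by norm_num)]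
    have := hlow.trans hlo'
    rw [div_le_iff₀ hy0] at this
    linarith
  have h7 := payoff_le_of_abs_sub_le (ε := ε) (κ := κ) h.ρ_pos hy0
    (x := (i + τ) / n) (by linarith [(abs_le.1 h5).2]) h5 (hd t).1
  have h8 : (2 / y + |ε - κ|) * (1 / n) ≤ (2 / y + |ε - κ|) / armsLower p T := by
    rw [mul_one_div]; gcongr
  have h9 : H i = payoff ρ ε κ ((i + τ) / n) (S t d) := rfl
  rw [← h9] at h7
  rw [herr]
  linarith

lemma integral_firstReward (h : Env v π k m T (.lbwi p) ρ ε κ B st S) (b : ℝ) :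
    Integrable (firstReward k m p b) π ∧ ∫ d, firstReward k m p b d ∂π =
      p.T₁ * (b + ∫ z, |z| ∂gaussianReal 0 (v k m)) := by
  have i1 : ∀ t, Integrable (fun d : Data K M => |d.1 (.noise k m (t + 1))|) π := fun t =>
    h.integrable_noise (integrable_abs_gaussian (v k m)) (t + 1)
  have i2 : ∀ t, Integrable (fun d : Data K M => b + |d.1 (.noise k m (t + 1))|) π := fun t =>
    (integrable_const b).add (i1 t)
  refine ⟨integrable_finsetSum _ fun t _ => i2 t, ?_⟩
  unfold firstReward
  rw [integral_finsetSum _ fun t _ => i2 t]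
  have : ∀ t, ∫ d : Data K M, (b + |d.1 (.noise k m (t + 1))|) ∂π =
      b + ∫ z, |z| ∂gaussianReal 0 (v k m) := fun t => by
    rw [integral_add (integrable_const _) (i1 t),
      h.integral_noise (integrable_abs_gaussian (v k m)) (t + 1)]
    simp
  simp only [this]
  simp
  ring

/-- The summands are, in this order, the cost of the first phase, the initial potential, and `T`
times the sum of a Markov bound for the event that is not moderate and the error of one round. -/
lemma lbwi_regret_le (h : Env v π k m T (.lbwi p) ρ ε κ B st S) (hγ : p.γ T ≤ 1 / 2) {y : ℝ}
    (hy : y ∈ Set.Ioc (0 : ℝ) 1) (hlow : 2 / y ≤ armsLower p T) {R : ℝ} (hR : 0 < R)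
    (hU : 0 ≤ armsUpper p R T / p.γ T * (Real.log (armsUpper p R T) + 2 * R)) (hT : p.T₁ ≤ T) :
    ∑ t ∈ Finset.range T, ∫ d, (payoff ρ ε κ y (S t d)
        - payoff ρ ε κ (demand k m T (.lbwi p) st t d) (S t d)) ∂π ≤
      2 * bound ε κ B * p.T₁
        + armsUpper p R T / p.γ T * (Real.log (armsUpper p R T) + 2 * R)
        + T * (2 * bound ε κ B * (p.T₁ * (bound ε κ B + ∫ z, |z| ∂gaussianReal 0 (v k m)) / R)
          + ((2 / y + |ε - κ|) / armsLower p T + 2 * p.γ T * (bound ε κ B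
            + ∫ z, noiseBound (bound ε κ B) z ∂gaussianReal 0 (v k m)))) := by
  have hb := h.bound_pos
  set b := bound ε κ B with hbd
  have hγ0 := p.γ_pos T
  have hy01 := Set.Ioc_subset_Icc_self hy
  have hy0 := hy.1
  have hA0 : 0 < armsLower p T := lt_of_lt_of_le (by positivity) hlow
  set C := ∫ z, noiseBound b z ∂gaussianReal 0 (v k m)
  have hC0 : 0 ≤ C := integral_nonneg fun z => (noiseBound_pos b z).le
  set err := (2 / y + |ε - κ|) / armsLower p T + 2 * p.γ T * (b + C) with herr
  have herr0 : 0 ≤ err := by positivity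
  set E := p.T₁ * (b + ∫ z, |z| ∂gaussianReal 0 (v k m)) with hE
  have hE0 : 0 ≤ E := mul_nonneg (Nat.cast_nonneg _)
    (add_nonneg hb.le (integral_nonneg fun z => abs_nonneg z))
  set UB := armsUpper p R T / p.γ T * (Real.log (armsUpper p R T) + 2 * R)
  set D : ℕ → Data K M → ℝ := fun t d => payoff ρ ε κ y (S t d)
        - payoff ρ ε κ (demand k m T (.lbwi p) st t d) (S t d) with hD
  have hDi : ∀ t, Integrable (D t) π := fun t =>
    (h.integrable_payoff_const hy01 t).sub (h.integrable_payoff_demand t)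
  have hDb : ∀ᵐ d ∂π, ∀ t, |D t d| ≤ 2 * b := by
    filter_upwards [h.S_mem, h.ae_abs_payoff_le] with d h1 h2 t
    have h3 := abs_payoff_le (ε := ε) (κ := κ) h.ρ_pos hy01 (h1 t)
    refine (abs_sub _ _).trans ?_
    have h4 := h2 t
    rw [← hbd] at h4
    have h5 : |payoff ρ ε κ y (S t d)| ≤ b := h3
    linarith
  have hfirst : ∀ t, ∫ d, D t d ∂π ≤ 2 * b := fun t => by
    have := integral_mono_ae (hDi t) (integrable_const (2 * b))
      (hDb.mono fun d hd => (le_abs_self _).trans (hd t))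
    simpa using this
  set χ := moderate k m p b R with hχ
  have hχ1 : ∀ d, ‖χ d‖ ≤ 1 := fun d => by
    rcases moderate_mem k m p b R d with h3 | ⟨h3, -⟩ <;> rw [hχ, h3] <;> simp
  obtain ⟨iQ, eQ⟩ := integral_firstReward h b
  have hχD : ∀ t, Integrable (fun d => χ d * D t d) π := fun t => (hDi t).bdd_mul
    (c := 1) (measurable_moderate k m p b R).aestronglyMeasurable (Eventually.of_forall hχ1)
  set Ψ : ℕ → Data K M → ℝ := fun t d => χ d * roundDrift k m T p ρ ε κ b y st S t d with hΨ
  have hΨi : ∀ t, p.T₁ ≤ t → Integrable (Ψ t) π := fun t ht => integrable_roundDrift h hγ R y ht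
  have hsecond : ∀ t, p.T₁ ≤ t → ∫ d, D t d ∂π ≤ -(∫ d, Ψ t d ∂π) + (2 * b * (E / R) + err) := by
    intro t ht
    -- Markov's inequality in pointwise form: where `χ` vanishes, `firstReward / R` exceeds one and
    -- `2 * b` bounds the regret.
    have h1 : ∫ d, D t d ∂π ≤ ∫ d, (χ d * D t d + 2 * b / R * firstReward k m p b d) ∂π := by
      refine integral_mono_ae (hDi t) ((hχD t).add (iQ.const_mul (2 * b / R))) ?_
      filter_upwards [hDb] with d hd
      have hQ0 : 0 ≤ firstReward k m p b d := Finset.sum_nonneg fun t _ => by positivity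
      by_cases hc : firstReward k m p b d ≤ R
      · have : χ d = 1 := if_pos hc
        rw [this, one_mul]
        have : 0 ≤ 2 * b / R * firstReward k m p b d := by positivity
        linarith
      · have : χ d = 0 := if_neg hc
        rw [this, zero_mul, zero_add]
        refine ((le_abs_self _).trans (hd t)).trans ?_
        rw [div_mul_eq_mul_div, le_div_iff₀ hR]
        push Not at hc
        gcongr
    rw [integral_add (hχD t) (iQ.const_mul _), integral_const_mul, eQ] at h1
    have h2 := lbwi_round h hγ hy hlow R ht
    rw [integral_add (hΨi t ht).fun_neg (integrable_const _), integral_neg] at h2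
    simp only [integral_const, probReal_univ, one_smul] at h2
    have e : 2 * b / R * E = 2 * b * (E / R) := by ring
    rw [e] at h1
    linarith
  obtain ⟨r, hr⟩ := Nat.exists_eq_add_of_le hT
  have hsumΨ : -UB ≤ ∑ t ∈ Finset.range r, ∫ d, Ψ (p.T₁ + t) d ∂π := by
    have i3 : ∀ t ∈ Finset.range r, Integrable (Ψ (p.T₁ + t)) π := fun t _ =>
      hΨi _ (Nat.le_add_right _ _)
    rw [← integral_finsetSum _ i3]
    have := integral_mono_ae (integrable_const (-UB)) (integrable_finsetSum _ i3)
      (sum_roundDrift_ge h hγ (y := y) r hU)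
    simpa using this
  have e0 : Finset.range T = Finset.range (p.T₁ + r) := by rw [← hr]
  have hrT : (r : ℝ) ≤ T := by
    have : r ≤ T := by omega
    exact_mod_cast this
  rw [e0, Finset.sum_range_add]
  have s1 : ∑ t ∈ Finset.range p.T₁, ∫ d, D t d ∂π ≤ 2 * b * p.T₁ := by
    refine (Finset.sum_le_sum fun t _ => hfirst t).trans_eq ?_
    simp; ring
  have s2 : ∑ t ∈ Finset.range r, ∫ d, D (p.T₁ + t) d ∂π ≤
      UB + T * (2 * b * (E / R) + err) := by
    refine (Finset.sum_le_sum fun t _ => hsecond _ (Nat.le_add_right p.T₁ t)).trans ?_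
    rw [Finset.sum_add_distrib, Finset.sum_neg_distrib]
    simp only [Finset.sum_const, Finset.card_range, nsmul_eq_mul]
    have : (r : ℝ) * (2 * b * (E / R) + err) ≤ T * (2 * b * (E / R) + err) := by gcongr
    linarith
  linarith

/-- The Lipschitz bandit with initialization has sublinear expected regret. -/
theorem lbwi_regret {st : ∀ T, ℕ → Data K M → ((Policy.lbwi p).learner T).State}
    {S : ℕ → ℕ → Data K M → ℝ}
    (h : ∀ᶠ T in atTop, Env v π k m T (.lbwi p) ρ ε κ B (st T) (S T)) {y : ℝ}
    (hy : y ∈ Set.Ioc (0 : ℝ) 1) {δ : ℝ} (hδ : 0 < δ) :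
    ∀ᶠ T in atTop, ∑ t ∈ Finset.range T, ∫ d, (payoff ρ ε κ y (S T t d)
        - payoff ρ ε κ (demand k m T (.lbwi p) (st T) t d) (S T t d)) ∂π ≤ δ * T := by
  obtain ⟨T₀, hT₀⟩ := h.exists
  have hb := hT₀.bound_pos
  have hy0 := hy.1
  set b := bound ε κ B with hbd
  set C := ∫ z, noiseBound b z ∂gaussianReal 0 (v k m) with hC
  have hC0 : 0 ≤ C := integral_nonneg fun z => (noiseBound_pos b z).le
  set E := p.T₁ * (b + ∫ z, |z| ∂gaussianReal 0 (v k m)) with hE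
  have hE0 : 0 ≤ E := mul_nonneg (Nat.cast_nonneg _)
    (add_nonneg hb.le (integral_nonneg fun z => abs_nonneg z))
  -- Five error terms receive `δ / 5` each. This `R` settles the Markov term and does not depend on
  -- `T`, as required for the growth estimate of the potential.
  set R := 2 * b * E / (δ / 5) + 1 with hR
  have hR0 : 0 < R := by positivity
  have hRE : 2 * b * (E / R) ≤ δ / 5 := by
    rw [← mul_div_assoc, div_le_iff₀ hR0, hR, mul_add, mul_div_cancel₀ _ (by positivity)]
    linarith
  set c := 2 / y + |ε - κ| with hc
  have hc0 : 0 < c := by positivity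
  filter_upwards [h, eventually_armsUpper_le p hR0.le (show 0 < δ / 5 by positivity),
    (tendsto_armsLower p).eventually_ge_atTop (2 / y),
    (tendsto_armsLower p).eventually_ge_atTop (c / (δ / 5)),
    p.γ_tendsto.eventually (ge_mem_nhds (show (0 : ℝ) < 1 / 2 by norm_num)),
    p.γ_tendsto.eventually (ge_mem_nhds (show 0 < δ / 5 / (2 * (b + C)) by positivity)),
    tendsto_natCast_atTop_atTop.eventually_ge_atTop (2 * b * p.T₁ / (δ / 5)),
    eventually_ge_atTop p.T₁] with T hT h1 h2 h3 h4 h5 h6 h7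
  have hγ0 := p.γ_pos T
  have hU : 0 ≤ armsUpper p R T / p.γ T * (Real.log (armsUpper p R T) + 2 * R) := by
    have e1 := Real.log_nonneg h1.1
    have e2 : 0 ≤ armsUpper p R T := by linarith [h1.1]
    positivity
  refine (lbwi_regret_le hT h4 hy h2 hR0 hU h7).trans ?_
  have hA : 0 < armsLower p T := lt_of_lt_of_le (by positivity) h2
  have f1 : 2 * b * p.T₁ ≤ δ / 5 * T := by
    rw [div_le_iff₀ (by positivity)] at h6; linarith
  have f2 : c / armsLower p T ≤ δ / 5 := by
    rw [div_le_iff₀ (by positivity)] at h3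
    rw [div_le_iff₀ hA]; linarith
  have f3 : 2 * p.γ T * (b + C) ≤ δ / 5 := by
    rw [le_div_iff₀ (by positivity)] at h5; linarith
  have f4 : T * (2 * b * (E / R) + (c / armsLower p T + 2 * p.γ T * (b + C))) ≤
      T * (3 * (δ / 5)) := by
    gcongr; linarith
  linarith [h1.2]

end LBWI

end FogGame

/-! Convergence of the repeated game -/

namespace FogGame

variable {K M : ℕ}

/-- Both policies have sublinear expected regret. -/
theorem Env.regret {v : Fin K → Fin M → ℝ≥0} {π : Measure (Data K M)} [IsProbabilityMeasure π]
    {k : Fin K} {m : Fin M} {P : Policy} {ρ ε κ B : ℝ}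
    {st : ∀ T, ℕ → Data K M → (P.learner T).State} {S : ℕ → ℕ → Data K M → ℝ}
    (h : ∀ᶠ T in atTop, Env v π k m T P ρ ε κ B (st T) (S T)) {y : ℝ}
    (hy : y ∈ Set.Ioc (0 : ℝ) 1) {δ : ℝ} (hδ : 0 < δ) :
    ∀ᶠ T in atTop, ∑ t ∈ Finset.range T, ∫ d, (payoff ρ ε κ y (S T t d)
        - payoff ρ ε κ (Env.demand k m T P (st T) t d) (S T t d)) ∂π ≤ δ * T := by
  cases P with
  | bgam p => exact bgam_regret h hy hδ
  | lbwi p => exact lbwi_regret h hy hδ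

lemma taskUtility_eq_payoff (G : TaskGame K M) (k : Fin K) (m : Fin M) (x : Fin K → ℝ) :
    G.taskUtility k m x = payoff (G.ρ k m) (G.ε k m) (G.κ k m) (x k)
      (∑ i ∈ Finset.univ.erase k, x i) := by
  unfold TaskGame.taskUtility TaskGame.share payoff gain
  rw [Finset.add_sum_erase _ _ (Finset.mem_univ k)]

lemma taskUtility_update (G : TaskGame K M) (k : Fin K) (m : Fin M) (x : Fin K → ℝ) (y : ℝ) :
    G.taskUtility k m (Function.update x k y) = payoff (G.ρ k m) (G.ε k m) (G.κ k m) y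
      (∑ i ∈ Finset.univ.erase k, x i) := by
  rw [taskUtility_eq_payoff, Function.update_self]
  congr 1
  refine Finset.sum_congr rfl fun i hi => ?_
  rw [Function.update_of_ne (Finset.ne_of_mem_erase hi)]

/-- The part `ε * S` contributed by the others is common to both payoffs, so only the net cost `κ -
ε` remains. -/
lemma excess_eq (G : TaskGame K M) (k : Fin K) (m : Fin M) (y : ℝ) (x : Fin K → ℝ) :
    excess (fun k => G.ρ k m) (fun k => G.κ k m - G.ε k m) k y x =
      payoff (G.ρ k m) (G.ε k m) (G.κ k m) y (∑ i ∈ Finset.univ.erase k, x i)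
        - payoff (G.ρ k m) (G.ε k m) (G.κ k m) (x k) (∑ i ∈ Finset.univ.erase k, x i) := by
  have h := Finset.add_sum_erase Finset.univ x (Finset.mem_univ k)
  have h' : ∑ i ∈ Finset.univ.erase k, x i = ∑ i, x i - x k := by linarith
  unfold excess payoff
  rw [h', add_sub_cancel]
  ring

lemma isEq_iff (G : TaskGame K M) (m : Fin M) (x : Fin K → ℝ) :
    IsEq (fun k => G.ρ k m) (fun k => G.κ k m - G.ε k m) x ↔
      (∀ k, x k ∈ Set.Icc (0 : ℝ) 1) ∧ ∀ k, ∀ y ∈ Set.Icc (0 : ℝ) 1,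
        G.taskUtility k m (Function.update x k y) ≤ G.taskUtility k m x := by
  refine and_congr_right fun _ => forall_congr' fun k => forall₂_congr fun y _ => ?_
  rw [taskUtility_update, taskUtility_eq_payoff, ← sub_nonpos, ← sub_nonpos (a := payoff _ _ _ _ _),
    ← excess_eq]
  rfl

lemma utility_update (G : TaskGame K M) (k : Fin K) (X : Fin K → Fin M → ℝ) (x : Fin M → ℝ) :
    G.utility k (Function.update X k x) =
      ∑ m, G.taskUtility k m (Function.update (fun i => X i m) k (x m)) := by
  refine Finset.sum_congr rfl fun m _ => ?_
  congr 1
  funext i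
  by_cases h : i = k
  · subst h; simp
  · simp [h]

/-- A joint action is a Nash equilibrium iff it is one for every task. -/
theorem isNash_iff (G : TaskGame K M) (X : Fin K → Fin M → ℝ) :
    G.IsNash X ↔ ∀ m, IsEq (fun k => G.ρ k m) (fun k => G.κ k m - G.ε k m) fun k => X k m := by
  simp only [isEq_iff]
  constructor
  · rintro ⟨h1, h2⟩ m
    refine ⟨fun k => h1 k m, fun k y hy => ?_⟩
    have h3 := h2 k (Function.update (X k) m y) fun m' => by
      rw [Function.update_apply]
      split_ifs
      exacts [hy, h1 k m']
    rw [utility_update, TaskGame.utility, ← Finset.add_sum_erase _ _ (Finset.mem_univ m),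
      ← Finset.add_sum_erase _ (fun m => G.taskUtility k m fun i => X i m) (Finset.mem_univ m)] at h3
    have h4 : ∑ m' ∈ Finset.univ.erase m, G.taskUtility k m'
        (Function.update (fun i => X i m') k (Function.update (X k) m y m')) =
        ∑ m' ∈ Finset.univ.erase m, G.taskUtility k m' fun i => X i m' := by
      refine Finset.sum_congr rfl fun m' hm => ?_
      rw [Function.update_of_ne (Finset.ne_of_mem_erase hm),
        Function.update_eq_self k fun i => X i m']
    rw [h4, Function.update_self] at h3
    linarith
  · intro h
    refine ⟨fun k m => (h m).1 k, fun k x hx => ?_⟩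
    rw [utility_update]
    exact Finset.sum_le_sum fun m _ => (h m).2 k (x m) (hx m)

/-! ### Regret and the law of the demand in a random round -/

section Play

variable {v : Fin K → Fin M → ℝ≥0} {π : Measure (Data K M)} [IsProbabilityMeasure π]

lemma play_set_of_node {s : Source K M} (G : TaskGame K M) (ℓ : Fin K → Fin M → Learner)
    (d : Data K M) (z : ℝ) {t : ℕ} (ht : t < round s) {i : Fin K} (hi : node s ≠ i) (m : Fin M) :
    (d.set s z).play G ℓ t i m = d.play G ℓ t i m := by
  simp only [Data.play, Data.joint, Data.states_set G ℓ d z t ht, Data.draw_set_of_node hi]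

/-- Every node with a task is a single learner in the environment formed by the other nodes. -/
theorem env_of_isLaw (h : IsLaw v π) (G : TaskGame K M) (pol : Fin K → Fin M → Policy) {T : ℕ}
    (h0 : 0 < T) (hT : ∀ k m, GoodHorizon T (pol k m)) (k : Fin K) (m : Fin M) :
    Env v π k m T (pol k m) (G.ρ k m) (G.ε k m) (G.κ k m) K
      (fun t d => d.states G (fun k m => (pol k m).learner T) t k m)
      (fun t d => ∑ i ∈ Finset.univ.erase k, d.play G (fun k m => (pol k m).learner T) t i m) where
  law := h
  T_pos := h0
  good := hT k m
  ρ_pos := G.ρ_pos k m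
  init _ := rfl
  step t d := by
    rw [Data.states]
    beta_reduce
    rw [taskUtility_eq_payoff]
    rfl
  meas t := measState_states G pol T t k m
  S_meas t := Finset.measurable_fun_sum _ fun i _ => measurable_play G pol T t i m
  S_mem := by
    filter_upwards [h.ae_goodDraw] with d hd t
    have h1 := fun i => play_mem G pol h0 hT hd t i m
    refine ⟨Finset.sum_nonneg fun i _ => (h1 i).1, ?_⟩
    refine (Finset.sum_le_sum_of_subset_of_nonneg (Finset.erase_subset k _)
      fun i _ _ => (h1 i).1).trans ?_
    exact sum_le_of_cube h1
  st_set s d z t ht := by rw [Data.states_set G _ d z t ht]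
  S_set s d z t ht hs := Finset.sum_congr rfl fun i hi =>
    play_set_of_node G _ d z ht (hs ▸ (Finset.ne_of_mem_erase hi).symm) m

/-- The law of the demands for one task in a uniformly chosen round. -/
noncomputable def demandLaw (G : TaskGame K M) (pol : Fin K → Fin M → Policy)
    (π : Measure (Data K M)) (m : Fin M) (T : ℕ) : Measure (Fin K → ℝ) :=
  -- The index is shifted to the horizon `T + 1`, so that this is a probability measure for every
  -- `T`.
  (T + 1 : ℝ≥0∞)⁻¹ • ∑ t ∈ Finset.range (T + 1),
    π.map fun d k => d.play G (fun k m => (pol k m).learner (T + 1)) t k m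

variable (G : TaskGame K M) (pol : Fin K → Fin M → Policy)

lemma measurable_demands (m : Fin M) (T t : ℕ) : Measurable fun (d : Data K M) k =>
    d.play G (fun k m => (pol k m).learner T) t k m :=
  measurable_pi_iff.2 fun k => measurable_play G pol T t k m

instance (m : Fin M) (T : ℕ) : IsProbabilityMeasure (demandLaw G pol π m T) := by
  constructor
  have h : ∀ t, (π.map fun (d : Data K M) k =>
      d.play G (fun k m => (pol k m).learner (T + 1)) t k m) Set.univ = 1 := fun t => by
    rw [Measure.map_apply (measurable_demands G pol m (T + 1) t) MeasurableSet.univ]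
    simp
  simp only [demandLaw, Measure.smul_apply, Measure.finsetSum_apply, h, smul_eq_mul]
  simp only [Finset.sum_const, Finset.card_range, nsmul_eq_mul, mul_one]
  push_cast
  exact ENNReal.inv_mul_cancel (by simp) (by finiteness)

omit [IsProbabilityMeasure π] in
lemma integral_demandLaw (m : Fin M) (T : ℕ) {φ : (Fin K → ℝ) → ℝ} (hφ : Measurable φ)
    (hi : ∀ t, Integrable (fun d : Data K M => φ fun k =>
      d.play G (fun k m => (pol k m).learner (T + 1)) t k m) π) :
    ∫ x, φ x ∂demandLaw G pol π m T = (∑ t ∈ Finset.range (T + 1), ∫ d, (φ fun k =>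
      d.play G (fun k m => (pol k m).learner (T + 1)) t k m) ∂π) / (T + 1) := by
  have hm := measurable_demands G pol m (T + 1)
  unfold demandLaw
  rw [integral_smul_measure, integral_finsetSum_measure fun t _ =>
    (integrable_map_measure hφ.aestronglyMeasurable (hm t).aemeasurable).2 (hi t)]
  have : ∀ t, ∫ x, φ x ∂(π.map fun (d : Data K M) k =>
      d.play G (fun k m => (pol k m).learner (T + 1)) t k m) = ∫ d, (φ fun k =>
      d.play G (fun k m => (pol k m).learner (T + 1)) t k m) ∂π := fun t =>
    integral_map (hm t).aemeasurable hφ.aestronglyMeasurable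
  simp only [this]
  have e : ((T + 1 : ℝ≥0∞)⁻¹).toReal = (T + 1 : ℝ)⁻¹ := by
    rw [ENNReal.toReal_inv]
    congr 1
  rw [e, smul_eq_mul, inv_mul_eq_div]

lemma ae_demandLaw (h : IsLaw v π) (m : Fin M) {T : ℕ}
    (hT : ∀ k m, GoodHorizon (T + 1) (pol k m)) :
    ∀ᵐ x ∂demandLaw G pol π m T, ∀ k, x k ∈ Set.Icc (0 : ℝ) 1 := by
  refine Measure.ae_smul_measure ?_ _
  have hS : MeasurableSet {x : Fin K → ℝ | ∀ k, x k ∈ Set.Icc (0 : ℝ) 1} := by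
    rw [Set.ofPred_forall]
    exact MeasurableSet.iInter fun k => measurableSet_Icc.preimage (by fun_prop)
  rw [ae_iff, Measure.finsetSum_apply]
  refine Finset.sum_eq_zero fun t _ => ?_
  rw [← ae_iff, ae_map_iff (measurable_demands G pol m (T + 1) t).aemeasurable hS]
  filter_upwards [h.ae_goodDraw] with d hd k
  exact play_mem G pol T.succ_pos hT hd t k m

lemma eventually_forall_goodHorizon :
    ∀ᶠ T in atTop, ∀ k m, GoodHorizon T (pol k m) :=
  eventually_all.2 fun k => eventually_all.2 fun m => eventually_goodHorizon (pol k m)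

/-- The mean excess under `demandLaw` is precisely the expected regret per round, to which
`Env.regret` applies. -/
lemma eventually_integral_excess_le (h : IsLaw v π) (m : Fin M) (k : Fin K) {y : ℝ}
    (hy : y ∈ Set.Ioc (0 : ℝ) 1) {δ : ℝ} (hδ : 0 < δ) :
    ∀ᶠ T in atTop, ∫ x, excess (fun k => G.ρ k m) (fun k => G.κ k m - G.ε k m) k y x
      ∂demandLaw G pol π m T ≤ δ := by
  have h1 : ∀ᶠ T in atTop, Env v π k m T (pol k m) (G.ρ k m) (G.ε k m) (G.κ k m) K
      (fun t d => d.states G (fun k m => (pol k m).learner T) t k m)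
      (fun t d => ∑ i ∈ Finset.univ.erase k,
        d.play G (fun k m => (pol k m).learner T) t i m) := by
    filter_upwards [eventually_gt_atTop 0, eventually_forall_goodHorizon pol] with T h0 hT
    exact env_of_isLaw h G pol h0 hT k m
  have h2 := Env.regret h1 hy hδ
  filter_upwards [(tendsto_add_atTop_nat 1).eventually h1, (tendsto_add_atTop_nat 1).eventually h2]
    with T hE hr
  have e : ∀ t (d : Data K M), excess (fun k => G.ρ k m) (fun k => G.κ k m - G.ε k m) k y
      (fun k => d.play G (fun k m => (pol k m).learner (T + 1)) t k m) =
      payoff (G.ρ k m) (G.ε k m) (G.κ k m) y (∑ i ∈ Finset.univ.erase k,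
        d.play G (fun k m => (pol k m).learner (T + 1)) t i m)
        - payoff (G.ρ k m) (G.ε k m) (G.κ k m) (Env.demand k m (T + 1) (pol k m)
          (fun t d => d.states G (fun k m => (pol k m).learner (T + 1)) t k m) t d)
          (∑ i ∈ Finset.univ.erase k,
            d.play G (fun k m => (pol k m).learner (T + 1)) t i m) := fun t d =>
    excess_eq G k m y _
  rw [integral_demandLaw G pol m T (measurable_excess k y) fun t => ?_]
  · simp only [e]
    rw [div_le_iff₀ (by positivity)]
    exact_mod_cast hr
  · simp only [e]
    exact (hE.integrable_payoff_const (Set.Ioc_subset_Icc_self hy) t).sub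
      (hE.integrable_payoff_demand t)

/-- The demands converge to an equilibrium of the task, in the mean over all rounds. -/
theorem exists_isEq_tendsto_play (h : IsLaw v π) (hK : 2 ≤ K) (m : Fin M)
    (hρ : ∀ k, 1 / 2 < G.ρ k m)
    (hne : ∀ k, G.κ k m = G.ε k m → ∃ j, j ≠ k ∧ G.κ j m - G.ε j m ≤ 1) :
    ∃ x, IsEq (fun k => G.ρ k m) (fun k => G.κ k m - G.ε k m) x ∧
      ∀ k, Tendsto (fun T : ℕ => (∑ t ∈ Finset.range T,
        ∫ d, |Data.play G (fun k m => (pol k m).learner T) t d k m - x k| ∂π) / T) atTop (𝓝 0) := by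
  have hne' : ∀ k, G.κ k m - G.ε k m = 0 → ∃ j, j ≠ k ∧ G.κ j m - G.ε j m ≤ 1 := fun k hk =>
    hne k (sub_eq_zero.1 hk)
  have hgood := (tendsto_add_atTop_nat 1).eventually (eventually_forall_goodHorizon pol)
  have key : ∀ U : Ultrafilter ℕ, (U : Filter ℕ) ≤ atTop →
      ∃ x, IsEq (fun k => G.ρ k m) (fun k => G.κ k m - G.ε k m) x ∧
        ∀ k, Tendsto (fun T => ∫ z, |z k - x k| ∂demandLaw G pol π m T) U (𝓝 0) := fun U hU =>
    exists_isEq_tendsto_of_regret hK hρ hne'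
      (hU (hgood.mono fun T hT => ae_demandLaw G pol h m hT))
      fun k y hy δ hδ => hU (eventually_integral_excess_le G pol h m k hy hδ)
  -- Any ultrafilter finer than `atTop` produces an equilibrium; by uniqueness all of them have the
  -- same limit, so convergence holds along `atTop`.
  obtain ⟨x, hx, -⟩ := key (Ultrafilter.of atTop) (Ultrafilter.of_le atTop)
  refine ⟨x, hx, fun k => ?_⟩
  have h1 : Tendsto (fun T => ∫ z, |z k - x k| ∂demandLaw G pol π m T) atTop (𝓝 0) := by
    rw [tendsto_iff_ultrafilter]
    intro U hU
    obtain ⟨x', hx', ht⟩ := key U hU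
    have : x' = x := hx'.unique hK (fun k => G.ρ_pos k m) hne' hx
    exact this ▸ ht k
  rw [← tendsto_add_atTop_iff_nat 1]
  refine h1.congr' ?_
  filter_upwards [hgood] with T hT
  rw [integral_demandLaw G pol m T (φ := fun z => |z k - x k|) (by fun_prop) fun t => ?_]
  · push_cast; rfl
  · refine Integrable.of_bound (((measurable_play G pol (T + 1) t k m).sub_const
      (x k)).abs).aestronglyMeasurable 1 ?_
    filter_upwards [h.ae_goodDraw] with d hd
    have h2 := play_mem G pol T.succ_pos hT hd t k m
    have h3 := hx.1 k
    rw [Real.norm_eq_abs, abs_abs, abs_le]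
    constructor <;> linarith [h2.1, h2.2, h3.1, h3.2]

end Play

/-! ### From convergence in mean to convergence in probability -/

section Average

variable {v : Fin K → Fin M → ℝ≥0} {Ω : Type*} [MeasurableSpace Ω] {μ : Measure Ω}

lemma measurable_randomness_play (R : Randomness K M v μ) (G : TaskGame K M)
    (pol : Fin K → Fin M → Policy) (T t : ℕ) (k : Fin K) (m : Fin M) :
    Measurable fun ω => R.play G (fun k m => (pol k m).learner T) t ω k m := by
  simp only [play_data]
  exact (measurable_play G pol T t k m).comp (measurable_data R)

lemma measurable_averagePlay (R : Randomness K M v μ) (G : TaskGame K M)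
    (pol : Fin K → Fin M → Policy) (T : ℕ) :
    Measurable fun ω => R.averagePlay G pol T ω :=
  measurable_pi_iff.2 fun k => measurable_pi_iff.2 fun m =>
    (Finset.measurable_fun_sum _ fun t _ => measurable_randomness_play R G pol T t k m).div_const _

/-- The deviation of the average is at most the average of the deviations, so the hypothesis gives
convergence in `L¹`, which implies convergence in measure. The sup norm of the joint action is
bounded by the sum over nodes and tasks. -/
theorem tendstoInMeasure_averagePlay [IsProbabilityMeasure μ] (R : Randomness K M v μ) (G : TaskGame K M)
    (pol : Fin K → Fin M → Policy) (X : Fin K → Fin M → ℝ)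
    (h : ∀ k m, Tendsto (fun T : ℕ => (∑ t ∈ Finset.range T,
      ∫ d, |Data.play G (fun k m => (pol k m).learner T) t d k m - X k m| ∂μ.map (data R)) / T)
      atTop (𝓝 0)) :
    TendstoInMeasure μ (fun T ω => R.averagePlay G pol T ω) atTop (fun _ => X) := by
  have hm := measurable_data R
  have hπ : IsProbabilityMeasure (μ.map (data R)) :=
    Measure.isProbabilityMeasure_map hm.aemeasurable
  have hlaw := isLaw_data R
  refine tendstoInMeasure_of_tendsto_eLpNorm one_ne_zero
    (fun T => (measurable_averagePlay R G pol T).aestronglyMeasurable)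
    aestronglyMeasurable_const ?_
  have hsum : Tendsto (fun T : ℕ => ENNReal.ofReal (∑ k, ∑ m, (∑ t ∈ Finset.range T,
      ∫ d, |Data.play G (fun k m => (pol k m).learner T) t d k m - X k m| ∂μ.map (data R)) / T))
      atTop (𝓝 0) := by
    have := ENNReal.tendsto_ofReal (tendsto_finsetSum Finset.univ fun k _ =>
      tendsto_finsetSum Finset.univ fun m _ => h k m)
    simpa using this
  refine tendsto_of_tendsto_of_tendsto_of_le_of_le' tendsto_const_nhds hsum
    (Eventually.of_forall fun T => zero_le) ?_
  filter_upwards [eventually_gt_atTop 0, eventually_forall_goodHorizon pol] with T h0 hT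
  have hT0 : (0 : ℝ) < T := by exact_mod_cast h0
  have hi : ∀ t k m, Integrable (fun ω =>
      |R.play G (fun k m => (pol k m).learner T) t ω k m - X k m|) μ := fun t k m => by
    refine Integrable.of_bound (((measurable_randomness_play R G pol T t k m).sub_const
      _).abs).aestronglyMeasurable (1 + |X k m|) ?_
    filter_upwards [ae_of_ae_map hm.aemeasurable hlaw.ae_goodDraw] with ω hω
    have h2 := play_mem G pol h0 hT hω t k m
    rw [← play_data] at h2
    rw [Real.norm_eq_abs, abs_abs]
    refine (abs_sub _ _).trans (add_le_add ?_ le_rfl)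
    rw [abs_le]; constructor <;> linarith [h2.1, h2.2]
  have hi' : ∀ k m, Integrable (fun ω => (∑ t ∈ Finset.range T,
      |R.play G (fun k m => (pol k m).learner T) t ω k m - X k m|) / T) μ := fun k m =>
    (integrable_finsetSum _ fun t _ => hi t k m).div_const _
  have he : ∀ t k m, ∫ d, |Data.play G (fun k m => (pol k m).learner T) t d k m - X k m|
      ∂μ.map (data R) = ∫ ω, |R.play G (fun k m => (pol k m).learner T) t ω k m - X k m| ∂μ := by
    intro t k m
    rw [integral_map hm.aemeasurable (((measurable_play G pol T t k m).sub_const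
      _).abs).aestronglyMeasurable]
    simp only [play_data]
  have hle : ∀ ω, ‖R.averagePlay G pol T ω - X‖ ≤ ∑ k, ∑ m, (∑ t ∈ Finset.range T,
      |R.play G (fun k m => (pol k m).learner T) t ω k m - X k m|) / T := by
    intro ω
    have hnn : ∀ k m, 0 ≤ (∑ t ∈ Finset.range T,
      |R.play G (fun k m => (pol k m).learner T) t ω k m - X k m|) / T := fun k m => by positivity
    have hnn' : ∀ k, 0 ≤ ∑ m, (∑ t ∈ Finset.range T,
      |R.play G (fun k m => (pol k m).learner T) t ω k m - X k m|) / T := fun k =>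
      Finset.sum_nonneg fun m _ => hnn k m
    refine (pi_norm_le_iff_of_nonneg (Finset.sum_nonneg fun k _ => hnn' k)).2 fun k => ?_
    refine le_trans ?_ (Finset.single_le_sum (fun k _ => hnn' k) (Finset.mem_univ k))
    refine (pi_norm_le_iff_of_nonneg (hnn' k)).2 fun m => ?_
    refine le_trans ?_ (Finset.single_le_sum (fun m _ => hnn k m) (Finset.mem_univ m))
    have e : (R.averagePlay G pol T ω - X) k m = (∑ t ∈ Finset.range T,
        (R.play G (fun k m => (pol k m).learner T) t ω k m - X k m)) / T := by
      simp only [Pi.sub_apply, Randomness.averagePlay]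
      rw [Finset.sum_sub_distrib]
      simp only [Finset.sum_const, Finset.card_range, nsmul_eq_mul]
      field_simp
    rw [e, Real.norm_eq_abs, abs_div, abs_of_pos hT0]
    gcongr
    exact Finset.abs_sum_le_sum_abs _ _
  have hi'' : Integrable (fun ω => ∑ k, ∑ m, (∑ t ∈ Finset.range T,
      |R.play G (fun k m => (pol k m).learner T) t ω k m - X k m|) / T) μ :=
    integrable_finsetSum _ fun k _ => integrable_finsetSum _ fun m _ => hi' k m
  calc eLpNorm ((fun ω => R.averagePlay G pol T ω) - fun _ => X) 1 μ
      = ∫⁻ ω, ‖R.averagePlay G pol T ω - X‖ₑ ∂μ := by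
        rw [eLpNorm_one_eq_lintegral_enorm]; rfl
    _ ≤ ∫⁻ ω, ENNReal.ofReal (∑ k, ∑ m, (∑ t ∈ Finset.range T,
        |R.play G (fun k m => (pol k m).learner T) t ω k m - X k m|) / T) ∂μ :=
        lintegral_mono fun ω => by
          rw [← ofReal_norm]
          exact ENNReal.ofReal_le_ofReal (hle ω)
    _ = ENNReal.ofReal (∫ ω, ∑ k, ∑ m, (∑ t ∈ Finset.range T,
        |R.play G (fun k m => (pol k m).learner T) t ω k m - X k m|) / T ∂μ) :=
        (ofReal_integral_eq_lintegral_ofReal hi'' (Eventually.of_forall fun ω =>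
          (norm_nonneg _).trans (hle ω))).symm
    _ ≤ _ := by
        refine ENNReal.ofReal_le_ofReal (le_of_eq ?_)
        rw [integral_finsetSum _ fun k _ => integrable_finsetSum _ fun m _ => hi' k m]
        refine Finset.sum_congr rfl fun k _ => ?_
        rw [integral_finsetSum _ fun m _ => hi' k m]
        refine Finset.sum_congr rfl fun m _ => ?_
        rw [integral_div, integral_finsetSum _ fun t _ => hi t k m]
        simp only [he]

end Average

end FogGame

theorem proposition8 {K M : ℕ} (hK : 2 ≤ K) (G : TaskGame K M)
    (hρ : ∀ k m, 1 / 2 < G.ρ k m)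
    (hne : ∀ k m, G.κ k m = G.ε k m → ∃ j, j ≠ k ∧ G.κ j m - G.ε j m ≤ 1)
    (pol : Fin K → Fin M → Policy)
    {Ω : Type*} [MeasurableSpace Ω] (μ : Measure Ω) [IsProbabilityMeasure μ]
    (v : Fin K → Fin M → ℝ≥0) (R : Randomness K M v μ) :
    ∃ Xstar : Fin K → Fin M → ℝ,
      G.IsNash Xstar ∧ (∀ Y, G.IsNash Y → Y = Xstar) ∧
        TendstoInMeasure μ (fun T ω => R.averagePlay G pol T ω) atTop (fun _ => Xstar) := by
  have hπ : IsProbabilityMeasure (μ.map (FogGame.data R)) :=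
    Measure.isProbabilityMeasure_map (FogGame.measurable_data R).aemeasurable
  choose x hx ht using fun m => FogGame.exists_isEq_tendsto_play G pol (FogGame.isLaw_data R) hK m
    (fun k => hρ k m) fun k => hne k m
  refine ⟨fun k m => x m k, (FogGame.isNash_iff G _).2 hx, fun Y hY => ?_,
    FogGame.tendstoInMeasure_averagePlay R G pol _ fun k m => ht m k⟩
  funext k m
  exact congrFun (((FogGame.isNash_iff G Y).1 hY m).unique hK (fun k => G.ρ_pos k m)
    (fun k hk => hne k m (sub_eq_zero.1 hk)) (hx m)) k
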